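/- Let $\varepsilon,\Lambda\in\mathbb R$. For functions $H(x,y)$, $R$, $F(x)$, $G(y)$ consider the ambitoric metric ansatz in coordinates $(\tau,\varphi,x,y)$ $$g_{\mathrm{amb}}=\frac1{H^2}\Big[\frac{F}{A(x-y)}(d\tau-y\,d\varphi)^2+\frac{x-y}{FA}dx^2+\frac{x-y}{BG}dy^2+\frac{G}{B(x-y)}(d\tau-x\,d\varphi)^2\Big],\qquad A=\sqrt{R(x)},\ B=\sqrt{R(y)},$$ in the case $H=1+\varepsilon\sqrt{xy}$, $R(z)=z$, and for functions $C(r)$, $D(q)$ the metric in coordinates $(\tau,\varphi,r,q)$ $$g_{C,D}=\frac{1}{(1+\varepsilon rq)^2}\Big[\frac{C}{r^2-q^2}(d\tau-q^2d\varphi)^2+\frac{r^2-q^2}{C}dr^2+\frac{r^2-q^2}{D}dq^2+\frac{D}{r^2-q^2}(d\tau-r^2d\varphi)^2\Big].$$ For $b,m,n,k\in\mathbb R$ put $$C_{b,m,n,k}(r)=-b+2mr+kr^2+2n\varepsilon r^3-\big(\varepsilon^2b+\tfrac{\Lambda}{3}\big)r^4,\qquad D_{b,m,n,k}(q)=b+2nq-kq^2+2m\varepsilon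 q^3+\big(\varepsilon^2b+\tfrac{\Lambda}{3}\big)q^4 .$$ A metric is called Einstein with constant $\Lambda$ if $\mathrm{Ric}=\Lambda g$. Then: 1. For $r,q>0$, the substitution $x=r^2$, $y=q^2$ together with $(\tau,\varphi)\mapsto(\tau/2,\varphi/2)$ pulls $g_{\mathrm{amb}}$ back to $g_{C,D}$ with $C(r)=F(r^2)/(4r)$, $D(q)=G(q^2)/(4q)$. 2. Let $V\subset\mathbb R^2$ be open and connected, let $F,G$ be smooth on the projections of $V$, and suppose that on $V$ one has $x,y>0$, $x\ne y$, $1+\varepsilon\sqrt{xy}\neq0$, $F/(x-y)>0$, $G/(x-y)>0$ (so $g_{\mathrm{amb}}$ is Riemannian). Then $g_{\mathrm{amb}}$ is Einstein with constant $\Lambda$ over $V$ if and only if there are $b,m,n,k\in\mathbb R$ with $F(x)=4\sqrt x\,C_{b,m,n,k}(\sqrt x)$ and $G(y)=4\sqrt y\,D_{b,m,n,k}(\sqrt y)$ for all $(x,y)\in V$. 3. Let $U\subset\mathbb R^2$ be open and connected, let $C,D$ be smooth on the projections of $U$, and suppose that on $U$ one has $r^2\neq q^2$, $1+\varepsilon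 rq\ne0$, $C/(r^2-q^2)>0$, $D/(r^2-q^2)>0$ (so $g_{C,D}$ is Riemannian). Then $g_{C,D}$ is Einstein with constant $\Lambda$ over $U$ if and only if there are $b,m,n,k\in\mathbb R$ with $C=C_{b,m,n,k}$ and $D=D_{b,m,n,k}$ on $U$. 4. If $k>0$, the rescaling $(\tau,\varphi,r,q)\mapsto(\tau/\sqrt k,\ \varphi/\sqrt k^{\,3},\ \sqrt k\,r,\ \sqrt k\,q)$ pulls the metric with parameters $(b,m,n,k,\varepsilon,\Lambda)$ back to the one with parameters $(b/k^2,\ m/k^{3/2},\ n/k^{3/2},\ 1,\ k\varepsilon,\ \Lambda)$. Thus $k$ can be normalised to $1$, which gives the Euclidean Plebański–Demiański metrics with $$C=-b+2mr+r^2+2n\varepsilon r^3-(\varepsilon^2b+\Lambda/3)r^4,\qquad D=b+2nq-q^2+2m\varepsilon q^3+(\varepsilon^2b+\Lambda/3)q^4 .$$ 5. At every point where the metric with $C=C_{b,m,n,k}$, $D=D_{b,m,n,k}$ is Riemannian in the sense of item 3, it is of type $D\otimes D$. More precisely, the covectors $$e^0=\tfrac{1}{1+\varepsilon rq}\sqrt{\tfrac{C}{r^2-q^2}}(d\tau-q^2d\varphi),\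 \ e^1=\tfrac{1}{1+\varepsilon rq}\sqrt{\tfrac{r^2-q^2}{C}}\,dr,\ \ e^2=\tfrac{1}{1+\varepsilon rq}\sqrt{\tfrac{r^2-q^2}{D}}\,dq,\ \ e^3=\tfrac{1}{1+\varepsilon rq}\sqrt{\tfrac{D}{r^2-q^2}}(d\tau-r^2d\varphi)$$ form an orthonormal coframe, and the Weyl tensor, acting on 2-forms by $\beta_{ab}\mapsto\frac12W_{ab}{}^{cd}\beta_{cd}$ (with the sign of the curvature for which the unit sphere has curvature operator $+1$), acts on the 2-forms $e^0\wedge e^i-\frac12\epsilon^{ijk}e^j\wedge e^k$, $i=1,2,3$, as $\mathrm{diag}(2\alpha,-\alpha,-\alpha)$ and on the 2-forms $e^0\wedge e^i+\frac12\epsilon^{ijk}e^j\wedge e^k$ as $\mathrm{diag}(2\bar\alpha,-\bar\alpha,-\bar\alpha)$, where $$\alpha=(n-m)\Big(\frac{1+\varepsilon rq}{r+q}\Big)^3,\qquad \bar\alpha=-(n+m)\Big(\frac{1+\varepsilon rq}{r-q}\Big)^3 .$$ 6. Euclidean Kerr is the case $\Lambda=\varepsilon=n=0$, $k=1$, $b=a^2$,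 $m=-M$: for $M\in\mathbb R$, $a\neq0$ and the substitution $\tau=t-a\phi$, $\varphi=-\phi/a$, $q=a\cos\theta$, this metric becomes $$\Big(1-\frac{2Mr}{\rho^2}\Big)dt^2+\frac{\rho^2}{\Delta}dr^2+\rho^2d\theta^2+\Big(r^2-a^2-\frac{2Mra^2}{\rho^2}\sin^2\theta\Big)\sin^2\theta\,d\phi^2+\frac{4Mra\sin^2\theta}{\rho^2}dt\,d\phi,$$ with $\rho^2=r^2-a^2\cos^2\theta$, $\Delta=r^2-2Mr-a^2$, wherever $\sin\theta$, $\rho^2$ and $\Delta$ do not vanish. -/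

import Mathlib

open scoped ContDiff

noncomputable section

namespace Ambitoric

/-! ### Riemannian curvature in a coordinate chart of dimension four -/

/-- Points of a coordinate chart. -/
abbrev Pt : Type := Fin 4 → ℝ

/-- A field of `4 × 4` matrices: the components `g_{ab}` of a metric in a chart. -/
abbrev MetricField : Type := Pt → Matrix (Fin 4) (Fin 4) ℝ

/-- The partial derivative `∂_a f` at `x`. -/
def pderiv (a : Fin 4) (f : Pt → ℝ) (x : Pt) : ℝ :=
  deriv (fun t => f (Function.update x a t)) (x a)

/-- The Christoffel symbols
`Γ^a_{bc} = ½ g^{ad} (∂_b g_{dc} + ∂_c g_{db} - ∂_d g_{bc})` of the Levi-Civita connection. -/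
def christoffel (g : MetricField) (a b c : Fin 4) (x : Pt) : ℝ :=
  ∑ d, (g x)⁻¹ a d *
    (pderiv b (fun z => g z d c) x + pderiv c (fun z => g z d b) x
      - pderiv d (fun z => g z b c) x) / 2

/-- The Riemann tensor
`R^a_{bcd} = ∂_c Γ^a_{db} - ∂_d Γ^a_{cb} + Γ^a_{ce} Γ^e_{db} - Γ^a_{de} Γ^e_{cb}`. -/
def riemann (g : MetricField) (a b c d : Fin 4) (x : Pt) : ℝ :=
  pderiv c (christoffel g a d b) x - pderiv d (christoffel g a c b) x
    + ∑ e, (christoffel g a c e x * christoffel g e d b x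
        - christoffel g a d e x * christoffel g e c b x)

/-- The Riemann tensor with all indices down, `R_{abcd} = g_{ae} R^e_{bcd}`. With this convention
`R_{abcd} = g_{ac} g_{bd} - g_{ad} g_{bc}` on the unit sphere. -/
def riemannLow (g : MetricField) (a b c d : Fin 4) (x : Pt) : ℝ :=
  ∑ e, g x a e * riemann g e b c d x

/-- The Ricci tensor `Ric_{bd} = R^a_{bad}`. -/
def ricci (g : MetricField) (b d : Fin 4) (x : Pt) : ℝ :=
  ∑ a, riemann g a b a d x

/-- The scalar curvature `g^{ab} Ric_{ab}`. -/
def scalarCurv (g : MetricField) (x : Pt) : ℝ :=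
  ∑ a, ∑ b, (g x)⁻¹ a b * ricci g a b x

/-- The Weyl tensor `W_{abcd}` in dimension four. -/
def weyl (g : MetricField) (a b c d : Fin 4) (x : Pt) : ℝ :=
  riemannLow g a b c d x
    - (g x a c * ricci g b d x - g x a d * ricci g b c x
        - g x b c * ricci g a d x + g x b d * ricci g a c x) / 2
    + scalarCurv g x / 6 * (g x a c * g x b d - g x a d * g x b c)

/-- `g` is Einstein on `S` with constant `Λ`: `Ric = Λ g`. -/
def IsEinsteinOn (g : MetricField) (Λ : ℝ) (S : Set Pt) : Prop :=
  ∀ x ∈ S, ∀ a b, ricci g a b x = Λ * g x a b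

/-- The pullback `(Φ^* g)_{ab} = ∂_a Φ^c ∂_b Φ^d (g_{cd} ∘ Φ)`. -/
def pullback (Φ : Pt → Pt) (g : MetricField) : MetricField := fun x =>
  Matrix.of fun a b => ∑ c, ∑ d,
    pderiv a (fun z => Φ z c) x * pderiv b (fun z => Φ z d) x * g (Φ x) c d

/-! ### The two halves of the Weyl tensor -/

/-- The action of the Weyl tensor on 2-forms, `(W β)_{ab} = ½ W_{ab}^{cd} β_{cd}`. A 2-form is
given by its (antisymmetric) matrix of components. -/
def weylOp (g : MetricField) (x : Pt) (β : Matrix (Fin 4) (Fin 4) ℝ) :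
    Matrix (Fin 4) (Fin 4) ℝ :=
  Matrix.of fun a b => (∑ c, ∑ d, ∑ p, ∑ q,
    weyl g a b c d x * (g x)⁻¹ c p * (g x)⁻¹ d q * β p q) / 2

/-- The components of the wedge product `u ∧ v` of two covectors. -/
def wedge (u v : Fin 4 → ℝ) : Matrix (Fin 4) (Fin 4) ℝ :=
  Matrix.of fun a b => u a * v b - u b * v a

/-- The covectors `e 0, e 1, e 2, e 3` form an orthonormal coframe of `g` at `x`:
`g = ∑ e^I ⊗ e^I`. -/
def IsOrthonormalCoframeAt (g : MetricField) (x : Pt) (e : Fin 4 → Fin 4 → ℝ) : Prop :=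
  ∀ a b, g x a b = ∑ I, e I a * e I b

/-- The basis `Σ^i = e^0 ∧ e^i - ½ ε^{ijk} e^j ∧ e^k` of the self-dual 2-forms; the index
`i = 0, 1, 2` here stands for `i = 1, 2, 3`, and `i + 1`, `i + 2` are taken modulo `3`. -/
def sdForm (e : Fin 4 → Fin 4 → ℝ) (i : Fin 3) : Matrix (Fin 4) (Fin 4) ℝ :=
  wedge (e 0) (e i.succ) - wedge (e (i + 1).succ) (e (i + 2).succ)

/-- The basis `e^0 ∧ e^i + ½ ε^{ijk} e^j ∧ e^k` of the anti-self-dual 2-forms. -/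
def asdForm (e : Fin 4 → Fin 4 → ℝ) (i : Fin 3) : Matrix (Fin 4) (Fin 4) ℝ :=
  wedge (e 0) (e i.succ) + wedge (e (i + 1).succ) (e (i + 2).succ)

/-- The diagonal entries `(2α, -α, -α)` of a half Weyl tensor of type D. -/
def typeDEigenvalue (α : ℝ) : Fin 3 → ℝ := ![2 * α, -α, -α]

/-- `g` is of type `D ⊗ D` at `x` with respect to the coframe `e`: `e` is orthonormal, and in the
bases of self-dual and anti-self-dual 2-forms built from `e` the two halves of the Weyl tensor are
`diag (2α, -α, -α)` and `diag (2β, -β, -β)`. -/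
def IsTypeDDAt (g : MetricField) (x : Pt) (e : Fin 4 → Fin 4 → ℝ) (α β : ℝ) : Prop :=
  IsOrthonormalCoframeAt g x e ∧
  (∀ i, weylOp g x (sdForm e i) = typeDEigenvalue α i • sdForm e i) ∧
  (∀ i, weylOp g x (asdForm e i) = typeDEigenvalue β i • asdForm e i)

/-! ### The metrics -/

/-- The symmetric square `u ⊗ u` of a covector. -/
def symSq (u : Fin 4 → ℝ) : Matrix (Fin 4) (Fin 4) ℝ := Matrix.vecMulVec u u

/-- The ambitoric metric ansatz in coordinates `(τ, φ, x, y)`,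
`H⁻² [ F/(A(x-y)) (dτ - y dφ)² + (x-y)/(FA) dx² + (x-y)/(BG) dy² + G/(B(x-y)) (dτ - x dφ)² ]`
with `A² = R(x)` and `B² = R(y)`. -/
def ambitoricMetric (H : ℝ → ℝ → ℝ) (R F G : ℝ → ℝ) : MetricField := fun p =>
  let x := p 2
  let y := p 3
  let A := Real.sqrt (R x)
  let B := Real.sqrt (R y)
  (1 / (H x y) ^ 2) •
    ((F x / (A * (x - y))) • symSq ![1, -y, 0, 0]
      + ((x - y) / (F x * A)) • symSq ![0, 0, 1, 0]
      + ((x - y) / (B * G y)) • symSq ![0, 0, 0, 1]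
      + (G y / (B * (x - y))) • symSq ![1, -x, 0, 0])

/-- The metric in coordinates `(τ, φ, r, q)`,
`(1+εrq)⁻² [ C/(r²-q²) (dτ - q² dφ)² + (r²-q²)/C dr² + (r²-q²)/D dq² + D/(r²-q²) (dτ - r² dφ)² ]`.
-/
def pdMetric (ε : ℝ) (C D : ℝ → ℝ) : MetricField := fun p =>
  let r := p 2
  let q := p 3
  (1 / (1 + ε * r * q) ^ 2) •
    ((C r / (r ^ 2 - q ^ 2)) • symSq ![1, -q ^ 2, 0, 0]
      + ((r ^ 2 - q ^ 2) / C r) • symSq ![0, 0, 1, 0]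
      + ((r ^ 2 - q ^ 2) / D q) • symSq ![0, 0, 0, 1]
      + (D q / (r ^ 2 - q ^ 2)) • symSq ![1, -r ^ 2, 0, 0])

/-- The orthonormal coframe of `pdMetric`, in the order
`dτ - q² dφ, dr, dq, dτ - r² dφ` of the underlying directions. -/
def pdCoframe (ε : ℝ) (C D : ℝ → ℝ) (p : Pt) : Fin 4 → Fin 4 → ℝ :=
  let r := p 2
  let q := p 3
  let H := 1 + ε * r * q
  ![(1 / H * Real.sqrt (C r / (r ^ 2 - q ^ 2))) • ![1, -q ^ 2, 0, 0],
    (1 / H * Real.sqrt ((r ^ 2 - q ^ 2) / C r)) • ![0, 0, 1, 0],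
    (1 / H * Real.sqrt ((r ^ 2 - q ^ 2) / D q)) • ![0, 0, 0, 1],
    (1 / H * Real.sqrt (D q / (r ^ 2 - q ^ 2))) • ![1, -r ^ 2, 0, 0]]

/-- The quartic `C`; `k` is the coefficient of `r²`, which the rescaling of `r, q` normalises. -/
def quarticC (b m n k ε Λ : ℝ) (r : ℝ) : ℝ :=
  -b + 2 * m * r + k * r ^ 2 + 2 * n * ε * r ^ 3 - (ε ^ 2 * b + Λ / 3) * r ^ 4

/-- The quartic `D`. -/
def quarticD (b m n k ε Λ : ℝ) (q : ℝ) : ℝ :=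
  b + 2 * n * q - k * q ^ 2 + 2 * m * ε * q ^ 3 + (ε ^ 2 * b + Λ / 3) * q ^ 4

/-- The Plebański-Demiański metric with parameters `b, m, n, ε, Λ` and coefficient `k`. -/
def plebanskiDemianski (b m n k ε Λ : ℝ) : MetricField :=
  pdMetric ε (quarticC b m n k ε Λ) (quarticD b m n k ε Λ)

/-- The Euclidean Kerr metric in Boyer-Lindquist coordinates `(t, ϕ, r, θ)`, with
`ρ² = r² - a² cos² θ` and `Δ = r² - 2 M r - a²`. -/
def kerrMetric (M a : ℝ) : MetricField := fun p =>
  let r := p 2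
  let θ := p 3
  let ρ2 := r ^ 2 - a ^ 2 * Real.cos θ ^ 2
  let Δ := r ^ 2 - 2 * M * r - a ^ 2
  !![1 - 2 * M * r / ρ2, 2 * M * r * a * Real.sin θ ^ 2 / ρ2, 0, 0;
     2 * M * r * a * Real.sin θ ^ 2 / ρ2,
       (r ^ 2 - a ^ 2 - 2 * M * r * a ^ 2 / ρ2 * Real.sin θ ^ 2) * Real.sin θ ^ 2, 0, 0;
     0, 0, ρ2 / Δ, 0;
     0, 0, 0, ρ2]

/-! ### Domains and coordinate changes -/

/-- The part of the chart on which the last two coordinates lie in `U`. -/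
def cylinder (U : Set (ℝ × ℝ)) : Set Pt := {p | (p 2, p 3) ∈ U}

/-- The point is in the region where `pdMetric ε C D` is a Riemannian metric. -/
def PDRegularAt (ε : ℝ) (C D : ℝ → ℝ) (r q : ℝ) : Prop :=
  r ^ 2 ≠ q ^ 2 ∧ 1 + ε * r * q ≠ 0 ∧ 0 < C r / (r ^ 2 - q ^ 2) ∧ 0 < D q / (r ^ 2 - q ^ 2)

/-- The coordinate change `x = r², y = q²`. It also rescales the coordinates along the
two Killing fields, which absorbs the factor `4` in `dx² = 4 r² dr²`. -/
def squareChange (p : Pt) : Pt := ![p 0 / 2, p 1 / 2, p 2 ^ 2, p 3 ^ 2]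

/-- The rescaling `r, q ↦ s r, s q`, with the compensating rescaling of `τ, φ`. -/
def rescale (s : ℝ) (p : Pt) : Pt := ![p 0 / s, p 1 / s ^ 3, s * p 2, s * p 3]

/-- The change to Boyer-Lindquist coordinates: `τ = t - a ϕ`, `φ = -ϕ / a`, `q = a cos θ`. -/
def boyerLindquist (a : ℝ) (p : Pt) : Pt :=
  ![p 0 - a * p 1, -p 1 / a, p 2, a * Real.cos (p 3)]

end Ambitoric

end

open Ambitoric

namespace Ambitoric

/-! ### Partial derivatives of smooth functions -/

/-! The theorem rests on one curvature computation and on the integration of one linear system of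
differential equations.

Curvature. With its indices lowered, the curvature tensor involves only the 2-jet of the metric and
the inverse metric (`IsSmoothMetricOn.riemannLow_eq`). For `pdMetric` it is therefore a rational
function of r, q and the 2-jets of C and D. In the orthonormal coframe only four coefficients occur
(`IsPDRegularOn.riemannLow_eq`): f0 on e⁰∧e¹, f1 on e²∧e³, f3 on the other four coordinate planes,
and f2 coupling each plane to its orthogonal complement. Hence Ric equals f0 + 2 f3 on the span of
e⁰, e¹ and f1 + 2 f3 on the span of e², e³, and the Einstein condition is a pair of scalar
equations, linear in the 2-jets of C and D (`einstein_components_iff`).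

Integration. A particular solution absorbs Λ. The two homogeneous equations determine C'' and D'' at
a point from C, C', D, D', which suggests a four-dimensional solution space, and the quartics with
parameters b, m, n, k fill it. Solving for these parameters in terms of C, C', D, D' gives four
functions `param` on U. Their partial derivatives vanish by the equations, so they are constant on
the connected set U, and C, D are the corresponding quartics (`IsPDRegularOn.exists_quartic`).
Conversely, the quartics satisfy the equations identically (`einstein_quartic`).

Ambitoric form. The change x = r², y = q² acts on each coordinate separately. The Ricci tensor is
natural under such changes (`IsDiagonalChange.ricci_eq`), which transfers the classification to F
and G.

Type D. For the quartics, f0 = f1 = α + β + Λ/3, f2 = β - α and f3 = -(α + β)/2 + Λ/3, where β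
stands for the second eigenvalue parameter (`curv_quartic`). Removing the part of constant curvature
Λ/3 leaves the Weyl tensor, which the self-dual and anti-self-dual forms diagonalise. The rescaling
and the Kerr case are direct substitutions. -/

theorem pderiv_eq_fderiv {f : Pt → ℝ} {x : Pt} (a : Fin 4) (hf : DifferentiableAt ℝ f x) :
    pderiv a f x = fderiv ℝ f x (Pi.single a 1) := by
  have h : HasFDerivAt f (fderiv ℝ f x) (Function.update x a (x a)) := by
    rw [Function.update_eq_self]; exact hf.hasFDerivAt
  exact (h.comp_hasDerivAt (x a) (hasDerivAt_update x a (x a))).deriv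

theorem hasDerivAt_pderiv {f : Pt → ℝ} {x : Pt} (a : Fin 4) (hf : DifferentiableAt ℝ f x) :
    HasDerivAt (fun t => f (Function.update x a t)) (pderiv a f x) (x a) := by
  have h : HasFDerivAt f (fderiv ℝ f x) (Function.update x a (x a)) := by
    rw [Function.update_eq_self]; exact hf.hasFDerivAt
  rw [pderiv_eq_fderiv a hf]
  exact h.comp_hasDerivAt (x a) (hasDerivAt_update x a (x a))

/-- Since S is open, the coordinate line through x stays in S near x, so an identity on S can be
differentiated, and differentiated again. -/
theorem pderiv_congr {f g : Pt → ℝ} {S : Set Pt} (hS : IsOpen S) (h : ∀ x ∈ S, f x = g x)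
    (a : Fin 4) {x : Pt} (hx : x ∈ S) : pderiv a f x = pderiv a g x := by
  have hc : ContinuousAt (fun t => Function.update x a t) (x a) :=
    (hasDerivAt_update x a (x a)).continuousAt
  have hm : ∀ᶠ t in nhds (x a), Function.update x a t ∈ S := by
    apply hc.eventually_mem
    rw [Function.update_eq_self]
    exact hS.mem_nhds hx
  exact Filter.EventuallyEq.deriv_eq (hm.mono fun t ht => h _ ht)

theorem pderiv_of_apply (f : ℝ → ℝ) (a c : Fin 4) (p : Pt) :
    pderiv c (fun z => f (z a)) p = if c = a then deriv f (p a) else 0 := by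
  unfold pderiv
  split_ifs with hc
  · subst hc; simp
  · simp [Function.update_of_ne (Ne.symm hc)]

section Rules

variable {f g : Pt → ℝ} {x : Pt}

theorem pderiv_add (a : Fin 4) (hf : DifferentiableAt ℝ f x) (hg : DifferentiableAt ℝ g x) :
    pderiv a (fun z => f z + g z) x = pderiv a f x + pderiv a g x :=
  ((hasDerivAt_pderiv a hf).add (hasDerivAt_pderiv a hg)).deriv

theorem pderiv_sub (a : Fin 4) (hf : DifferentiableAt ℝ f x) (hg : DifferentiableAt ℝ g x) :
    pderiv a (fun z => f z - g z) x = pderiv a f x - pderiv a g x :=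
  ((hasDerivAt_pderiv a hf).sub (hasDerivAt_pderiv a hg)).deriv

theorem pderiv_mul (a : Fin 4) (hf : DifferentiableAt ℝ f x) (hg : DifferentiableAt ℝ g x) :
    pderiv a (fun z => f z * g z) x = pderiv a f x * g x + f x * pderiv a g x := by
  have h := ((hasDerivAt_pderiv a hf).mul (hasDerivAt_pderiv a hg)).deriv
  rw [Function.update_eq_self] at h
  exact h

theorem pderiv_inv (a : Fin 4) (hf : DifferentiableAt ℝ f x) (h0 : f x ≠ 0) :
    pderiv a (fun z => (f z)⁻¹) x = -pderiv a f x / f x ^ 2 := by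
  have h := ((hasDerivAt_pderiv a hf).inv (by simpa only [Function.update_eq_self] using h0)).deriv
  rw [Function.update_eq_self] at h
  exact h

theorem pderiv_const (a : Fin 4) (c : ℝ) : pderiv a (fun _ => c) x = 0 := by
  simp [pderiv]

theorem pderiv_div_const (a : Fin 4) (c : ℝ) (hf : DifferentiableAt ℝ f x) :
    pderiv a (fun z => f z / c) x = pderiv a f x / c :=
  ((hasDerivAt_pderiv a hf).div_const c).deriv

theorem pderiv_sum {ι : Type*} (s : Finset ι) (F : ι → Pt → ℝ) (a : Fin 4)
    (hF : ∀ i ∈ s, DifferentiableAt ℝ (F i) x) :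
    pderiv a (fun z => ∑ i ∈ s, F i z) x = ∑ i ∈ s, pderiv a (F i) x :=
  (HasDerivAt.fun_sum (A := fun i t => F i (Function.update x a t))
    fun i hi => hasDerivAt_pderiv a (hF i hi)).deriv

end Rules

theorem smooth_pderiv {f : Pt → ℝ} {S : Set Pt} (hS : IsOpen S) (hf : ContDiffOn ℝ ∞ f S)
    (a : Fin 4) : ContDiffOn ℝ ∞ (pderiv a f) S := by
  have h1 : ContDiffOn ℝ ∞ (fderiv ℝ f) S := hf.fderiv_of_isOpen hS (by simp)
  have h2 : ContDiffOn ℝ ∞ (fun x => fderiv ℝ f x (Pi.single a 1)) S :=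
    h1.clm_apply contDiffOn_const
  exact h2.congr fun x hx => pderiv_eq_fderiv a
    ((hf.differentiableOn (by simp)).differentiableAt (hS.mem_nhds hx))

theorem differentiableAt_of_smooth {f : Pt → ℝ} {S : Set Pt} (hS : IsOpen S)
    (hf : ContDiffOn ℝ ∞ f S) {x : Pt} (hx : x ∈ S) : DifferentiableAt ℝ f x :=
  (hf.differentiableOn (by simp)).differentiableAt (hS.mem_nhds hx)

/-- Both sides are values of the second Fréchet derivative on basis vectors, which is a symmetric
bilinear form for a C² function. -/
theorem pderiv_comm {f : Pt → ℝ} {S : Set Pt} (hS : IsOpen S) (hf : ContDiffOn ℝ ∞ f S)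
    (a b : Fin 4) {x : Pt} (hx : x ∈ S) :
    pderiv a (pderiv b f) x = pderiv b (pderiv a f) x := by
  have h1 : DifferentiableAt ℝ (fderiv ℝ f) x :=
    ((hf.fderiv_of_isOpen hS (m := ∞) (by simp)).differentiableOn (by simp)).differentiableAt
      (hS.mem_nhds hx)
  have key : ∀ c d : Fin 4, pderiv c (pderiv d f) x
      = fderiv ℝ (fderiv ℝ f) x (Pi.single c 1) (Pi.single d 1) := by
    intro c d
    rw [pderiv_congr hS (g := fun y => fderiv ℝ f y (Pi.single d 1))
      (fun y hy => pderiv_eq_fderiv d (differentiableAt_of_smooth hS hf hy)) c hx,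
      pderiv_eq_fderiv c (h1.clm_apply (differentiableAt_const _)),
      fderiv_clm_apply h1 (differentiableAt_const _)]
    simp
  rw [key, key]
  refine (ContDiffAt.isSymmSndFDerivAt (hf.contDiffAt (hS.mem_nhds hx)) ?_).eq _ _
  simp only [minSmoothness_of_isRCLikeNormedField]
  exact WithTop.coe_le_coe.2 (le_top : (2 : ℕ∞) ≤ ⊤)

/-! ### Smooth metrics -/

/-- A symmetric nondegenerate matrix field with smooth entries on `S`. -/
structure IsSmoothMetricOn (g : MetricField) (S : Set Pt) : Prop where
  smooth : ∀ a b, ContDiffOn ℝ ∞ (fun x => g x a b) S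
  symm : ∀ x ∈ S, ∀ a b, g x a b = g x b a
  det_ne_zero : ∀ x ∈ S, (g x).det ≠ 0

namespace IsSmoothMetricOn

variable {g : MetricField} {S : Set Pt}

theorem inv_mul (hg : IsSmoothMetricOn g S) {x : Pt} (hx : x ∈ S) (a b : Fin 4) :
    ∑ d, (g x)⁻¹ a d * g x d b = if a = b then 1 else 0 := by
  have h := Matrix.nonsing_inv_mul (g x) (isUnit_iff_ne_zero.2 (hg.det_ne_zero x hx))
  have h2 := congrFun (congrFun h a) b
  rwa [Matrix.mul_apply, Matrix.one_apply] at h2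

theorem mul_inv (hg : IsSmoothMetricOn g S) {x : Pt} (hx : x ∈ S) (a b : Fin 4) :
    ∑ d, g x a d * (g x)⁻¹ d b = if a = b then 1 else 0 := by
  have h := Matrix.mul_nonsing_inv (g x) (isUnit_iff_ne_zero.2 (hg.det_ne_zero x hx))
  have h2 := congrFun (congrFun h a) b
  rwa [Matrix.mul_apply, Matrix.one_apply] at h2

theorem inv_symm (hg : IsSmoothMetricOn g S) {x : Pt} (hx : x ∈ S) (a b : Fin 4) :
    (g x)⁻¹ a b = (g x)⁻¹ b a := by
  have h : (g x).transpose = g x := by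
    ext i j; exact hg.symm x hx j i
  have h2 := Matrix.transpose_nonsing_inv (g x)
  rw [h] at h2
  exact (congrFun (congrFun h2 b) a)

theorem _root_.Ambitoric.smooth_det {A : Pt → Matrix (Fin 4) (Fin 4) ℝ}
    (hA : ∀ a b, ContDiffOn ℝ ∞ (fun x => A x a b) S) :
    ContDiffOn ℝ ∞ (fun x => (A x).det) S := by
  simp only [Matrix.det_apply]
  refine ContDiffOn.sum fun σ _ => ?_
  exact ContDiffOn.const_smul _ (contDiffOn_prod fun i _ => hA _ _)

theorem smooth_inv (hg : IsSmoothMetricOn g S) (a b : Fin 4) :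
    ContDiffOn ℝ ∞ (fun x => (g x)⁻¹ a b) S := by
  -- Cramer's rule: the entries of the inverse are quotients of determinants in the entries of g.
  have h1 : ∀ x, (g x)⁻¹ a b = (g x).det⁻¹ * ((g x).updateRow b (Pi.single a 1)).det := by
    intro x
    rw [Matrix.inv_def, Ring.inverse_eq_inv', Matrix.smul_apply, Matrix.adjugate_apply,
      smul_eq_mul]
  simp only [h1]
  refine ((smooth_det hg.smooth).inv hg.det_ne_zero).mul (smooth_det fun c d => ?_)
  by_cases h : c = b
  · subst h; simp only [Matrix.updateRow_self]; exact contDiffOn_const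
  · simp only [Matrix.updateRow_ne h]; exact hg.smooth c d

theorem smooth_christoffel (hg : IsSmoothMetricOn g S) (hS : IsOpen S) (a b c : Fin 4) :
    ContDiffOn ℝ ∞ (christoffel g a b c) S := by
  unfold christoffel
  refine ContDiffOn.sum fun d _ => ContDiffOn.div_const (ContDiffOn.mul (hg.smooth_inv a d) ?_) 2
  exact ((smooth_pderiv hS (hg.smooth d c) b).add (smooth_pderiv hS (hg.smooth d b) c)).sub
    (smooth_pderiv hS (hg.smooth b c) d)

end IsSmoothMetricOn

/-! ### The curvature tensor with lowered indices -/

/-- The Christoffel symbols of the first kind `Γ_{a,bc}`. -/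
noncomputable def christoffelLow (g : MetricField) (a b c : Fin 4) (x : Pt) : ℝ :=
  (pderiv b (fun z => g z a c) x + pderiv c (fun z => g z a b) x
    - pderiv a (fun z => g z b c) x) / 2

theorem christoffel_eq_sum (g : MetricField) (a b c : Fin 4) (x : Pt) :
    christoffel g a b c x = ∑ d, (g x)⁻¹ a d * christoffelLow g d b c x := by
  simp only [christoffel, christoffelLow, mul_div_assoc]

namespace IsSmoothMetricOn

variable {g : MetricField} {S : Set Pt}

theorem pderiv_symm (hg : IsSmoothMetricOn g S) (hS : IsOpen S) {x : Pt} (hx : x ∈ S)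
    (a b k : Fin 4) : pderiv k (fun z => g z a b) x = pderiv k (fun z => g z b a) x :=
  pderiv_congr hS (fun y hy => hg.symm y hy a b) k hx

theorem christoffelLow_symm (hg : IsSmoothMetricOn g S) (hS : IsOpen S) {x : Pt} (hx : x ∈ S)
    (a b c : Fin 4) : christoffelLow g a b c x = christoffelLow g a c b x := by
  unfold christoffelLow
  rw [hg.pderiv_symm hS hx b c a]
  ring

theorem pderiv_eq_christoffelLow (hg : IsSmoothMetricOn g S) (hS : IsOpen S) {x : Pt}
    (hx : x ∈ S) (a b c : Fin 4) :
    pderiv c (fun z => g z a b) x = christoffelLow g a c b x + christoffelLow g b c a x := by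
  unfold christoffelLow
  rw [hg.pderiv_symm hS hx b a c, hg.pderiv_symm hS hx c b a, hg.pderiv_symm hS hx c a b]
  ring

theorem sum_mul_christoffel (hg : IsSmoothMetricOn g S) {x : Pt} (hx : x ∈ S) (a b c : Fin 4) :
    ∑ e, g x a e * christoffel g e b c x = christoffelLow g a b c x := by
  simp only [christoffel_eq_sum, Finset.mul_sum]
  rw [Finset.sum_comm]
  simp only [← mul_assoc, ← Finset.sum_mul, hg.mul_inv hx, ite_mul, one_mul, zero_mul,
    Finset.sum_ite_eq, Finset.mem_univ, if_true]

/-- Leibniz rule for g_{ae} Γ^e_{db} = Γ_{a,db}, combined with metric compatibility ∂_c g_{ae} =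
Γ_{a,ce} + Γ_{e,ca}. This removes all derivatives of the inverse metric from the curvature. -/
theorem sum_mul_pderiv_christoffel (hg : IsSmoothMetricOn g S) (hS : IsOpen S) {x : Pt}
    (hx : x ∈ S) (a b c d : Fin 4) :
    ∑ e, g x a e * pderiv c (christoffel g e d b) x
      = pderiv c (christoffelLow g a d b) x
        - ∑ e, (christoffelLow g a c e x + christoffelLow g e c a x) * christoffel g e d b x := by
  have hG := fun e => differentiableAt_of_smooth hS (hg.smooth a e) hx
  have hΓ := fun e => differentiableAt_of_smooth hS (hg.smooth_christoffel hS e d b) hx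
  rw [← pderiv_congr hS (fun y hy => hg.sum_mul_christoffel hy a d b) c hx,
    pderiv_sum Finset.univ (fun e z => g z a e * christoffel g e d b z) c
      (fun e _ => (hG e).mul (hΓ e)), eq_sub_iff_add_eq, ← Finset.sum_add_distrib]
  refine Finset.sum_congr rfl fun e _ => ?_
  rw [pderiv_mul c (hG e) (hΓ e), hg.pderiv_eq_christoffelLow hS hx]
  ring

theorem pderiv_christoffelLow (hg : IsSmoothMetricOn g S) (hS : IsOpen S) {x : Pt}
    (hx : x ∈ S) (a b c d : Fin 4) :
    pderiv d (christoffelLow g a b c) x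
      = (pderiv d (pderiv b (fun z => g z a c)) x + pderiv d (pderiv c (fun z => g z a b)) x
          - pderiv d (pderiv a (fun z => g z b c)) x) / 2 := by
  have h := fun a b c => differentiableAt_of_smooth hS (smooth_pderiv hS (hg.smooth a b) c) hx
  have h1 := pderiv_add d (h a c b) (h a b c)
  have h2 := pderiv_sub (f := fun z => pderiv b (fun z => g z a c) z
    + pderiv c (fun z => g z a b) z) d ((h a c b).add (h a b c)) (h b c a)
  have h3 := pderiv_div_const (f := fun z => pderiv b (fun z => g z a c) z
    + pderiv c (fun z => g z a b) z - pderiv a (fun z => g z b c) z) d 2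
    (((h a c b).add (h a b c)).sub (h b c a))
  rw [← h1, ← h2, ← h3]
  rfl

/-- The curvature tensor in terms of the second partial derivatives of the metric. -/
theorem riemannLow_eq (hg : IsSmoothMetricOn g S) (hS : IsOpen S) {x : Pt} (hx : x ∈ S)
    (a b c d : Fin 4) :
    riemannLow g a b c d x
      = (pderiv b (pderiv c (fun z => g z a d)) x + pderiv a (pderiv d (fun z => g z b c)) x
          - pderiv a (pderiv c (fun z => g z b d)) x
          - pderiv b (pderiv d (fun z => g z a c)) x) / 2
        + ∑ e, ∑ f, (g x)⁻¹ e f *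
          (christoffelLow g e b c x * christoffelLow g f a d x
            - christoffelLow g e b d x * christoffelLow g f a c x) := by
  -- These products cancel the half Γ_{a,ce} Γ^e_{db} of the Leibniz correction; the other half,
  -- rewritten in `hΓΓ`, is the quadratic part of the result.
  have hquad : ∀ c d : Fin 4, ∑ e, g x a e * ∑ f, christoffel g e c f x * christoffel g f d b x
      = ∑ f, christoffelLow g a c f x * christoffel g f d b x := by
    intro c d
    simp only [Finset.mul_sum]
    rw [Finset.sum_comm]
    simp only [← mul_assoc, ← Finset.sum_mul, hg.sum_mul_christoffel hx]
  have hΓΓ : ∀ c d : Fin 4, ∑ e, christoffelLow g e c a x * christoffel g e d b x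
      = ∑ e, ∑ f, (g x)⁻¹ e f * (christoffelLow g e b d x * christoffelLow g f a c x) := by
    intro c d
    rw [Finset.sum_comm]
    refine Finset.sum_congr rfl fun e _ => ?_
    rw [christoffel_eq_sum, Finset.mul_sum]
    refine Finset.sum_congr rfl fun f _ => ?_
    rw [hg.inv_symm hx f e, hg.christoffelLow_symm hS hx e c a,
      hg.christoffelLow_symm hS hx f d b]
    ring
  have h1 : riemannLow g a b c d x
      = (∑ e, g x a e * pderiv c (christoffel g e d b) x)
        - (∑ e, g x a e * pderiv d (christoffel g e c b) x)
        + ((∑ e, g x a e * ∑ f, christoffel g e c f x * christoffel g f d b x)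
          - ∑ e, g x a e * ∑ f, christoffel g e d f x * christoffel g f c b x) := by
    rw [← Finset.sum_sub_distrib, ← Finset.sum_sub_distrib, ← Finset.sum_add_distrib]
    unfold riemannLow riemann
    refine Finset.sum_congr rfl fun e _ => ?_
    rw [Finset.sum_sub_distrib]
    ring
  rw [h1, hquad, hquad, hg.sum_mul_pderiv_christoffel hS hx, hg.sum_mul_pderiv_christoffel hS hx]
  simp only [add_mul, Finset.sum_add_distrib, mul_sub, Finset.sum_sub_distrib]
  rw [hΓΓ, hΓΓ, hg.pderiv_christoffelLow hS hx, hg.pderiv_christoffelLow hS hx,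
    pderiv_comm hS (hg.smooth a b) d c hx, pderiv_comm hS (hg.smooth a d) c b hx,
    pderiv_comm hS (hg.smooth a c) d b hx, pderiv_comm hS (hg.smooth d b) c a hx,
    pderiv_comm hS (hg.smooth c b) d a hx,
    pderiv_congr hS (fun y hy => hg.pderiv_symm hS hy d b c) a hx,
    pderiv_congr hS (fun y hy => hg.pderiv_symm hS hy c b d) a hx]
  ring

end IsSmoothMetricOn

/-! ### Coordinate changes acting on each coordinate separately -/

/-- `Φ` maps `T` to `S` and acts on the coordinate `a` by the smooth function `φ a`, with
non-vanishing derivative. -/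
structure IsDiagonalChange (φ : Fin 4 → ℝ → ℝ) (Φ : Pt → Pt) (T S : Set Pt) : Prop where
  apply : ∀ p a, Φ p a = φ a (p a)
  smooth : ∀ a, ContDiff ℝ ∞ (φ a)
  deriv_ne_zero : ∀ p ∈ T, ∀ a, deriv (φ a) (p a) ≠ 0
  mapsTo : ∀ p ∈ T, Φ p ∈ S

namespace IsDiagonalChange

variable {φ : Fin 4 → ℝ → ℝ} {Φ : Pt → Pt} {T S : Set Pt}

theorem hasDerivAt (h : IsDiagonalChange φ Φ T S) (a : Fin 4) (t : ℝ) :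
    HasDerivAt (φ a) (deriv (φ a) t) t :=
  ((h.smooth a).differentiable (by simp) t).hasDerivAt

theorem apply_update (h : IsDiagonalChange φ Φ T S) (p : Pt) (a : Fin 4) (t : ℝ) :
    Φ (Function.update p a t) = Function.update (Φ p) a (φ a t) := by
  ext i
  by_cases hi : i = a
  · subst hi; simp [h.apply]
  · simp [h.apply, hi]

theorem differentiable (h : IsDiagonalChange φ Φ T S) : Differentiable ℝ Φ := by
  rw [differentiable_pi]
  intro i
  simp only [h.apply]
  exact ((h.smooth i).differentiable (by simp)).comp (differentiable_apply i)

theorem pderiv_comp (h : IsDiagonalChange φ Φ T S) (a : Fin 4) {f : Pt → ℝ} {p : Pt}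
    (hf : DifferentiableAt ℝ f (Φ p)) :
    pderiv a (fun z => f (Φ z)) p = deriv (φ a) (p a) * pderiv a f (Φ p) := by
  have h1 := hasDerivAt_pderiv a hf
  rw [h.apply p a] at h1
  have h2 := (h1.comp (p a) (h.hasDerivAt a (p a))).deriv
  rw [mul_comm, ← h2]
  simp only [pderiv, h.apply_update]
  rfl

theorem differentiable_deriv (h : IsDiagonalChange φ Φ T S) (a : Fin 4) :
    Differentiable ℝ (fun p : Pt => deriv (φ a) (p a)) :=
  ((contDiff_infty_iff_deriv.1 (h.smooth a)).2.differentiable (by simp)).comp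
    (differentiable_apply a)

theorem differentiable_deriv_deriv (h : IsDiagonalChange φ Φ T S) (a : Fin 4) :
    Differentiable ℝ (fun p : Pt => deriv (deriv (φ a)) (p a)) :=
  ((contDiff_infty_iff_deriv.1 (contDiff_infty_iff_deriv.1 (h.smooth a)).2).2.differentiable
    (by simp)).comp (differentiable_apply a)

theorem pderiv_deriv (a c : Fin 4) (p : Pt) :
    pderiv c (fun z => deriv (φ a) (z a)) p = if c = a then deriv (deriv (φ a)) (p a) else 0 :=
  pderiv_of_apply _ a c p

variable {g g' : MetricField}

theorem inv_apply (h : IsDiagonalChange φ Φ T S) (hg : IsSmoothMetricOn g S)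
    (hg' : ∀ p ∈ T, ∀ a b, g' p a b = deriv (φ a) (p a) * deriv (φ b) (p b) * g (Φ p) a b)
    {p : Pt} (hp : p ∈ T) (a b : Fin 4) :
    (g' p)⁻¹ a b = (g (Φ p))⁻¹ a b / (deriv (φ a) (p a) * deriv (φ b) (p b)) := by
  have hJ := h.deriv_ne_zero p hp
  have h1 : (Matrix.of fun a b => (g (Φ p))⁻¹ a b / (deriv (φ a) (p a) * deriv (φ b) (p b)))
      * g' p = 1 := by
    ext i j
    rw [Matrix.mul_apply, Matrix.one_apply]
    have h2 : ∀ d, (g (Φ p))⁻¹ i d / (deriv (φ i) (p i) * deriv (φ d) (p d)) * g' p d j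
        = (g (Φ p))⁻¹ i d * g (Φ p) d j * (deriv (φ j) (p j) / deriv (φ i) (p i)) := by
      intro d
      have := hJ d
      have := hJ i
      rw [hg' p hp]
      field_simp
    simp only [Matrix.of_apply, h2, ← Finset.sum_mul, hg.inv_mul (h.mapsTo p hp)]
    split_ifs with hij
    · subst hij; rw [one_mul, div_self (hJ i)]
    · rw [zero_mul]
  rw [Matrix.inv_eq_left_inv h1, Matrix.of_apply]

theorem pderiv_metric (h : IsDiagonalChange φ Φ T S) (hg : IsSmoothMetricOn g S)
    (hS : IsOpen S) (hT : IsOpen T)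
    (hg' : ∀ p ∈ T, ∀ a b, g' p a b = deriv (φ a) (p a) * deriv (φ b) (p b) * g (Φ p) a b)
    {p : Pt} (hp : p ∈ T) (a b c : Fin 4) :
    pderiv c (fun z => g' z a b) p
      = (if c = a then deriv (deriv (φ a)) (p a) * deriv (φ b) (p b) * g (Φ p) a b else 0)
        + (if c = b then deriv (φ a) (p a) * deriv (deriv (φ b)) (p b) * g (Φ p) a b else 0)
        + deriv (φ a) (p a) * deriv (φ b) (p b) * deriv (φ c) (p c)
          * pderiv c (fun z => g z a b) (Φ p) := by
  have hf := differentiableAt_of_smooth hS (hg.smooth a b) (h.mapsTo p hp)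
  have hfΦ : DifferentiableAt ℝ (fun z => g (Φ z) a b) p := hf.comp p (h.differentiable p)
  have hJ := fun a => h.differentiable_deriv a p
  rw [pderiv_congr hT (fun y hy => hg' y hy a b) c hp,
    pderiv_mul (f := fun z => deriv (φ a) (z a) * deriv (φ b) (z b)) c ((hJ a).mul (hJ b)) hfΦ,
    pderiv_mul c (hJ a) (hJ b), pderiv_deriv, pderiv_deriv,
    h.pderiv_comp c (f := fun z => g z a b) hf]
  split_ifs <;> ring

/-- The Jacobian is diagonal and each entry depends on its own coordinate only, so the inhomogeneous
term of the transformation law survives only when all three indices coincide, with value φ''/φ'. -/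
theorem christoffel_eq (h : IsDiagonalChange φ Φ T S) (hg : IsSmoothMetricOn g S)
    (hS : IsOpen S) (hT : IsOpen T)
    (hg' : ∀ p ∈ T, ∀ a b, g' p a b = deriv (φ a) (p a) * deriv (φ b) (p b) * g (Φ p) a b)
    {p : Pt} (hp : p ∈ T) (a b c : Fin 4) :
    christoffel g' a b c p
      = deriv (φ b) (p b) * deriv (φ c) (p c) / deriv (φ a) (p a) * christoffel g a b c (Φ p)
        + if b = c then if a = b then deriv (deriv (φ a)) (p a) / deriv (φ a) (p a) else 0
          else 0 := by
  have hJ := h.deriv_ne_zero p hp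
  have hsy := hg.symm _ (h.mapsTo p hp)
  have h1 : ∀ d, (g' p)⁻¹ a d *
      (pderiv b (fun z => g' z d c) p + pderiv c (fun z => g' z d b) p
        - pderiv d (fun z => g' z b c) p) / 2
      = deriv (φ b) (p b) * deriv (φ c) (p c) / deriv (φ a) (p a) * ((g (Φ p))⁻¹ a d *
          (pderiv b (fun z => g z d c) (Φ p) + pderiv c (fun z => g z d b) (Φ p)
            - pderiv d (fun z => g z b c) (Φ p)) / 2)
        + (g (Φ p))⁻¹ a d * g (Φ p) d b *
          (if b = c then deriv (deriv (φ b)) (p b) / deriv (φ a) (p a) else 0) := by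
    intro d
    have := hJ a
    have := hJ d
    rw [h.inv_apply hg hg' hp, h.pderiv_metric hg hS hT hg' hp,
      h.pderiv_metric hg hS hT hg' hp, h.pderiv_metric hg hS hT hg' hp]
    by_cases hbc : b = c
    · subst hbc
      by_cases hbd : b = d
      · subst hbd
        simp only [if_true]
        field_simp
        ring
      · simp only [hbd, Ne.symm hbd, if_true, if_false]
        field_simp
        ring
    · by_cases hbd : b = d
      · subst hbd
        simp only [hbc, Ne.symm hbc, if_true, if_false]
        field_simp
        ring
      · by_cases hcd : c = d
        · subst hcd
          simp only [hbc, Ne.symm hbc, if_true, if_false]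
          rw [hsy b c]
          field_simp
          ring
        · simp only [hbc, hbd, hcd, Ne.symm hbc, Ne.symm hbd, Ne.symm hcd, if_false]
          field_simp
          ring
  unfold christoffel
  simp only [h1]
  rw [Finset.sum_add_distrib, ← Finset.mul_sum, ← Finset.sum_mul,
    hg.inv_mul (h.mapsTo p hp)]
  congr 1
  by_cases hab : a = b
  · subst hab; simp
  · simp [hab]

theorem pderiv_christoffel (h : IsDiagonalChange φ Φ T S) (hg : IsSmoothMetricOn g S)
    (hS : IsOpen S) (hT : IsOpen T)
    (hg' : ∀ p ∈ T, ∀ a b, g' p a b = deriv (φ a) (p a) * deriv (φ b) (p b) * g (Φ p) a b)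
    {p : Pt} (hp : p ∈ T) (a b c k : Fin 4) :
    pderiv k (christoffel g' a b c) p
      = deriv (φ b) (p b) * deriv (φ c) (p c) / deriv (φ a) (p a) *
          (deriv (φ k) (p k) * pderiv k (christoffel g a b c) (Φ p)
          + ((if k = b then deriv (deriv (φ b)) (p b) / deriv (φ b) (p b) else 0)
            + (if k = c then deriv (deriv (φ c)) (p c) / deriv (φ c) (p c) else 0)
            - (if k = a then deriv (deriv (φ a)) (p a) / deriv (φ a) (p a) else 0))
            * christoffel g a b c (Φ p))
        + if b = c then if a = b then if k = a then
            deriv (fun t => deriv (deriv (φ a)) t / deriv (φ a) t) (p a)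
          else 0 else 0 else 0 := by
  have hJ0 := h.deriv_ne_zero p hp
  have hf := differentiableAt_of_smooth hS (hg.smooth_christoffel hS a b c) (h.mapsTo p hp)
  have hfΦ : DifferentiableAt ℝ (fun z => christoffel g a b c (Φ z)) p :=
    hf.comp p (h.differentiable p)
  have hJ := fun a => h.differentiable_deriv a p
  have hJi : DifferentiableAt ℝ (fun z : Pt => (deriv (φ a) (z a))⁻¹) p := (hJ a).inv (hJ0 a)
  have hK : DifferentiableAt ℝ
      (fun z : Pt => deriv (deriv (φ a)) (z a) / deriv (φ a) (z a)) p := by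
    simp only [div_eq_mul_inv]
    exact (h.differentiable_deriv_deriv a p).mul hJi
  have hE : DifferentiableAt ℝ (fun z : Pt =>
      if b = c then if a = b then deriv (deriv (φ a)) (z a) / deriv (φ a) (z a) else 0
        else 0) p := by
    split_ifs
    · exact hK
    · exact differentiableAt_const _
    · exact differentiableAt_const _
  have hEd : pderiv k (fun z : Pt =>
      if b = c then if a = b then deriv (deriv (φ a)) (z a) / deriv (φ a) (z a) else 0
        else 0) p = if b = c then if a = b then if k = a then
            deriv (fun t => deriv (deriv (φ a)) t / deriv (φ a) t) (p a)
          else 0 else 0 else 0 := by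
    split_ifs with h1 h2 h3
    · rw [pderiv_of_apply (fun t => deriv (deriv (φ a)) t / deriv (φ a) t), if_pos h3]
    · rw [pderiv_of_apply (fun t => deriv (deriv (φ a)) t / deriv (φ a) t), if_neg h3]
    · exact pderiv_const _ _
    · exact pderiv_const _ _
  have hΓ : ∀ y ∈ T, christoffel g' a b c y
      = deriv (φ b) (y b) * deriv (φ c) (y c) * (deriv (φ a) (y a))⁻¹
          * christoffel g a b c (Φ y)
        + if b = c then if a = b then deriv (deriv (φ a)) (y a) / deriv (φ a) (y a) else 0
          else 0 := by
    intro y hy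
    rw [h.christoffel_eq hg hS hT hg' hy]
    simp only [div_eq_mul_inv]
  rw [pderiv_congr hT hΓ k hp,
    pderiv_add (f := fun y => deriv (φ b) (y b) * deriv (φ c) (y c) * (deriv (φ a) (y a))⁻¹
      * christoffel g a b c (Φ y)) k ((((hJ b).mul (hJ c)).mul hJi).mul hfΦ) hE, hEd,
    pderiv_mul (f := fun y => deriv (φ b) (y b) * deriv (φ c) (y c) * (deriv (φ a) (y a))⁻¹) k
      (((hJ b).mul (hJ c)).mul hJi) hfΦ,
    pderiv_mul (f := fun y => deriv (φ b) (y b) * deriv (φ c) (y c)) k ((hJ b).mul (hJ c)) hJi,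
    pderiv_mul k (hJ b) (hJ c), pderiv_inv k (hJ a) (hJ0 a), pderiv_deriv, pderiv_deriv,
    pderiv_deriv, h.pderiv_comp k hf]
  congr 1
  have := hJ0 a
  have := hJ0 b
  have := hJ0 c
  split_ifs <;> field_simp <;> ring

/-- The second derivatives of φ coming from the derivatives of the prefactors cancel those from the
quadratic terms. A third derivative of φ occurs only when all four indices agree, and there the
antisymmetry in c and d removes it. -/
theorem riemann_eq (h : IsDiagonalChange φ Φ T S) (hg : IsSmoothMetricOn g S)
    (hS : IsOpen S) (hT : IsOpen T)
    (hg' : ∀ p ∈ T, ∀ a b, g' p a b = deriv (φ a) (p a) * deriv (φ b) (p b) * g (Φ p) a b)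
    {p : Pt} (hp : p ∈ T) (a b c d : Fin 4) :
    riemann g' a b c d p
      = deriv (φ b) (p b) * deriv (φ c) (p c) * deriv (φ d) (p d) / deriv (φ a) (p a)
        * riemann g a b c d (Φ p) := by
  have hJ := h.deriv_ne_zero p hp
  have hq : ∀ c d : Fin 4, ∑ e, christoffel g' a c e p * christoffel g' e d b p
      = deriv (φ b) (p b) * deriv (φ c) (p c) * deriv (φ d) (p d) / deriv (φ a) (p a)
          * ∑ e, christoffel g a c e (Φ p) * christoffel g e d b (Φ p)
        + (if d = b then deriv (φ c) (p c) * deriv (deriv (φ d)) (p d) / deriv (φ a) (p a)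
            * christoffel g a c d (Φ p) else 0)
        + (if a = c then deriv (deriv (φ a)) (p a) / deriv (φ a) (p a) * (
            deriv (φ d) (p d) * deriv (φ b) (p b) / deriv (φ a) (p a)
              * christoffel g a d b (Φ p)
            + if d = b then if a = d then deriv (deriv (φ a)) (p a) / deriv (φ a) (p a) else 0
              else 0) else 0) := by
    intro c d
    have h1 : ∀ e, christoffel g' a c e p * christoffel g' e d b p
        = deriv (φ b) (p b) * deriv (φ c) (p c) * deriv (φ d) (p d) / deriv (φ a) (p a)
            * (christoffel g a c e (Φ p) * christoffel g e d b (Φ p))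
          + (if e = d then if d = b then
              deriv (φ c) (p c) * deriv (deriv (φ d)) (p d) / deriv (φ a) (p a)
              * christoffel g a c d (Φ p) else 0 else 0)
          + (if e = c then if a = c then deriv (deriv (φ a)) (p a) / deriv (φ a) (p a) * (
              deriv (φ d) (p d) * deriv (φ b) (p b) / deriv (φ a) (p a)
                * christoffel g a d b (Φ p)
              + if d = b then if a = d then deriv (deriv (φ a)) (p a) / deriv (φ a) (p a) else 0
                else 0) else 0 else 0) := by
      intro e
      rw [h.christoffel_eq hg hS hT hg' hp, h.christoffel_eq hg hS hT hg' hp]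
      have := hJ a
      have := hJ e
      by_cases hec : e = c
      · subst hec
        by_cases hae : a = e
        · subst hae
          by_cases hdb : d = b
          · subst hdb
            by_cases had : a = d
            · subst had
              simp only [if_true]
              field_simp
            · simp only [had, if_true, if_false]
              field_simp
              ring
          · simp only [hdb, if_true, if_false, ite_self]
            field_simp
            ring
        · by_cases hdb : d = b
          · subst hdb
            by_cases hed : e = d
            · subst hed
              simp only [hae, if_true, if_false]
              field_simp
              ring
            · simp only [hae, hed, if_true, if_false]
              field_simp
              ring
          · simp only [hdb, hae, if_false, ite_self]
            field_simp
            ring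
      · by_cases hdb : d = b
        · subst hdb
          by_cases hed : e = d
          · subst hed
            simp only [hec, Ne.symm hec, if_true, if_false]
            field_simp
            ring
          · simp only [hec, Ne.symm hec, hed, if_true, if_false]
            field_simp
            ring
        · simp only [hdb, hec, Ne.symm hec, if_false, ite_self]
          field_simp
          ring
    simp only [h1]
    rw [Finset.sum_add_distrib, Finset.sum_add_distrib, ← Finset.mul_sum]
    simp only [Finset.sum_ite_eq', Finset.mem_univ, if_true]
  unfold riemann
  rw [Finset.sum_sub_distrib, Finset.sum_sub_distrib, hq, hq,
    h.pderiv_christoffel hg hS hT hg' hp, h.pderiv_christoffel hg hS hT hg' hp]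
  have := hJ a
  have := hJ b
  have := hJ c
  have := hJ d
  -- The correction terms are supported on coincidences of indices; in each pattern of coincidences
  -- a rational identity remains.
  by_cases hcd : c = d
  · subst hcd; ring
  · by_cases hbc : b = c
    · subst hbc
      by_cases hab : a = b
      · subst hab
        simp only [hcd, Ne.symm hcd, if_true, if_false, ite_self]
        field_simp
        ring
      · by_cases had : a = d
        · subst had
          simp only [hcd, Ne.symm hcd, if_true, if_false, ite_self]
          field_simp
          ring
        · simp only [hcd, Ne.symm hcd, hab, Ne.symm hab, had, Ne.symm had, if_true, if_false,
            ite_self]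
          field_simp
          ring
    · by_cases hbd : b = d
      · subst hbd
        by_cases hab : a = b
        · subst hab
          simp only [hcd, Ne.symm hcd, if_true, if_false, ite_self]
          field_simp
          ring
        · by_cases hac : a = c
          · subst hac
            simp only [hab, Ne.symm hab, if_true, if_false, ite_self]
            field_simp
            ring
          · simp only [hcd, Ne.symm hcd, hab, Ne.symm hab, hac, Ne.symm hac, if_true, if_false,
              ite_self]
            field_simp
            ring
      · by_cases hac : a = c
        · subst hac
          simp only [hcd, Ne.symm hcd, Ne.symm hbc, Ne.symm hbd, if_true, if_false,
            ite_self]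
          field_simp
          ring
        · by_cases had : a = d
          · subst had
            simp only [hcd, Ne.symm hcd, Ne.symm hbc, Ne.symm hbd, if_true, if_false,
              ite_self]
            field_simp
            ring
          · simp only [hcd, Ne.symm hcd, Ne.symm hbc, Ne.symm hbd, hac, Ne.symm hac,
              had, Ne.symm had, if_false, ite_self]
            field_simp
            ring

/-- The Ricci tensor is natural under coordinate changes. -/
theorem ricci_eq (h : IsDiagonalChange φ Φ T S) (hg : IsSmoothMetricOn g S)
    (hS : IsOpen S) (hT : IsOpen T)
    (hg' : ∀ p ∈ T, ∀ a b, g' p a b = deriv (φ a) (p a) * deriv (φ b) (p b) * g (Φ p) a b)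
    {p : Pt} (hp : p ∈ T) (b d : Fin 4) :
    ricci g' b d p = deriv (φ b) (p b) * deriv (φ d) (p d) * ricci g b d (Φ p) := by
  unfold ricci
  rw [Finset.mul_sum]
  refine Finset.sum_congr rfl fun a _ => ?_
  have := h.deriv_ne_zero p hp a
  rw [h.riemann_eq hg hS hT hg' hp]
  field_simp

end IsDiagonalChange

/-! ### Symmetries of the curvature tensor -/

/-- The algebraic symmetries of a curvature tensor, apart from the Bianchi identity. -/
structure HasCurvatureSymm (T : Fin 4 → Fin 4 → Fin 4 → Fin 4 → ℝ) : Prop where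
  antisymm_left : ∀ a b c d, T a b c d = -T b a c d
  antisymm_right : ∀ a b c d, T a b c d = -T a b d c
  pair : ∀ a b c d, T a b c d = T c d a b

/-- Such a tensor is a symmetric form on the six index pairs a < b, hence is fixed by 21 components:
those whose first pair does not exceed the second in lexicographic order. -/
theorem HasCurvatureSymm.ext {T K : Fin 4 → Fin 4 → Fin 4 → Fin 4 → ℝ}
    (hT : HasCurvatureSymm T) (hK : HasCurvatureSymm K)
    (h : ∀ a b c d, a < b → c < d → a ≤ c → (a = c → b ≤ d) → T a b c d = K a b c d)
    (a b c d : Fin 4) : T a b c d = K a b c d := by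
  have h1 : ∀ a b c d, a < b → c < d → T a b c d = K a b c d := by
    intro a b c d hab hcd
    by_cases h2 : a ≤ c ∧ (a = c → b ≤ d)
    · exact h a b c d hab hcd h2.1 h2.2
    · rw [hT.pair, hK.pair]
      exact h c d a b hcd hab (by grind) (by grind)
  have zr : ∀ {T : Fin 4 → Fin 4 → Fin 4 → Fin 4 → ℝ}, HasCurvatureSymm T →
      ∀ a b c, T a b c c = 0 := fun hT a b c => by linarith [hT.antisymm_right a b c c]
  have h2 : ∀ a b c d, a < b → T a b c d = K a b c d := by
    intro a b c d hab
    rcases lt_trichotomy c d with hcd | rfl | hcd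
    · exact h1 a b c d hab hcd
    · rw [zr hT, zr hK]
    · rw [hT.antisymm_right, hK.antisymm_right, h1 a b d c hab hcd]
  rcases lt_trichotomy a b with hab | rfl | hab
  · exact h2 a b c d hab
  · rw [hT.pair, hK.pair, zr hT, zr hK]
  · rw [hT.antisymm_left, hK.antisymm_left, h2 b a c d hab]

theorem IsSmoothMetricOn.riemannLow_symm {g : MetricField} {S : Set Pt}
    (hg : IsSmoothMetricOn g S) (hS : IsOpen S) {x : Pt} (hx : x ∈ S) :
    HasCurvatureSymm fun a b c d => riemannLow g a b c d x := by
  have hr : ∀ a b c d, riemannLow g a b c d x = -riemannLow g a b d c x := by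
    intro a b c d
    unfold riemannLow riemann
    rw [← Finset.sum_neg_distrib]
    refine Finset.sum_congr rfl fun e _ => ?_
    simp only [Finset.sum_sub_distrib]
    ring
  have hp : ∀ a b c d, riemannLow g a b c d x = riemannLow g c d a b x := by
    intro a b c d
    have hq : ∑ e, ∑ f, (g x)⁻¹ e f *
          (christoffelLow g e b c x * christoffelLow g f a d x
            - christoffelLow g e b d x * christoffelLow g f a c x)
        = ∑ e, ∑ f, (g x)⁻¹ e f *
          (christoffelLow g e d a x * christoffelLow g f c b x
            - christoffelLow g e d b x * christoffelLow g f c a x) := by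
      simp only [mul_sub, Finset.sum_sub_distrib]
      congr 1
      · rw [Finset.sum_comm]
        refine Finset.sum_congr rfl fun e _ => Finset.sum_congr rfl fun f _ => ?_
        rw [hg.inv_symm hx f e, hg.christoffelLow_symm hS hx e a d,
          hg.christoffelLow_symm hS hx f b c]
        ring
      · refine Finset.sum_congr rfl fun e _ => Finset.sum_congr rfl fun f _ => ?_
        rw [hg.christoffelLow_symm hS hx e b d, hg.christoffelLow_symm hS hx f a c]
    have hs := fun a b c d => pderiv_congr hS (fun y hy => hg.pderiv_symm hS hy a b c) d hx
    rw [hg.riemannLow_eq hS hx, hg.riemannLow_eq hS hx, hq,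
      pderiv_comm hS (hg.smooth a d) b c hx, pderiv_comm hS (hg.smooth b c) a d hx,
      pderiv_comm hS (hg.smooth b d) a c hx, pderiv_comm hS (hg.smooth a c) b d hx,
      hs b c a d, hs a d b c, hs b d a c, hs a c b d]
    ring
  refine ⟨fun a b c d => ?_, hr, hp⟩
  -- R_{abcd} = R_{cdab} = -R_{cdba} = -R_{bacd}.
  rw [hp, hr, hp]

/-! ### Second-order jets -/

/-- The value, first and second partial derivatives of a function at a point. -/
@[ext]
structure Jet where
  val : ℝ
  d : Fin 4 → ℝ
  dd : Fin 4 → Fin 4 → ℝ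

namespace Jet

noncomputable def const (c : ℝ) : Jet := ⟨c, fun _ => 0, fun _ _ => 0⟩

noncomputable def add (J K : Jet) : Jet :=
  ⟨J.val + K.val, fun a => J.d a + K.d a, fun a b => J.dd a b + K.dd a b⟩

noncomputable def mul (J K : Jet) : Jet :=
  ⟨J.val * K.val, fun a => J.d a * K.val + J.val * K.d a,
    fun a b => J.dd a b * K.val + J.d b * K.d a + (J.d a * K.d b + J.val * K.dd a b)⟩

noncomputable def inv (J : Jet) : Jet :=
  ⟨J.val⁻¹, fun a => -J.d a / J.val ^ 2,
    fun a b => -J.dd a b / J.val ^ 2 + 2 * J.d a * J.d b / J.val ^ 3⟩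

/-- The jet of a function of the `k`-th coordinate, with given value and derivatives. -/
noncomputable def single (k : Fin 4) (f0 f1 f2 : ℝ) : Jet :=
  ⟨f0, fun a => if a = k then f1 else 0, fun a b => if a = k then if b = k then f2 else 0 else 0⟩

end Jet

/-- `f` is smooth on `S` and has the jet `J` at `p`. -/
structure HasJet (S : Set Pt) (p : Pt) (f : Pt → ℝ) (J : Jet) : Prop where
  smooth : ContDiffOn ℝ ∞ f S
  val : f p = J.val
  d : ∀ a, pderiv a f p = J.d a
  dd : ∀ a b, pderiv a (pderiv b f) p = J.dd a b

namespace HasJet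

variable {S : Set Pt} {p : Pt} {f g : Pt → ℝ} {J K : Jet}

theorem const (c : ℝ) : HasJet S p (fun _ => c) (Jet.const c) where
  smooth := contDiffOn_const
  val := rfl
  d a := pderiv_const a c
  dd a b := by
    have : pderiv b (fun _ : Pt => c) = fun _ => 0 := funext fun x => pderiv_const b c
    rw [this]; exact pderiv_const a 0

theorem add (hS : IsOpen S) (hp : p ∈ S) (hf : HasJet S p f J) (hg : HasJet S p g K) :
    HasJet S p (fun z => f z + g z) (J.add K) where
  smooth := hf.smooth.add hg.smooth
  val := by rw [hf.val, hg.val]; rfl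
  d a := by
    rw [pderiv_add a (differentiableAt_of_smooth hS hf.smooth hp)
      (differentiableAt_of_smooth hS hg.smooth hp), hf.d, hg.d]; rfl
  dd a b := by
    rw [pderiv_congr hS (fun y hy => pderiv_add b (differentiableAt_of_smooth hS hf.smooth hy)
      (differentiableAt_of_smooth hS hg.smooth hy)) a hp,
      pderiv_add a (differentiableAt_of_smooth hS (smooth_pderiv hS hf.smooth b) hp)
      (differentiableAt_of_smooth hS (smooth_pderiv hS hg.smooth b) hp), hf.dd, hg.dd]; rfl

theorem mul (hS : IsOpen S) (hp : p ∈ S) (hf : HasJet S p f J) (hg : HasJet S p g K) :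
    HasJet S p (fun z => f z * g z) (J.mul K) where
  smooth := hf.smooth.mul hg.smooth
  val := by rw [hf.val, hg.val]; rfl
  d a := by
    rw [pderiv_mul a (differentiableAt_of_smooth hS hf.smooth hp)
      (differentiableAt_of_smooth hS hg.smooth hp), hf.d, hg.d, hf.val, hg.val]; rfl
  dd a b := by
    have hf0 := differentiableAt_of_smooth hS hf.smooth hp
    have hg0 := differentiableAt_of_smooth hS hg.smooth hp
    have hf1 := differentiableAt_of_smooth hS (smooth_pderiv hS hf.smooth b) hp
    have hg1 := differentiableAt_of_smooth hS (smooth_pderiv hS hg.smooth b) hp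
    rw [pderiv_congr hS (fun y hy => pderiv_mul b (differentiableAt_of_smooth hS hf.smooth hy)
      (differentiableAt_of_smooth hS hg.smooth hy)) a hp,
      pderiv_add (f := fun z => pderiv b f z * g z) (g := fun z => f z * pderiv b g z) a (hf1.mul hg0) (hf0.mul hg1),
      pderiv_mul a hf1 hg0, pderiv_mul a hf0 hg1, hf.dd, hg.dd, hf.d, hf.d, hg.d, hg.d,
      hf.val, hg.val]
    rfl

theorem inv (hS : IsOpen S) (hp : p ∈ S) (hf : HasJet S p f J) (h0 : ∀ z ∈ S, f z ≠ 0) :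
    HasJet S p (fun z => (f z)⁻¹) J.inv where
  smooth := hf.smooth.inv h0
  val := by rw [hf.val]; rfl
  d a := by
    rw [pderiv_inv a (differentiableAt_of_smooth hS hf.smooth hp) (h0 p hp), hf.d, hf.val]; rfl
  dd a b := by
    have hf0 := differentiableAt_of_smooth hS hf.smooth hp
    have hf1 := differentiableAt_of_smooth hS (smooth_pderiv hS hf.smooth b) hp
    have hi := hf0.fun_inv (h0 p hp)
    -- The first derivative is written as a product of inverses, so that the second one follows from
    -- the product rule and `pderiv_inv` alone.
    have h1 : ∀ y ∈ S, pderiv b (fun z => (f z)⁻¹) y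
        = (-1) * (pderiv b f y * ((f y)⁻¹ * (f y)⁻¹)) := by
      intro y hy
      rw [pderiv_inv b (differentiableAt_of_smooth hS hf.smooth hy) (h0 y hy)]
      have := h0 y hy
      field_simp
    have hv := h0 p hp
    rw [pderiv_congr hS h1 a hp,
      pderiv_mul (f := fun _ => -1) (g := fun y => pderiv b f y * ((f y)⁻¹ * (f y)⁻¹)) a
        (differentiableAt_const _) (hf1.mul (hi.mul hi)), pderiv_const,
      pderiv_mul (g := fun y => (f y)⁻¹ * (f y)⁻¹) a hf1 (hi.mul hi),
      pderiv_mul a hi hi, pderiv_inv a hf0 hv, hf.dd, hf.d, hf.d]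
    rw [hf.val] at hv ⊢
    simp only [Jet.inv]
    field_simp
    ring

theorem single (hS : IsOpen S) (hp : p ∈ S) (k : Fin 4) {φ : ℝ → ℝ} {I : Set ℝ}
    (hφ : ContDiffOn ℝ ∞ φ I) (hSI : ∀ z ∈ S, z k ∈ I) :
    HasJet S p (fun z => φ (z k))
      (Jet.single k (φ (p k)) (deriv φ (p k)) (deriv (deriv φ) (p k))) where
  smooth := hφ.comp (contDiff_apply ℝ ℝ k).contDiffOn hSI
  val := rfl
  d a := pderiv_of_apply φ k a p
  dd a b := by
    rw [pderiv_congr hS (fun _ _ => pderiv_of_apply φ k b _) a hp]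
    by_cases hb : b = k
    · simp only [hb, if_true]
      rw [pderiv_of_apply (deriv φ) k a p]
      simp [Jet.single]
    · simp only [hb, if_false, Jet.single, ite_self]
      exact pderiv_const _ _

theorem coord (hS : IsOpen S) (hp : p ∈ S) (k : Fin 4) :
    HasJet S p (fun z => z k) (Jet.single k (p k) 1 0) := by
  have h := single hS hp k (contDiff_id (𝕜 := ℝ) (E := ℝ)).contDiffOn
    fun z _ => Set.mem_univ _
  have h1 : deriv (id : ℝ → ℝ) = fun _ => 1 := funext fun x => deriv_id x
  simpa [h1] using h

theorem congr (hS : IsOpen S) (hp : p ∈ S) (hf : HasJet S p f J) (h : ∀ z ∈ S, g z = f z) :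
    HasJet S p g J where
  smooth := hf.smooth.congr h
  val := (h p hp).trans hf.val
  d a := (pderiv_congr hS h a hp).trans (hf.d a)
  dd a b := (pderiv_congr hS (fun _ hy => pderiv_congr hS h b hy) a hp).trans (hf.dd a b)

theorem of_eq (hf : HasJet S p f J) (h : J = K) : HasJet S p f K := h ▸ hf

end HasJet

/-! ### Jets of functions of the last two coordinates -/

namespace Jet

/-- The jet of a function of the last two coordinates. -/
noncomputable def planar (v r q rr rq qq : ℝ) : Jet :=
  ⟨v, ![0, 0, r, q],
    ![![0, 0, 0, 0], ![0, 0, 0, 0], ![0, 0, rr, rq], ![0, 0, rq, qq]]⟩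

theorem const_eq_planar (c : ℝ) : const c = planar c 0 0 0 0 0 := by
  ext i j
  · rfl
  · fin_cases i <;> rfl
  · fin_cases i <;> fin_cases j <;> rfl

theorem single_two (a b c : ℝ) : single 2 a b c = planar a b 0 c 0 0 := by
  ext i j
  · rfl
  · fin_cases i <;> simp [single, planar]
  · fin_cases i <;> fin_cases j <;> simp [single, planar]

theorem single_three (a b c : ℝ) : single 3 a b c = planar a 0 b 0 0 c := by
  ext i j
  · rfl
  · fin_cases i <;> simp [single, planar]
  · fin_cases i <;> fin_cases j <;> simp [single, planar]

theorem planar_add (v r q rr rq qq v' r' q' rr' rq' qq' : ℝ) :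
    (planar v r q rr rq qq).add (planar v' r' q' rr' rq' qq')
      = planar (v + v') (r + r') (q + q') (rr + rr') (rq + rq') (qq + qq') := by
  ext i j
  · rfl
  · fin_cases i <;> simp [add, planar]
  · fin_cases i <;> fin_cases j <;> simp [add, planar]

theorem planar_mul (v r q rr rq qq v' r' q' rr' rq' qq' : ℝ) :
    (planar v r q rr rq qq).mul (planar v' r' q' rr' rq' qq')
      = planar (v * v') (r * v' + v * r') (q * v' + v * q')
          (rr * v' + 2 * r * r' + v * rr') (rq * v' + r * q' + q * r' + v * rq')
          (qq * v' + 2 * q * q' + v * qq') := by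
  ext i j
  · rfl
  · fin_cases i <;> simp [mul, planar]
  · fin_cases i <;> fin_cases j <;> simp [mul, planar] <;> ring

theorem planar_inv (v r q rr rq qq : ℝ) :
    (planar v r q rr rq qq).inv
      = planar v⁻¹ (-r / v ^ 2) (-q / v ^ 2) (-rr / v ^ 2 + 2 * r ^ 2 / v ^ 3)
          (-rq / v ^ 2 + 2 * r * q / v ^ 3) (-qq / v ^ 2 + 2 * q ^ 2 / v ^ 3) := by
  ext i j
  · rfl
  · fin_cases i <;> simp [inv, planar]
  · fin_cases i <;> fin_cases j <;> simp [inv, planar] <;> ring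

end Jet

/-! ### The metric in the coordinates `r, q` -/

/-- The domain and regularity assumptions on `pdMetric ε C D`. -/
structure IsPDRegularOn (ε : ℝ) (C D : ℝ → ℝ) (U : Set (ℝ × ℝ)) : Prop where
  isOpen : IsOpen U
  smooth_left : ContDiffOn ℝ ∞ C (Prod.fst '' U)
  smooth_right : ContDiffOn ℝ ∞ D (Prod.snd '' U)
  regular : ∀ u ∈ U, PDRegularAt ε C D u.1 u.2

theorem pdMetric_eq (ε : ℝ) (C D : ℝ → ℝ) (p : Pt) :
    pdMetric ε C D p =
      let r := p 2
      let q := p 3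
      let w := 1 / ((1 + ε * r * q) ^ 2 * (r ^ 2 - q ^ 2))
      let v := (r ^ 2 - q ^ 2) / (1 + ε * r * q) ^ 2
      !![w * (C r + D q), -(w * (q ^ 2 * C r + r ^ 2 * D q)), 0, 0;
        -(w * (q ^ 2 * C r + r ^ 2 * D q)), w * (q ^ 4 * C r + r ^ 4 * D q), 0, 0;
        0, 0, v * (C r)⁻¹, 0;
        0, 0, 0, v * (D q)⁻¹] := by
  ext i j
  fin_cases i <;> fin_cases j <;>
    simp [pdMetric, symSq, Matrix.vecHead, Matrix.vecTail] <;> ring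

/-- The jet of `1 / (u² s)`, where `u = 1 + ε r q` and `s = r² - q²`;
the value of `u` is a separate argument. -/
noncomputable def pdJetW (ε u r q : ℝ) : Jet :=
  let s := r ^ 2 - q ^ 2
  .planar (1 / (u ^ 2 * s))
    (-(2 * ε * q) / (u ^ 3 * s) - 2 * r / (u ^ 2 * s ^ 2))
    (-(2 * ε * r) / (u ^ 3 * s) + 2 * q / (u ^ 2 * s ^ 2))
    (6 * ε ^ 2 * q ^ 2 / (u ^ 4 * s) + 8 * ε * q * r / (u ^ 3 * s ^ 2)
      + 8 * r ^ 2 / (u ^ 2 * s ^ 3) - 2 / (u ^ 2 * s ^ 2))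
    (6 * ε ^ 2 * r * q / (u ^ 4 * s) + 2 * ε / (u ^ 3 * s) - 8 * r * q / (u ^ 2 * s ^ 3))
    (6 * ε ^ 2 * r ^ 2 / (u ^ 4 * s) - 8 * ε * r * q / (u ^ 3 * s ^ 2)
      + 8 * q ^ 2 / (u ^ 2 * s ^ 3) + 2 / (u ^ 2 * s ^ 2))

/-- The jet of `s / u²`, where `u = 1 + ε r q` and `s = r² - q²`;
the value of `u` is a separate argument. -/
noncomputable def pdJetV (ε u r q : ℝ) : Jet :=
  let s := r ^ 2 - q ^ 2
  .planar (s / u ^ 2)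
    (2 * r / u ^ 2 - 2 * ε * q * s / u ^ 3)
    (-(2 * q) / u ^ 2 - 2 * ε * r * s / u ^ 3)
    (2 / u ^ 2 - 8 * ε * r * q / u ^ 3 + 6 * ε ^ 2 * q ^ 2 * s / u ^ 4)
    (-(6 * ε * s) / u ^ 3 + 6 * ε ^ 2 * r * q * s / u ^ 4)
    (-2 / u ^ 2 + 8 * ε * r * q / u ^ 3 + 6 * ε ^ 2 * r ^ 2 * s / u ^ 4)

/-- The jets of the entries of `pdMetric`, in terms of the values and the first two derivatives
of `C` and `D`. -/
noncomputable def pdJet (ε u r q C C1 C2 D D1 D2 : ℝ) : Fin 4 → Fin 4 → Jet :=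
  let h0 := (pdJetW ε u r q).mul (.planar (C + D) C1 D1 C2 0 D2)
  let h1 := (pdJetW ε u r q).mul (.planar (-(q ^ 2 * C + r ^ 2 * D)) (-(q ^ 2 * C1 + 2 * r * D))
    (-(2 * q * C + r ^ 2 * D1)) (-(q ^ 2 * C2 + 2 * D)) (-(2 * q * C1 + 2 * r * D1))
    (-(2 * C + r ^ 2 * D2)))
  let h2 := (pdJetW ε u r q).mul (.planar (q ^ 4 * C + r ^ 4 * D) (q ^ 4 * C1 + 4 * r ^ 3 * D)
    (4 * q ^ 3 * C + r ^ 4 * D1) (q ^ 4 * C2 + 12 * r ^ 2 * D) (4 * q ^ 3 * C1 + 4 * r ^ 3 * D1)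
    (12 * q ^ 2 * C + r ^ 4 * D2))
  let P := (pdJetV ε u r q).mul
    (.planar C⁻¹ (-C1 / C ^ 2) 0 (-C2 / C ^ 2 + 2 * C1 ^ 2 / C ^ 3) 0 0)
  let Q := (pdJetV ε u r q).mul
    (.planar D⁻¹ 0 (-D1 / D ^ 2) 0 0 (-D2 / D ^ 2 + 2 * D1 ^ 2 / D ^ 3))
  let z : Jet := .planar 0 0 0 0 0 0
  ![![h0, h1, z, z], ![h1, h2, z, z], ![z, z, P, z], ![z, z, z, Q]]

theorem isOpen_cylinder {U : Set (ℝ × ℝ)} (hU : IsOpen U) : IsOpen (cylinder U) :=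
  hU.preimage ((continuous_apply 2).prodMk (continuous_apply 3))

theorem Jet.planar_congr {v r q rr rq qq v' r' q' rr' rq' qq' : ℝ}
    (h1 : v = v') (h2 : r = r') (h3 : q = q') (h4 : rr = rr') (h5 : rq = rq') (h6 : qq = qq') :
    Jet.planar v r q rr rq qq = Jet.planar v' r' q' rr' rq' qq' := by
  subst h1 h2 h3 h4 h5 h6; rfl

section BasicJets

variable {S : Set Pt} {p : Pt}

theorem HasJet.r (hS : IsOpen S) (hp : p ∈ S) :
    HasJet S p (fun z => z 2) (.planar (p 2) 1 0 0 0 0) := by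
  simpa only [Jet.single_two] using HasJet.coord hS hp 2

theorem HasJet.q (hS : IsOpen S) (hp : p ∈ S) :
    HasJet S p (fun z => z 3) (.planar (p 3) 0 1 0 0 0) := by
  simpa only [Jet.single_three] using HasJet.coord hS hp 3

theorem HasJet.planar_const (c : ℝ) : HasJet S p (fun _ => c) (.planar c 0 0 0 0 0) := by
  simpa only [Jet.const_eq_planar] using HasJet.const c

theorem HasJet.r_sq (hS : IsOpen S) (hp : p ∈ S) :
    HasJet S p (fun z => z 2 ^ 2) (.planar (p 2 ^ 2) (2 * p 2) 0 2 0 0) := by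
  refine (((HasJet.r hS hp).mul hS hp (HasJet.r hS hp)).congr hS hp
    fun z _ => sq (z 2)).of_eq ?_
  rw [Jet.planar_mul]
  apply Jet.planar_congr <;> ring

theorem HasJet.q_sq (hS : IsOpen S) (hp : p ∈ S) :
    HasJet S p (fun z => z 3 ^ 2) (.planar (p 3 ^ 2) 0 (2 * p 3) 0 0 2) := by
  refine (((HasJet.q hS hp).mul hS hp (HasJet.q hS hp)).congr hS hp
    fun z _ => sq (z 3)).of_eq ?_
  rw [Jet.planar_mul]
  apply Jet.planar_congr <;> ring

theorem HasJet.u (hS : IsOpen S) (hp : p ∈ S) (ε : ℝ) :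
    HasJet S p (fun z => 1 + ε * z 2 * z 3)
      (.planar (1 + ε * p 2 * p 3) (ε * p 3) (ε * p 2) 0 ε 0) := by
  refine (((HasJet.planar_const 1).add hS hp (((HasJet.planar_const ε).mul hS hp
    (HasJet.r hS hp)).mul hS hp (HasJet.q hS hp)))).of_eq ?_
  simp only [Jet.planar_mul, Jet.planar_add]
  apply Jet.planar_congr <;> ring

theorem HasJet.s (hS : IsOpen S) (hp : p ∈ S) :
    HasJet S p (fun z => z 2 ^ 2 - z 3 ^ 2)
      (.planar (p 2 ^ 2 - p 3 ^ 2) (2 * p 2) (-(2 * p 3)) 2 0 (-2)) := by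
  refine (((HasJet.r_sq hS hp).add hS hp ((HasJet.planar_const (-1)).mul hS hp
    (HasJet.q_sq hS hp))).congr hS hp fun z _ => ?_).of_eq ?_
  · ring
  · simp only [Jet.planar_mul, Jet.planar_add]
    apply Jet.planar_congr <;> ring

theorem HasJet.inv_u_sq (hS : IsOpen S) (hp : p ∈ S) (ε : ℝ)
    (h0 : ∀ z ∈ S, 1 + ε * z 2 * z 3 ≠ 0) :
    HasJet S p (fun z => ((1 + ε * z 2 * z 3) ^ 2)⁻¹)
      (.planar ((1 + ε * p 2 * p 3) ^ 2)⁻¹ (-(2 * ε * p 3) / (1 + ε * p 2 * p 3) ^ 3)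
        (-(2 * ε * p 2) / (1 + ε * p 2 * p 3) ^ 3)
        (6 * ε ^ 2 * p 3 ^ 2 / (1 + ε * p 2 * p 3) ^ 4)
        (6 * ε ^ 2 * p 2 * p 3 / (1 + ε * p 2 * p 3) ^ 4 - 2 * ε / (1 + ε * p 2 * p 3) ^ 3)
        (6 * ε ^ 2 * p 2 ^ 2 / (1 + ε * p 2 * p 3) ^ 4)) := by
  have hi := (HasJet.u hS hp ε).inv hS hp h0
  refine ((hi.mul hS hp hi).congr hS hp fun z _ => ?_).of_eq ?_
  · rw [sq, mul_inv]
  · have h1 := h0 p hp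
    simp only [Jet.planar_inv, Jet.planar_mul]
    generalize 1 + ε * p 2 * p 3 = u at h1
    apply Jet.planar_congr <;> field_simp <;> ring

theorem HasJet.w (hS : IsOpen S) (hp : p ∈ S) (ε : ℝ)
    (h0 : ∀ z ∈ S, 1 + ε * z 2 * z 3 ≠ 0) (h1 : ∀ z ∈ S, z 2 ^ 2 - z 3 ^ 2 ≠ 0) :
    HasJet S p (fun z => 1 / ((1 + ε * z 2 * z 3) ^ 2 * (z 2 ^ 2 - z 3 ^ 2)))
      (pdJetW ε (1 + ε * p 2 * p 3) (p 2) (p 3)) := by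
  refine (((HasJet.inv_u_sq hS hp ε h0).mul hS hp ((HasJet.s hS hp).inv hS hp h1)).congr hS hp
    fun z _ => ?_).of_eq ?_
  · rw [one_div, mul_inv]
  · have hu := h0 p hp
    have hs := h1 p hp
    simp only [Jet.planar_inv, Jet.planar_mul, pdJetW]
    apply Jet.planar_congr <;> field_simp <;> ring

theorem HasJet.v (hS : IsOpen S) (hp : p ∈ S) (ε : ℝ)
    (h0 : ∀ z ∈ S, 1 + ε * z 2 * z 3 ≠ 0) :
    HasJet S p (fun z => (z 2 ^ 2 - z 3 ^ 2) / (1 + ε * z 2 * z 3) ^ 2)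
      (pdJetV ε (1 + ε * p 2 * p 3) (p 2) (p 3)) := by
  refine (((HasJet.inv_u_sq hS hp ε h0).mul hS hp (HasJet.s hS hp)).congr hS hp
    fun z _ => ?_).of_eq ?_
  · rw [div_eq_inv_mul]
  · have hu := h0 p hp
    simp only [Jet.planar_mul, pdJetV]
    apply Jet.planar_congr <;> field_simp <;> ring

end BasicJets

namespace IsPDRegularOn

variable {ε : ℝ} {C D : ℝ → ℝ} {U : Set (ℝ × ℝ)}

theorem ne_zero (h : IsPDRegularOn ε C D U) {p : Pt} (hp : p ∈ cylinder U) :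
    1 + ε * p 2 * p 3 ≠ 0 ∧ p 2 ^ 2 - p 3 ^ 2 ≠ 0 ∧ C (p 2) ≠ 0 ∧ D (p 3) ≠ 0 := by
  obtain ⟨h1, h2, h3, h4⟩ := h.regular _ hp
  refine ⟨h2, sub_ne_zero.2 h1, fun h0 => ?_, fun h0 => ?_⟩
  · simp [h0] at h3
  · simp [h0] at h4

theorem hasJet (h : IsPDRegularOn ε C D U) {p : Pt} (hp : p ∈ cylinder U) (a b : Fin 4) :
    HasJet (cylinder U) p (fun z => pdMetric ε C D z a b)
      (pdJet ε (1 + ε * p 2 * p 3) (p 2) (p 3) (C (p 2)) (deriv C (p 2))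
        (deriv (deriv C) (p 2))
        (D (p 3)) (deriv D (p 3)) (deriv (deriv D) (p 3)) a b) := by
  have hS := isOpen_cylinder h.isOpen
  have jC := HasJet.single hS hp 2 h.smooth_left fun z hz => ⟨_, hz, rfl⟩
  have jD := HasJet.single hS hp 3 h.smooth_right fun z hz => ⟨_, hz, rfl⟩
  rw [Jet.single_two] at jC
  rw [Jet.single_three] at jD
  have jCi := HasJet.inv hS hp jC fun z hz => (h.ne_zero hz).2.2.1
  have jDi := HasJet.inv hS hp jD fun z hz => (h.ne_zero hz).2.2.2
  have jr2 := HasJet.r_sq hS hp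
  have jq2 := HasJet.q_sq hS hp
  have jw := HasJet.w hS hp ε (fun z hz => (h.ne_zero hz).1) fun z hz => (h.ne_zero hz).2.1
  have jv := HasJet.v hS hp ε fun z hz => (h.ne_zero hz).1
  have jz : HasJet (cylinder U) p (fun _ => 0) (.planar 0 0 0 0 0 0) := HasJet.planar_const 0
  have j0 := jw.mul hS hp (jC.add hS hp jD)
  have j1 := jw.mul hS hp ((HasJet.planar_const (-1)).mul hS hp
    ((jq2.mul hS hp jC).add hS hp (jr2.mul hS hp jD)))
  have j2 := jw.mul hS hp (((jq2.mul hS hp jq2).mul hS hp jC).add hS hp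
    ((jr2.mul hS hp jr2).mul hS hp jD))
  have jP := jv.mul hS hp jCi
  have jQ := jv.mul hS hp jDi
  have e0 : HasJet (cylinder U) p (fun z => pdMetric ε C D z 0 0) (pdJet ε (1 + ε * p 2 * p 3) (p 2) (p 3) (C (p 2))
      (deriv C (p 2)) (deriv (deriv C) (p 2)) (D (p 3)) (deriv D (p 3)) (deriv (deriv D) (p 3))
      0 0) := by
    refine (j0.congr hS hp fun z _ => ?_).of_eq ?_
    · simp [pdMetric_eq]
    · simp only [Jet.planar_add, add_zero, zero_add]; rfl
  have e1 : HasJet (cylinder U) p (fun z => pdMetric ε C D z 0 1) (pdJet ε (1 + ε * p 2 * p 3) (p 2) (p 3) (C (p 2))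
      (deriv C (p 2)) (deriv (deriv C) (p 2)) (D (p 3)) (deriv D (p 3)) (deriv (deriv D) (p 3))
      0 1) := by
    refine (j1.congr hS hp fun z _ => ?_).of_eq ?_
    · simp only [pdMetric_eq, Matrix.of_apply, Matrix.cons_val]
      ring
    · simp only [Jet.planar_add, Jet.planar_mul]
      refine congrArg _ (Jet.planar_congr ?_ ?_ ?_ ?_ ?_ ?_) <;> ring
  have e2 : HasJet (cylinder U) p (fun z => pdMetric ε C D z 1 1) (pdJet ε (1 + ε * p 2 * p 3) (p 2) (p 3) (C (p 2))
      (deriv C (p 2)) (deriv (deriv C) (p 2)) (D (p 3)) (deriv D (p 3)) (deriv (deriv D) (p 3))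
      1 1) := by
    refine (j2.congr hS hp fun z _ => ?_).of_eq ?_
    · simp only [pdMetric_eq, Matrix.of_apply, Matrix.cons_val]
      ring
    · simp only [Jet.planar_add, Jet.planar_mul]
      refine congrArg _ (Jet.planar_congr ?_ ?_ ?_ ?_ ?_ ?_) <;> ring
  have eP : HasJet (cylinder U) p (fun z => pdMetric ε C D z 2 2) (pdJet ε (1 + ε * p 2 * p 3) (p 2) (p 3) (C (p 2))
      (deriv C (p 2)) (deriv (deriv C) (p 2)) (D (p 3)) (deriv D (p 3)) (deriv (deriv D) (p 3))
      2 2) := by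
    refine (jP.congr hS hp fun z _ => ?_).of_eq ?_
    · simp [pdMetric_eq]
    · simp only [Jet.planar_inv]
      refine congrArg _ (Jet.planar_congr ?_ ?_ ?_ ?_ ?_ ?_) <;> ring
  have eQ : HasJet (cylinder U) p (fun z => pdMetric ε C D z 3 3) (pdJet ε (1 + ε * p 2 * p 3) (p 2) (p 3) (C (p 2))
      (deriv C (p 2)) (deriv (deriv C) (p 2)) (D (p 3)) (deriv D (p 3)) (deriv (deriv D) (p 3))
      3 3) := by
    refine (jQ.congr hS hp fun z _ => ?_).of_eq ?_
    · simp [pdMetric_eq]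
    · simp only [Jet.planar_inv]
      refine congrArg _ (Jet.planar_congr ?_ ?_ ?_ ?_ ?_ ?_) <;> ring
  have ez : ∀ a b, (∀ z, pdMetric ε C D z a b = 0) →
      HasJet (cylinder U) p (fun z => pdMetric ε C D z a b) (.planar 0 0 0 0 0 0) :=
    fun a b hab => jz.congr hS hp fun z _ => hab z
  fin_cases a <;> fin_cases b
  · exact e0
  · exact e1
  · exact ez 0 2 fun z => by simp [pdMetric_eq]
  · exact ez 0 3 fun z => by simp [pdMetric_eq]
  · exact e1.congr hS hp fun z _ => by simp [pdMetric_eq]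
  · exact e2
  · exact ez 1 2 fun z => by simp [pdMetric_eq]
  · exact ez 1 3 fun z => by simp [pdMetric_eq]
  · exact ez 2 0 fun z => by simp [pdMetric_eq]
  · exact ez 2 1 fun z => by simp [pdMetric_eq]
  · exact eP
  · exact ez 2 3 fun z => by simp [pdMetric_eq]
  · exact ez 3 0 fun z => by simp [pdMetric_eq]
  · exact ez 3 1 fun z => by simp [pdMetric_eq]
  · exact ez 3 2 fun z => by simp [pdMetric_eq]
  · exact eQ

/-- The inverse of `pdMetric`. -/
theorem inv_eq (h : IsPDRegularOn ε C D U) {p : Pt} (hp : p ∈ cylinder U) :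
    pdMetric ε C D p *
      (let r := p 2
      let q := p 3
      let u := 1 + ε * r * q
      let s := r ^ 2 - q ^ 2
      !![u ^ 2 * (q ^ 4 * C r + r ^ 4 * D q) / (C r * D q * s),
          u ^ 2 * (q ^ 2 * C r + r ^ 2 * D q) / (C r * D q * s), 0, 0;
        u ^ 2 * (q ^ 2 * C r + r ^ 2 * D q) / (C r * D q * s),
          u ^ 2 * (C r + D q) / (C r * D q * s), 0, 0;
        0, 0, u ^ 2 * C r / s, 0;
        0, 0, 0, u ^ 2 * D q / s]) = 1 := by
  obtain ⟨hu, hs, hC, hD⟩ := h.ne_zero hp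
  rw [pdMetric_eq]
  dsimp only
  generalize 1 + ε * p 2 * p 3 = u at hu
  ext i j
  fin_cases i <;> fin_cases j <;>
    simp [Matrix.mul_apply, Fin.sum_univ_four] <;> field_simp <;> ring

theorem isSmoothMetricOn (h : IsPDRegularOn ε C D U) :
    IsSmoothMetricOn (pdMetric ε C D) (cylinder U) where
  smooth a b := fun p hp => (h.hasJet hp a b).smooth p hp
  symm p _ a b := by
    rw [pdMetric_eq]
    fin_cases a <;> fin_cases b <;> rfl
  det_ne_zero p hp := (Matrix.isUnit_det_of_right_inverse (h.inv_eq hp)).ne_zero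

end IsPDRegularOn

/-! ### The curvature of `pdMetric` -/

/-- The Christoffel symbols of the first kind, computed from the jets of the metric. -/
noncomputable def jetChristoffel (J : Fin 4 → Fin 4 → Jet) (a b c : Fin 4) : ℝ :=
  ((J a c).d b + (J a b).d c - (J b c).d a) / 2

/-- The curvature tensor, computed from the jets and the inverse of the metric. -/
noncomputable def jetCurvature (J : Fin 4 → Fin 4 → Jet) (gi : Matrix (Fin 4) (Fin 4) ℝ)
    (a b c d : Fin 4) : ℝ :=
  ((J a d).dd b c + (J b c).dd a d - (J b d).dd a c - (J a c).dd b d) / 2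
    + ∑ e, ∑ f, gi e f * (jetChristoffel J e b c * jetChristoffel J f a d
      - jetChristoffel J e b d * jetChristoffel J f a c)

theorem IsSmoothMetricOn.riemannLow_eq_jetCurvature {g : MetricField} {S : Set Pt}
    (hg : IsSmoothMetricOn g S) (hS : IsOpen S) {p : Pt} (hp : p ∈ S)
    {J : Fin 4 → Fin 4 → Jet} (hJ : ∀ a b, HasJet S p (fun z => g z a b) (J a b))
    (a b c d : Fin 4) :
    riemannLow g a b c d p = jetCurvature J (g p)⁻¹ a b c d := by
  simp only [hg.riemannLow_eq hS hp, jetCurvature, jetChristoffel, christoffelLow,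
    (hJ _ _).d, (hJ _ _).dd]

/-- The inverse of `pdMetric`, in terms of the values of `u = 1 + ε r q`, `r`, `q`, `C`, `D`. -/
noncomputable def pdInv (u r q C D : ℝ) : Matrix (Fin 4) (Fin 4) ℝ :=
  let s := r ^ 2 - q ^ 2
  !![u ^ 2 * (q ^ 4 * C + r ^ 4 * D) / (C * D * s), u ^ 2 * (q ^ 2 * C + r ^ 2 * D) / (C * D * s),
      0, 0;
    u ^ 2 * (q ^ 2 * C + r ^ 2 * D) / (C * D * s), u ^ 2 * (C + D) / (C * D * s), 0, 0;
    0, 0, u ^ 2 * C / s, 0;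
    0, 0, 0, u ^ 2 * D / s]

/-- The curvature components along `e⁰∧e¹`. -/
noncomputable def curv01 (ε u r q C C1 C2 D : ℝ) : ℝ :=
  let s := r ^ 2 - q ^ 2
  u ^ 2 * (-(3 * r ^ 2 + q ^ 2) * (C + D) / s ^ 3 + 2 * r * C1 / s ^ 2 - C2 / (2 * s))
    + u * ε * (-2 * r * q * (C + D) / s ^ 2 + q * C1 / s) - ε ^ 2 * (q ^ 2 * C + r ^ 2 * D) / s

noncomputable def curv23 (ε u r q C D D1 D2 : ℝ) : ℝ :=
  let s := r ^ 2 - q ^ 2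
  u ^ 2 * (-(r ^ 2 + 3 * q ^ 2) * (C + D) / s ^ 3 - 2 * q * D1 / s ^ 2 - D2 / (2 * s))
    + u * ε * (2 * r * q * (C + D) / s ^ 2 + r * D1 / s) - ε ^ 2 * (q ^ 2 * C + r ^ 2 * D) / s

/-- The coefficient coupling a plane to its orthogonal complement. It enters with weights 1, -1/2,
-1/2 on the three complementary pairs, which add up to zero as the first Bianchi identity requires.
-/
noncomputable def curvMixed (u r q C C1 D D1 : ℝ) : ℝ :=
  let s := r ^ 2 - q ^ 2
  u ^ 2 * (-4 * r * q * (C + D) / s ^ 3 + q * C1 / s ^ 2 - r * D1 / s ^ 2)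

/-- The common sectional curvature of the four planes that take one direction from e⁰, e¹ and one
from e², e³. -/
noncomputable def curv02 (ε u r q C C1 D D1 : ℝ) : ℝ :=
  let s := r ^ 2 - q ^ 2
  u ^ 2 * ((r ^ 2 + q ^ 2) * (C + D) / s ^ 3 - r * C1 / (2 * s ^ 2) + q * D1 / (2 * s ^ 2))
    + u * ε * (q * C1 / (2 * s) + r * D1 / (2 * s)) - ε ^ 2 * (q ^ 2 * C + r ^ 2 * D) / s

/-- The coframe `dτ - q² dφ, dr, dq, dτ - r² dφ`. -/
noncomputable def pdFrame (r q : ℝ) : Fin 4 → Fin 4 → ℝ :=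
  ![![1, -q ^ 2, 0, 0], ![0, 0, 1, 0], ![0, 0, 0, 1], ![1, -r ^ 2, 0, 0]]

/-- The product `(θ^I ∧ θ^J) ⊗ (θ^K ∧ θ^L)` for the coframe `θ`. -/
def wedgeTensor (θ : Fin 4 → Fin 4 → ℝ) (I J K L a b c d : Fin 4) : ℝ :=
  wedge (θ I) (θ J) a b * wedge (θ K) (θ L) c d

/-- The curvature tensor of `pdMetric` in terms of the coframe `pdFrame`. -/
noncomputable def pdCurvature (ε u r q C C1 C2 D D1 D2 : ℝ) (a b c d : Fin 4) : ℝ :=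
  let s := r ^ 2 - q ^ 2
  let W := fun I J K L => wedgeTensor (pdFrame r q) I J K L a b c d
  (curv01 ε u r q C C1 C2 D * W 0 1 0 1 + curv23 ε u r q C D D1 D2 * W 2 3 2 3
    + curvMixed u r q C C1 D D1 * (W 0 1 2 3 + W 2 3 0 1
      - (W 0 2 3 1 + W 3 1 0 2 + W 0 3 1 2 + W 1 2 0 3) / 2)
    + curv02 ε u r q C C1 D D1 * (C / D * W 0 2 0 2 + D / C * W 3 1 3 1
      + C * D / s ^ 2 * W 0 3 0 3 + s ^ 2 / (C * D) * W 1 2 1 2)) / u ^ 4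

-- Here u is an indeterminate: the jets contain only the derivatives εq, εr, ε of u, and the
-- identity holds without u = 1 + εrq. The order conditions on the indices leave the 21 components
-- of `HasCurvatureSymm.ext`, each a rational identity. Using `pdFrame`, which is not normalised,
-- keeps square roots out; the factors C/D, D/C and so on compensate for the lengths.
set_option maxHeartbeats 2000000 in
theorem jetCurvature_pdJet {ε u r q C C1 C2 D D1 D2 : ℝ} (hu : u ≠ 0) (hs : r ^ 2 - q ^ 2 ≠ 0)
    (hC : C ≠ 0) (hD : D ≠ 0) (a b c d : Fin 4) (hab : a < b) (hcd : c < d) (hac : a ≤ c)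
    (hbd : a = c → b ≤ d) :
    jetCurvature (pdJet ε u r q C C1 C2 D D1 D2) (pdInv u r q C D) a b c d =
      pdCurvature ε u r q C C1 C2 D D1 D2 a b c d := by
  fin_cases a <;> fin_cases b <;> (try (exfalso; revert hab; decide)) <;>
    fin_cases c <;> (try (exfalso; revert hac; decide)) <;>
    fin_cases d <;> (try (exfalso; revert hcd; decide)) <;>
    (try (exfalso; revert hbd; decide)) <;> clear hab hcd hac hbd <;>
    simp [jetCurvature, jetChristoffel, Fin.sum_univ_four, pdJet, pdInv, Jet.planar, Jet.mul,
      pdJetW, pdJetV, pdCurvature, wedgeTensor, wedge, pdFrame, curv01, curv23, curvMixed,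
      curv02] <;> field_simp <;> ring

theorem pdCurvature_symm (ε u r q C C1 C2 D D1 D2 : ℝ) :
    HasCurvatureSymm (pdCurvature ε u r q C C1 C2 D D1 D2) := by
  constructor <;> intro a b c d <;> simp only [pdCurvature, wedgeTensor, wedge, Matrix.of_apply] <;>
    ring

/-! ### Contractions in an orthonormal coframe -/

section Coframe

variable {g : MetricField} {x : Pt} {e : Fin 4 → Fin 4 → ℝ}

theorem IsOrthonormalCoframeAt.contract (he : IsOrthonormalCoframeAt g x e)
    (h0 : (g x).det ≠ 0) (I J : Fin 4) :
    ∑ a, ∑ b, (g x)⁻¹ a b * e I a * e J b = if I = J then 1 else 0 := by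
  have h1 : g x = (Matrix.of e).transpose * Matrix.of e := by
    ext a b
    rw [Matrix.mul_apply, he]
    rfl
  have h2 : (Matrix.of e).transpose * (Matrix.of e * (g x)⁻¹) = 1 := by
    rw [← Matrix.mul_assoc, ← h1, Matrix.mul_nonsing_inv _ (isUnit_iff_ne_zero.2 h0)]
  have h3 : (Matrix.of e * (g x)⁻¹ * (Matrix.of e).transpose) I J = (1 : Matrix _ _ ℝ) I J := by
    -- From g = EᵀE, the matrix E g⁻¹ is a right inverse of the square matrix Eᵀ, hence also a left
    -- inverse: E g⁻¹ Eᵀ = 1.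
    rw [mul_eq_one_comm.1 h2]
  rw [Matrix.mul_apply, Matrix.one_apply] at h3
  rw [← h3, Finset.sum_comm]
  refine Finset.sum_congr rfl fun b _ => ?_
  rw [Matrix.mul_apply, Finset.sum_mul]
  refine Finset.sum_congr rfl fun a _ => ?_
  simp only [Matrix.of_apply, Matrix.transpose_apply]
  ring

theorem IsOrthonormalCoframeAt.symm (he : IsOrthonormalCoframeAt g x e) (a b : Fin 4) :
    g x a b = g x b a := by
  rw [he, he]
  exact Finset.sum_congr rfl fun I _ => mul_comm _ _

/-- Contraction of the first and third indices of `(e^I ∧ e^J) ⊗ (e^K ∧ e^L)`. -/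
theorem IsOrthonormalCoframeAt.contract_wedgeTensor (he : IsOrthonormalCoframeAt g x e)
    (h0 : (g x).det ≠ 0) (I J K L b d : Fin 4) :
    ∑ a, ∑ c, (g x)⁻¹ a c * wedgeTensor e I J K L a b c d
      = (if I = K then 1 else 0) * e J b * e L d - (if I = L then 1 else 0) * e J b * e K d
        - (if J = K then 1 else 0) * e I b * e L d
        + (if J = L then 1 else 0) * e I b * e K d := by
  simp only [← he.contract h0, Finset.sum_mul]
  simp only [← Finset.sum_add_distrib, ← Finset.sum_sub_distrib, wedgeTensor, wedge,
    Matrix.of_apply]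
  refine Finset.sum_congr rfl fun a _ => Finset.sum_congr rfl fun c _ => ?_
  ring

/-- A 2-form with its indices raised by `g`. -/
noncomputable def raise (g : MetricField) (x : Pt) (β : Matrix (Fin 4) (Fin 4) ℝ)
    (c d : Fin 4) : ℝ :=
  ∑ p, ∑ q, (g x)⁻¹ c p * (g x)⁻¹ d q * β p q

/-- The inner product of 2-forms. -/
noncomputable def formInner (g : MetricField) (x : Pt) (α β : Matrix (Fin 4) (Fin 4) ℝ) : ℝ :=
  (∑ c, ∑ d, α c d * raise g x β c d) / 2

theorem formInner_add (α β γ : Matrix (Fin 4) (Fin 4) ℝ) :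
    formInner g x α (β + γ) = formInner g x α β + formInner g x α γ := by
  simp only [formInner, raise, Matrix.add_apply, mul_add, Finset.sum_add_distrib]
  ring

theorem formInner_sub (α β γ : Matrix (Fin 4) (Fin 4) ℝ) :
    formInner g x α (β - γ) = formInner g x α β - formInner g x α γ := by
  simp only [formInner, raise, Matrix.sub_apply, mul_sub, Finset.sum_sub_distrib]
  ring

theorem IsOrthonormalCoframeAt.formInner_wedge (he : IsOrthonormalCoframeAt g x e)
    (h0 : (g x).det ≠ 0) (I J K L : Fin 4) :
    formInner g x (wedge (e I) (e J)) (wedge (e K) (e L))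
      = (if I = K then 1 else 0) * (if J = L then 1 else 0)
        - (if I = L then 1 else 0) * (if J = K then 1 else 0) := by
  have h1 : ∀ I J K L, ∑ c, ∑ d, ∑ p, ∑ q,
      e I c * e J d * ((g x)⁻¹ c p * (g x)⁻¹ d q * (e K p * e L q))
      = (if I = K then 1 else 0) * (if J = L then 1 else 0) := by
    intro I J K L
    rw [← he.contract h0 I K, ← he.contract h0 J L, Finset.sum_mul_sum]
    refine Finset.sum_congr rfl fun c _ => Finset.sum_congr rfl fun d _ => ?_
    rw [Finset.sum_mul_sum]
    refine Finset.sum_congr rfl fun p _ => Finset.sum_congr rfl fun q _ => ?_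
    ring
  have h2 : formInner g x (wedge (e I) (e J)) (wedge (e K) (e L))
      = ((∑ c, ∑ d, ∑ p, ∑ q, e I c * e J d * ((g x)⁻¹ c p * (g x)⁻¹ d q * (e K p * e L q)))
        - (∑ c, ∑ d, ∑ p, ∑ q, e I c * e J d * ((g x)⁻¹ c p * (g x)⁻¹ d q * (e L p * e K q)))
        - (∑ c, ∑ d, ∑ p, ∑ q, e J c * e I d * ((g x)⁻¹ c p * (g x)⁻¹ d q * (e K p * e L q)))
        + (∑ c, ∑ d, ∑ p, ∑ q, e J c * e I d
            * ((g x)⁻¹ c p * (g x)⁻¹ d q * (e L p * e K q)))) / 2 := by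
    simp only [formInner, raise, Finset.mul_sum, ← Finset.sum_add_distrib,
      ← Finset.sum_sub_distrib, wedge, Matrix.of_apply]
    congr 1
    refine Finset.sum_congr rfl fun c _ => Finset.sum_congr rfl fun d _ =>
      Finset.sum_congr rfl fun p _ => Finset.sum_congr rfl fun q _ => ?_
    ring
  rw [h2, h1, h1, h1, h1]
  ring

theorem ricci_eq_sum_riemannLow (h0 : (g x).det ≠ 0) (b d : Fin 4) :
    ricci g b d x = ∑ a, ∑ c, (g x)⁻¹ a c * riemannLow g c b a d x := by
  have h1 := Matrix.nonsing_inv_mul (g x) (isUnit_iff_ne_zero.2 h0)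
  unfold ricci riemannLow
  refine Finset.sum_congr rfl fun a _ => ?_
  simp only [Finset.mul_sum]
  rw [Finset.sum_comm]
  simp only [← mul_assoc, ← Finset.sum_mul]
  have h2 : ∀ f, ∑ c, (g x)⁻¹ a c * g x c f = if a = f then 1 else 0 := by
    intro f
    rw [← Matrix.mul_apply, h1, Matrix.one_apply]
  simp only [h2, ite_mul, one_mul, zero_mul, Finset.sum_ite_eq, Finset.mem_univ, if_true]

/-- The curvature tensor with the given components in the coframe `e`. -/
noncomputable def frameCurvature (e : Fin 4 → Fin 4 → ℝ) (f0 f1 f2 f3 : ℝ) (a b c d : Fin 4) :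
    ℝ :=
  let W := fun I J K L => wedgeTensor e I J K L a b c d
  f0 * W 0 1 0 1 + f1 * W 2 3 2 3
    + f2 * (W 0 1 2 3 + W 2 3 0 1 - (W 0 2 3 1 + W 3 1 0 2 + W 0 3 1 2 + W 1 2 0 3) / 2)
    + f3 * (W 0 2 0 2 + W 3 1 3 1 + W 0 3 0 3 + W 1 2 1 2)

/-- The f2 terms pair planes without a common index, so they have no trace. Each covector lies in
one plane with coefficient f0 or f1 and in two planes with coefficient f3. -/
theorem ricci_of_frameCurvature (he : IsOrthonormalCoframeAt g x e) (h0 : (g x).det ≠ 0)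
    {f0 f1 f2 f3 : ℝ} (hR : ∀ a b c d, riemannLow g a b c d x = frameCurvature e f0 f1 f2 f3 a b c d)
    (b d : Fin 4) :
    ricci g b d x = (f0 + 2 * f3) * (e 0 b * e 0 d + e 1 b * e 1 d)
      + (f1 + 2 * f3) * (e 2 b * e 2 d + e 3 b * e 3 d) := by
  have hc := he.contract_wedgeTensor h0
  have hsy : ∀ a c, (g x)⁻¹ a c = (g x)⁻¹ c a := by
    have h : (g x).transpose = g x := by
      ext i j
      exact he.symm j i
    have h2 := Matrix.transpose_nonsing_inv (g x)
    rw [h] at h2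
    exact fun a c => congrFun (congrFun h2 c) a
  have h1 : ricci g b d x = ∑ a, ∑ c, (g x)⁻¹ a c * frameCurvature e f0 f1 f2 f3 a b c d := by
    rw [ricci_eq_sum_riemannLow h0, Finset.sum_comm]
    refine Finset.sum_congr rfl fun a _ => Finset.sum_congr rfl fun c _ => ?_
    rw [hR, hsy]
  have h2 : ricci g b d x =
      f0 * (∑ a, ∑ c, (g x)⁻¹ a c * wedgeTensor e 0 1 0 1 a b c d)
      + f1 * (∑ a, ∑ c, (g x)⁻¹ a c * wedgeTensor e 2 3 2 3 a b c d)
      + f2 * ((∑ a, ∑ c, (g x)⁻¹ a c * wedgeTensor e 0 1 2 3 a b c d)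
        + (∑ a, ∑ c, (g x)⁻¹ a c * wedgeTensor e 2 3 0 1 a b c d)
        - ((∑ a, ∑ c, (g x)⁻¹ a c * wedgeTensor e 0 2 3 1 a b c d)
          + (∑ a, ∑ c, (g x)⁻¹ a c * wedgeTensor e 3 1 0 2 a b c d)
          + (∑ a, ∑ c, (g x)⁻¹ a c * wedgeTensor e 0 3 1 2 a b c d)
          + (∑ a, ∑ c, (g x)⁻¹ a c * wedgeTensor e 1 2 0 3 a b c d)) / 2)
      + f3 * ((∑ a, ∑ c, (g x)⁻¹ a c * wedgeTensor e 0 2 0 2 a b c d)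
        + (∑ a, ∑ c, (g x)⁻¹ a c * wedgeTensor e 3 1 3 1 a b c d)
        + (∑ a, ∑ c, (g x)⁻¹ a c * wedgeTensor e 0 3 0 3 a b c d)
        + (∑ a, ∑ c, (g x)⁻¹ a c * wedgeTensor e 1 2 1 2 a b c d)) := by
    rw [h1]
    simp only [Finset.mul_sum, Finset.sum_div, ← Finset.sum_add_distrib,
      ← Finset.sum_sub_distrib, frameCurvature]
    refine Finset.sum_congr rfl fun a _ => Finset.sum_congr rfl fun c _ => ?_
    ring
  rw [h2]
  simp only [hc]
  simp
  ring

/-- The Weyl tensor of an Einstein metric. -/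
theorem weyl_of_einstein (he : IsOrthonormalCoframeAt g x e) (h0 : (g x).det ≠ 0) {Λ : ℝ}
    (hE : ∀ a b, ricci g a b x = Λ * g x a b) (a b c d : Fin 4) :
    weyl g a b c d x = riemannLow g a b c d x
      - Λ / 3 * frameCurvature e 1 1 0 1 a b c d := by
  have hs : scalarCurv g x = 4 * Λ := by
    have h1 := Matrix.nonsing_inv_mul (g x) (isUnit_iff_ne_zero.2 h0)
    have h2 : ∀ a, ∑ b, (g x)⁻¹ a b * (Λ * g x a b) = Λ := by
      intro a
      have h3 : ((g x)⁻¹ * g x) a a = 1 := by rw [h1, Matrix.one_apply_eq]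
      rw [Matrix.mul_apply] at h3
      calc ∑ b, (g x)⁻¹ a b * (Λ * g x a b) = Λ * ∑ b, (g x)⁻¹ a b * g x b a := by
            rw [Finset.mul_sum]
            refine Finset.sum_congr rfl fun b _ => ?_
            rw [he.symm a b]
            ring
        _ = Λ := by rw [h3, mul_one]
    simp only [scalarCurv, hE, h2, Finset.sum_const, Finset.card_univ, Fintype.card_fin,
      nsmul_eq_mul]
    norm_num
  have hgg : g x a c * g x b d - g x a d * g x b c = frameCurvature e 1 1 0 1 a b c d := by
    simp only [he _ _, Fin.sum_univ_four, frameCurvature, wedgeTensor, wedge, Matrix.of_apply]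
    ring
  rw [weyl, hs, hE, hE, hE, hE, ← hgg]
  ring

/-- The tensor is a sum of products of 2-forms, so its action on β pairs the second factor with β.
This reduces the eigenvalue problem to inner products of the six basic 2-forms. -/
theorem weylOp_of_frameCurvature {f0 f1 f2 f3 : ℝ} (hW : ∀ a b c d, weyl g a b c d x = frameCurvature e f0 f1 f2 f3 a b c d)
    (β : Matrix (Fin 4) (Fin 4) ℝ) :
    weylOp g x β =
      (f0 * formInner g x (wedge (e 0) (e 1)) β + f2 * formInner g x (wedge (e 2) (e 3)) β)
        • wedge (e 0) (e 1)
      + (f1 * formInner g x (wedge (e 2) (e 3)) β + f2 * formInner g x (wedge (e 0) (e 1)) β)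
        • wedge (e 2) (e 3)
      + (f3 * formInner g x (wedge (e 0) (e 2)) β
        - f2 / 2 * formInner g x (wedge (e 3) (e 1)) β) • wedge (e 0) (e 2)
      + (f3 * formInner g x (wedge (e 3) (e 1)) β
        - f2 / 2 * formInner g x (wedge (e 0) (e 2)) β) • wedge (e 3) (e 1)
      + (f3 * formInner g x (wedge (e 0) (e 3)) β
        - f2 / 2 * formInner g x (wedge (e 1) (e 2)) β) • wedge (e 0) (e 3)
      + (f3 * formInner g x (wedge (e 1) (e 2)) β
        - f2 / 2 * formInner g x (wedge (e 0) (e 3)) β) • wedge (e 1) (e 2) := by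
  ext a b
  have h1 : weylOp g x β a b = (∑ c, ∑ d, weyl g a b c d x * raise g x β c d) / 2 := by
    simp only [weylOp, raise, Matrix.of_apply, Finset.mul_sum, mul_assoc]
  rw [h1]
  simp only [hW, formInner, Matrix.add_apply, Matrix.smul_apply, smul_eq_mul,
    Finset.mul_sum, Finset.sum_mul, Finset.sum_div, ← Finset.sum_add_distrib,
    ← Finset.sum_sub_distrib, frameCurvature, wedgeTensor]
  refine Finset.sum_congr rfl fun c _ => Finset.sum_congr rfl fun d _ => ?_
  ring

/-- A curvature tensor of type `D ⊗ D`. -/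
theorem isTypeDDAt_of_frameCurvature (he : IsOrthonormalCoframeAt g x e) (h0 : (g x).det ≠ 0)
    {α β : ℝ} (hW : ∀ a b c d, weyl g a b c d x
      = frameCurvature e (α + β) (α + β) (β - α) (-(α + β) / 2) a b c d) :
    IsTypeDDAt g x e α β := by
  have hop := weylOp_of_frameCurvature hW
  have hi := he.formInner_wedge h0
  refine ⟨he, fun i => ?_, fun i => ?_⟩
  -- With indices modulo 3 the partner of e⁰∧e² is e³∧e¹, not e¹∧e³; `frameCurvature` uses the same
  -- cyclic orientation.
  · have hsd : ∀ i, sdForm e i = ![wedge (e 0) (e 1) - wedge (e 2) (e 3),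
        wedge (e 0) (e 2) - wedge (e 3) (e 1), wedge (e 0) (e 3) - wedge (e 1) (e 2)] i := by
      intro i; fin_cases i <;> rfl
    rw [hop, hsd]
    fin_cases i <;> ext a b <;>
      simp [formInner_sub, hi, typeDEigenvalue] <;> ring
  · have hasd : ∀ i, asdForm e i = ![wedge (e 0) (e 1) + wedge (e 2) (e 3),
        wedge (e 0) (e 2) + wedge (e 3) (e 1), wedge (e 0) (e 3) + wedge (e 1) (e 2)] i := by
      intro i; fin_cases i <;> rfl
    rw [hop, hasd]
    fin_cases i <;> ext a b <;>
      simp [formInner_add, hi, typeDEigenvalue] <;> ring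

end Coframe

section

/-! ### Curvature of `pdMetric` in the orthonormal coframe -/

theorem wedge_smul (a b : ℝ) (u v : Fin 4 → ℝ) :
    wedge (a • u) (b • v) = (a * b) • wedge u v := by
  ext i j
  simp [wedge]
  ring

theorem wedgeTensor_smul (t : Fin 4 → ℝ) (θ : Fin 4 → Fin 4 → ℝ) (I J K L a b c d : Fin 4) :
    wedgeTensor (fun I => t I • θ I) I J K L a b c d
      = t I * t J * t K * t L * wedgeTensor θ I J K L a b c d := by
  simp only [wedgeTensor, wedge_smul, Matrix.smul_apply, smul_eq_mul]
  ring

/-- The lengths of the elements of `pdFrame`. -/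
noncomputable def pdScale (ε : ℝ) (C D : ℝ → ℝ) (p : Pt) : Fin 4 → ℝ :=
  let u := 1 + ε * p 2 * p 3
  let s := p 2 ^ 2 - p 3 ^ 2
  ![1 / u * Real.sqrt (C (p 2) / s), 1 / u * Real.sqrt (s / C (p 2)),
    1 / u * Real.sqrt (s / D (p 3)), 1 / u * Real.sqrt (D (p 3) / s)]

theorem pdCoframe_eq (ε : ℝ) (C D : ℝ → ℝ) (p : Pt) :
    pdCoframe ε C D p = fun I => pdScale ε C D p I • pdFrame (p 2) (p 3) I := by
  funext I
  fin_cases I <;> rfl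

/-- With x and y the square roots of C/(r² - q²) and D/(r² - q²), the lengths of the coframe and the
values C, D are all rational in x, y, r, q and 1 + εrq, so the remaining checks are field identities
without radicals. -/
theorem exists_pdScale {ε : ℝ} {C D : ℝ → ℝ} {p : Pt} (h : PDRegularAt ε C D (p 2) (p 3)) :
    ∃ x y : ℝ, 0 < x ∧ 0 < y ∧ C (p 2) = x ^ 2 * (p 2 ^ 2 - p 3 ^ 2) ∧
      D (p 3) = y ^ 2 * (p 2 ^ 2 - p 3 ^ 2) ∧
      pdScale ε C D p = ![x / (1 + ε * p 2 * p 3), 1 / (x * (1 + ε * p 2 * p 3)),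
        1 / (y * (1 + ε * p 2 * p 3)), y / (1 + ε * p 2 * p 3)] := by
  obtain ⟨h1, h2, h3, h4⟩ := h
  have hs := sub_ne_zero.2 h1
  refine ⟨_, _, Real.sqrt_pos.2 h3, Real.sqrt_pos.2 h4, ?_, ?_, ?_⟩
  · rw [Real.sq_sqrt h3.le, div_mul_cancel₀ _ hs]
  · rw [Real.sq_sqrt h4.le, div_mul_cancel₀ _ hs]
  · have e1 : Real.sqrt ((p 2 ^ 2 - p 3 ^ 2) / C (p 2))
        = (Real.sqrt (C (p 2) / (p 2 ^ 2 - p 3 ^ 2)))⁻¹ := by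
      rw [← Real.sqrt_inv, inv_div]
    have e2 : Real.sqrt ((p 2 ^ 2 - p 3 ^ 2) / D (p 3))
        = (Real.sqrt (D (p 3) / (p 2 ^ 2 - p 3 ^ 2)))⁻¹ := by
      rw [← Real.sqrt_inv, inv_div]
    simp only [pdScale, e1, e2]
    funext I
    fin_cases I <;> simp [div_eq_mul_inv, mul_comm]

theorem isOrthonormalCoframeAt_pdCoframe {ε : ℝ} {C D : ℝ → ℝ} {p : Pt}
    (h : PDRegularAt ε C D (p 2) (p 3)) :
    IsOrthonormalCoframeAt (pdMetric ε C D) p (pdCoframe ε C D p) := by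
  obtain ⟨x, y, hx, hy, hC, hD, hsc⟩ := exists_pdScale h
  have hs := sub_ne_zero.2 h.1
  have hu := h.2.1
  intro a b
  rw [pdCoframe_eq, pdMetric_eq, hsc]
  simp only [hC, hD]
  generalize 1 + ε * p 2 * p 3 = u at hu
  fin_cases a <;> fin_cases b <;> simp [Fin.sum_univ_four, pdFrame] <;> field_simp <;> ring

variable {ε : ℝ} {C D : ℝ → ℝ} {U : Set (ℝ × ℝ)}

theorem IsPDRegularOn.riemannLow_eq_pdCurvature (h : IsPDRegularOn ε C D U) {p : Pt}
    (hp : p ∈ cylinder U) (a b c d : Fin 4) :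
    riemannLow (pdMetric ε C D) a b c d p
      = pdCurvature ε (1 + ε * p 2 * p 3) (p 2) (p 3) (C (p 2)) (deriv C (p 2))
        (deriv (deriv C) (p 2)) (D (p 3)) (deriv D (p 3)) (deriv (deriv D) (p 3)) a b c d := by
  have hS := isOpen_cylinder h.isOpen
  have hinv : (pdMetric ε C D p)⁻¹ = pdInv (1 + ε * p 2 * p 3) (p 2) (p 3) (C (p 2)) (D (p 3)) :=
    Matrix.inv_eq_right_inv (h.inv_eq hp)
  obtain ⟨hu, hs, hC, hD⟩ := h.ne_zero hp
  refine (h.isSmoothMetricOn.riemannLow_symm hS hp).ext (pdCurvature_symm _ _ _ _ _ _ _ _ _ _)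
    (fun a b c d hab hcd hac hbd => ?_) a b c d
  rw [h.isSmoothMetricOn.riemannLow_eq_jetCurvature hS hp (h.hasJet hp), hinv,
    jetCurvature_pdJet hu hs hC hD a b c d hab hcd hac hbd]

theorem IsPDRegularOn.riemannLow_eq (h : IsPDRegularOn ε C D U) {p : Pt}
    (hp : p ∈ cylinder U) (a b c d : Fin 4) :
    riemannLow (pdMetric ε C D) a b c d p
      = frameCurvature (pdCoframe ε C D p)
        (curv01 ε (1 + ε * p 2 * p 3) (p 2) (p 3) (C (p 2)) (deriv C (p 2))
          (deriv (deriv C) (p 2)) (D (p 3)))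
        (curv23 ε (1 + ε * p 2 * p 3) (p 2) (p 3) (C (p 2)) (D (p 3)) (deriv D (p 3))
          (deriv (deriv D) (p 3)))
        (curvMixed (1 + ε * p 2 * p 3) (p 2) (p 3) (C (p 2)) (deriv C (p 2)) (D (p 3))
          (deriv D (p 3)))
        (curv02 ε (1 + ε * p 2 * p 3) (p 2) (p 3) (C (p 2)) (deriv C (p 2)) (D (p 3))
          (deriv D (p 3))) a b c d := by
  obtain ⟨hu, hs, hC0, hD0⟩ := h.ne_zero hp
  obtain ⟨x, y, hx, hy, hC, hD, hsc⟩ := exists_pdScale (h.regular _ hp)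
  rw [h.riemannLow_eq_pdCurvature hp, pdCoframe_eq]
  simp only [pdCurvature, frameCurvature, wedgeTensor_smul, hsc]
  generalize curv01 _ _ _ _ _ _ _ _ = f0
  generalize curv23 _ _ _ _ _ _ _ _ = f1
  generalize curvMixed _ _ _ _ _ _ _ = f2
  generalize curv02 _ _ _ _ _ _ _ _ = f3
  rw [hC, hD]
  generalize 1 + ε * p 2 * p 3 = u at hu
  generalize wedgeTensor (pdFrame (p 2) (p 3)) = W
  generalize p 2 ^ 2 - p 3 ^ 2 = s at hs
  simp
  field_simp

/-- `pdMetric` is Einstein at a point if and only if its curvature components satisfy two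
equations. -/
theorem IsPDRegularOn.einstein_iff (h : IsPDRegularOn ε C D U) {p : Pt}
    (hp : p ∈ cylinder U) (Λ : ℝ) :
    (∀ a b, ricci (pdMetric ε C D) a b p = Λ * pdMetric ε C D p a b) ↔
      curv01 ε (1 + ε * p 2 * p 3) (p 2) (p 3) (C (p 2)) (deriv C (p 2))
          (deriv (deriv C) (p 2)) (D (p 3))
        + 2 * curv02 ε (1 + ε * p 2 * p 3) (p 2) (p 3) (C (p 2)) (deriv C (p 2)) (D (p 3))
          (deriv D (p 3)) = Λ ∧
      curv23 ε (1 + ε * p 2 * p 3) (p 2) (p 3) (C (p 2)) (D (p 3)) (deriv D (p 3))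
          (deriv (deriv D) (p 3))
        + 2 * curv02 ε (1 + ε * p 2 * p 3) (p 2) (p 3) (C (p 2)) (deriv C (p 2)) (D (p 3))
          (deriv D (p 3)) = Λ := by
  have he := isOrthonormalCoframeAt_pdCoframe (h.regular _ hp)
  have h0 := h.isSmoothMetricOn.det_ne_zero p hp
  have hR := ricci_of_frameCurvature he h0 (h.riemannLow_eq hp)
  obtain ⟨hu, hs, hC0, hD0⟩ := h.ne_zero hp
  obtain ⟨x, y, hx, hy, hC, hD, hsc⟩ := exists_pdScale (h.regular _ hp)
  constructor
  · intro hE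
    -- The coframe elements proportional to dr and dq lie in different eigenspaces of Ric, so these
    -- two diagonal components already give both equations.
    have h2 := hE 2 2
    have h3 := hE 3 3
    rw [hR, he] at h2 h3
    simp only [pdCoframe_eq, hsc, Fin.sum_univ_four] at h2 h3
    simp only [pdFrame] at h2 h3
    exact ⟨by simpa [hu, hx.ne'] using h2, by simpa [hu, hy.ne'] using h3⟩
  · rintro ⟨h1, h2⟩ a b
    rw [hR, h1, h2, he, Fin.sum_univ_four]
    ring

end

/-! ### Integration of the Einstein equations -/

/-- The trace of the Einstein equations. -/
def EinsteinTrace (Λ ε r q C C1 C2 D D1 D2 : ℝ) : Prop :=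
  (1 + ε * r * q) ^ 2 * (C2 + D2) - 6 * (1 + ε * r * q) * ε * (q * C1 + r * D1)
    + 12 * ε ^ 2 * (q ^ 2 * C + r ^ 2 * D) = -4 * Λ * (r ^ 2 - q ^ 2)

/-- The trace-free part of the Einstein equations. -/
def EinsteinTraceFree (ε r q C C1 C2 D D1 D2 : ℝ) : Prop :=
  (1 + ε * r * q) * (-4 * (C + D) + 4 * (r * C1 + q * D1) - (r ^ 2 - q ^ 2) * (C2 - D2))
    + ε * (-8 * r * q * (C + D) + 2 * (r ^ 2 - q ^ 2) * (q * C1 - r * D1)) = 0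

/-- The trace equation is the sum of the two conditions multiplied by -2(r² - q²). The trace-free
one, multiplied by 1 + εrq, is their difference multiplied by 2(r² - q²)². All these factors are
nonzero. -/
theorem einstein_components_iff {Λ ε r q C C1 C2 D D1 D2 : ℝ} (hu : 1 + ε * r * q ≠ 0)
    (hs : r ^ 2 - q ^ 2 ≠ 0) :
    (curv01 ε (1 + ε * r * q) r q C C1 C2 D + 2 * curv02 ε (1 + ε * r * q) r q C C1 D D1 = Λ ∧
      curv23 ε (1 + ε * r * q) r q C D D1 D2 + 2 * curv02 ε (1 + ε * r * q) r q C C1 D D1 = Λ)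
    ↔ EinsteinTrace Λ ε r q C C1 C2 D D1 D2 ∧ EinsteinTraceFree ε r q C C1 C2 D D1 D2 := by
  have e1 : (1 + ε * r * q) ^ 2 * (C2 + D2) - 6 * (1 + ε * r * q) * ε * (q * C1 + r * D1)
      + 12 * ε ^ 2 * (q ^ 2 * C + r ^ 2 * D)
      = -2 * (r ^ 2 - q ^ 2) * ((curv01 ε (1 + ε * r * q) r q C C1 C2 D
          + 2 * curv02 ε (1 + ε * r * q) r q C C1 D D1)
        + (curv23 ε (1 + ε * r * q) r q C D D1 D2
          + 2 * curv02 ε (1 + ε * r * q) r q C C1 D D1)) := by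
    simp only [curv01, curv02, curv23]
    generalize 1 + ε * r * q = u at hu
    field_simp
    ring
  have e2 : (1 + ε * r * q) * ((1 + ε * r * q) * (-4 * (C + D) + 4 * (r * C1 + q * D1)
        - (r ^ 2 - q ^ 2) * (C2 - D2))
      + ε * (-8 * r * q * (C + D) + 2 * (r ^ 2 - q ^ 2) * (q * C1 - r * D1)))
      = 2 * (r ^ 2 - q ^ 2) ^ 2 * ((curv01 ε (1 + ε * r * q) r q C C1 C2 D
          + 2 * curv02 ε (1 + ε * r * q) r q C C1 D D1)
        - (curv23 ε (1 + ε * r * q) r q C D D1 D2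
          + 2 * curv02 ε (1 + ε * r * q) r q C C1 D D1)) := by
    simp only [curv01, curv02, curv23]
    generalize 1 + ε * r * q = u at hu
    field_simp
    ring
  unfold EinsteinTrace EinsteinTraceFree
  rw [e1]
  constructor
  · rintro ⟨h1, h2⟩
    rw [h1, h2] at e2 ⊢
    refine ⟨by ring, ?_⟩
    apply (mul_eq_zero.1 (e2.trans (by ring))).resolve_left hu
  · rintro ⟨h1, h2⟩
    rw [h2, mul_zero] at e2
    have h3 := (mul_eq_zero.1 e2.symm).resolve_left (by positivity)
    have h4 : -2 * (r ^ 2 - q ^ 2) * ((curv01 ε (1 + ε * r * q) r q C C1 C2 D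
          + 2 * curv02 ε (1 + ε * r * q) r q C C1 D D1)
        + (curv23 ε (1 + ε * r * q) r q C D D1 D2
          + 2 * curv02 ε (1 + ε * r * q) r q C C1 D D1) - 2 * Λ) = 0 := by
      linear_combination h1
    have h5 := (mul_eq_zero.1 h4).resolve_left (by simpa using hs)
    constructor <;> linarith

theorem hasDerivAt_quarticC (b m n k ε Λ r : ℝ) :
    HasDerivAt (quarticC b m n k ε Λ)
      (2 * m + 2 * k * r + 6 * n * ε * r ^ 2 - 4 * (ε ^ 2 * b + Λ / 3) * r ^ 3) r := by
  unfold quarticC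
  have h : HasDerivAt (fun r : ℝ => r) 1 r := hasDerivAt_id r
  refine (((((h.const_mul (2 * m)).const_add (-b)).add ((h.pow 2).const_mul k)).add
    ((h.pow 3).const_mul (2 * n * ε))).sub
    ((h.pow 4).const_mul (ε ^ 2 * b + Λ / 3))).congr_deriv ?_
  norm_num
  ring

theorem hasDerivAt_quarticD (b m n k ε Λ q : ℝ) :
    HasDerivAt (quarticD b m n k ε Λ)
      (2 * n - 2 * k * q + 6 * m * ε * q ^ 2 + 4 * (ε ^ 2 * b + Λ / 3) * q ^ 3) q := by
  unfold quarticD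
  have h : HasDerivAt (fun r : ℝ => r) 1 q := hasDerivAt_id q
  refine (((((h.const_mul (2 * n)).const_add b).sub ((h.pow 2).const_mul k)).add
    ((h.pow 3).const_mul (2 * m * ε))).add
    ((h.pow 4).const_mul (ε ^ 2 * b + Λ / 3))).congr_deriv ?_
  norm_num
  ring

theorem deriv_quarticC (b m n k ε Λ : ℝ) :
    deriv (quarticC b m n k ε Λ) =
      fun r => 2 * m + 2 * k * r + 6 * n * ε * r ^ 2 - 4 * (ε ^ 2 * b + Λ / 3) * r ^ 3 :=
  funext fun r => (hasDerivAt_quarticC b m n k ε Λ r).deriv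

theorem deriv_quarticD (b m n k ε Λ : ℝ) :
    deriv (quarticD b m n k ε Λ) =
      fun q => 2 * n - 2 * k * q + 6 * m * ε * q ^ 2 + 4 * (ε ^ 2 * b + Λ / 3) * q ^ 3 :=
  funext fun q => (hasDerivAt_quarticD b m n k ε Λ q).deriv

theorem deriv_deriv_quarticC (b m n k ε Λ r : ℝ) :
    deriv (deriv (quarticC b m n k ε Λ)) r =
      2 * k + 12 * n * ε * r - 12 * (ε ^ 2 * b + Λ / 3) * r ^ 2 := by
  rw [deriv_quarticC]
  have h : HasDerivAt (fun r : ℝ => r) 1 r := hasDerivAt_id r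
  refine (((((h.const_mul (2 * k)).const_add (2 * m)).add
    ((h.pow 2).const_mul (6 * n * ε))).sub
    ((h.pow 3).const_mul (4 * (ε ^ 2 * b + Λ / 3)))).congr_deriv ?_).deriv
  norm_num
  ring

theorem deriv_deriv_quarticD (b m n k ε Λ q : ℝ) :
    deriv (deriv (quarticD b m n k ε Λ)) q =
      -2 * k + 12 * m * ε * q + 12 * (ε ^ 2 * b + Λ / 3) * q ^ 2 := by
  rw [deriv_quarticD]
  have h : HasDerivAt (fun r : ℝ => r) 1 q := hasDerivAt_id q
  refine (((((h.const_mul (2 * k)).const_sub (2 * n)).add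
    ((h.pow 2).const_mul (6 * m * ε))).add
    ((h.pow 3).const_mul (4 * (ε ^ 2 * b + Λ / 3)))).congr_deriv ?_).deriv
  norm_num
  ring

theorem einstein_quartic (b m n k ε Λ r q : ℝ) :
    EinsteinTrace Λ ε r q (quarticC b m n k ε Λ r) (deriv (quarticC b m n k ε Λ) r)
        (deriv (deriv (quarticC b m n k ε Λ)) r) (quarticD b m n k ε Λ q)
        (deriv (quarticD b m n k ε Λ) q) (deriv (deriv (quarticD b m n k ε Λ)) q) ∧
      EinsteinTraceFree ε r q (quarticC b m n k ε Λ r) (deriv (quarticC b m n k ε Λ) r)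
        (deriv (deriv (quarticC b m n k ε Λ)) r) (quarticD b m n k ε Λ q)
        (deriv (quarticD b m n k ε Λ) q) (deriv (deriv (quarticD b m n k ε Λ)) q) := by
  rw [deriv_deriv_quarticC, deriv_deriv_quarticD, deriv_quarticC, deriv_quarticD]
  constructor
  · unfold EinsteinTrace quarticC quarticD; ring
  · unfold EinsteinTraceFree quarticC quarticD; ring

/-- The numerators of the parameters `b, m, n, k`, recovered from the values and first
derivatives of the quartics for `Λ = 0`; the common denominator is `(r² - q²) (1 + ε r q)³`. -/
noncomputable def paramNum (ε r q c c1 d d1 : ℝ) : Fin 4 → ℝ :=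
  ![q ^ 2 * (1 + 3 * ε * r * q) * c - (1 + ε * r * q) * (r * q ^ 2) * c1
      + r ^ 2 * (1 + 3 * ε * r * q) * d - (1 + ε * r * q) * (r ^ 2 * q) * d1,
    (r + 2 * r ^ 2 * q * ε - 3 * r * q ^ 4 * ε ^ 2) * c
      - (1 + ε * r * q) * (q ^ 2 + r ^ 2 - 2 * r * q ^ 3 * ε) / 2 * c1
      + (r + 2 * r ^ 2 * q * ε - 2 * r ^ 3 * q ^ 2 * ε ^ 2 - r ^ 5 * ε ^ 2) * d
      - (1 + ε * r * q) * (2 * r * q - r ^ 2 * q ^ 2 * ε - r ^ 4 * ε) / 2 * d1,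
    (-q - 2 * r * q ^ 2 * ε + q ^ 5 * ε ^ 2 + 2 * r ^ 2 * q ^ 3 * ε ^ 2) * c
      + (1 + ε * r * q) * (2 * r * q - q ^ 4 * ε - r ^ 2 * q ^ 2 * ε) / 2 * c1
      + (-q - 2 * r * q ^ 2 * ε + 3 * r ^ 4 * q * ε ^ 2) * d
      + (1 + ε * r * q) * (q ^ 2 + r ^ 2 - 2 * r ^ 3 * q * ε) / 2 * d1,
    (-1 + r * q * ε + 3 * q ^ 4 * ε ^ 2 + 8 * r ^ 2 * q ^ 2 * ε ^ 2
        - 3 * r * q ^ 5 * ε ^ 3) * c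
      + (1 + ε * r * q) * (r - 2 * q ^ 3 * ε - 2 * r ^ 2 * q * ε + r * q ^ 4 * ε ^ 2) * c1
      + (-1 + r * q * ε + 8 * r ^ 2 * q ^ 2 * ε ^ 2 + 3 * r ^ 4 * ε ^ 2
        - 3 * r ^ 5 * q * ε ^ 3) * d
      + (1 + ε * r * q) * (q - 2 * r * q ^ 2 * ε - 2 * r ^ 3 * ε + r ^ 4 * q * ε ^ 2) * d1]

noncomputable def paramDen (ε r q : ℝ) : ℝ := (r ^ 2 - q ^ 2) * (1 + ε * r * q) ^ 3

/-- For Λ = 0 the quartics are linear in b, m, n, k; this inverts the linear map from (b, m, n, k)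
to (C, C', D, D') at (r, q). The denominator is nonzero wherever the metric is regular. -/
noncomputable def param (ε r q c c1 d d1 : ℝ) (i : Fin 4) : ℝ :=
  paramNum ε r q c c1 d d1 i / paramDen ε r q

theorem hasDerivAt_div_zero {f g : ℝ → ℝ} {f' g' x : ℝ} (hf : HasDerivAt f f' x)
    (hg : HasDerivAt g g' x) (h0 : g x ≠ 0) (h : f' * g x - f x * g' = 0) :
    HasDerivAt (fun t => f t / g t) 0 x := by
  have h1 := hf.fun_div hg h0
  rwa [h, zero_div] at h1

theorem hasDerivAt_paramDen_left (ε r q : ℝ) :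
    HasDerivAt (fun t => paramDen ε t q)
      (2 * r * (1 + ε * r * q) ^ 3 + (r ^ 2 - q ^ 2) * (3 * ε * q * (1 + ε * r * q) ^ 2)) r := by
  have h : HasDerivAt (fun r : ℝ => r) 1 r := hasDerivAt_id r
  have hu : HasDerivAt (fun t => 1 + ε * t * q) (ε * 1 * q) r :=
    ((h.const_mul ε).mul_const q).const_add 1
  refine (((h.fun_pow 2).sub_const (q ^ 2)).fun_mul (hu.fun_pow 3)).congr_deriv ?_
  push_cast
  ring

theorem hasDerivAt_paramDen_right (ε r q : ℝ) :
    HasDerivAt (fun t => paramDen ε r t)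
      (-(2 * q) * (1 + ε * r * q) ^ 3 + (r ^ 2 - q ^ 2) * (3 * ε * r * (1 + ε * r * q) ^ 2)) q := by
  have h : HasDerivAt (fun r : ℝ => r) 1 q := hasDerivAt_id q
  have hu : HasDerivAt (fun t => 1 + ε * r * t) (ε * r * 1) q :=
    (h.const_mul (ε * r)).const_add 1
  refine (((h.fun_pow 2).const_sub (r ^ 2)).fun_mul (hu.fun_pow 3)).congr_deriv ?_
  push_cast
  ring

/-- The quartics with parameters `param` share the 1-jets of c and d at the point. The equations,
which the quartics also satisfy, determine the second derivative of c from these 1-jets, so c agrees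
with its quartic to second order and the parameters are stationary in r. The proof is the quotient
rule with the equations substituted. -/
theorem hasDerivAt_param_left {ε r q d d1 d2 c2 : ℝ} {c c1 : ℝ → ℝ}
    (hu : 1 + ε * r * q ≠ 0) (hs : r ^ 2 - q ^ 2 ≠ 0)
    (hc : HasDerivAt c (c1 r) r) (hc1 : HasDerivAt c1 c2 r)
    (h1 : EinsteinTrace 0 ε r q (c r) (c1 r) c2 d d1 d2)
    (h2 : EinsteinTraceFree ε r q (c r) (c1 r) c2 d d1 d2) (i : Fin 4) :
    HasDerivAt (fun t => param ε t q (c t) (c1 t) d d1 i) 0 r := by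
  unfold EinsteinTrace at h1
  unfold EinsteinTraceFree at h2
  have hden := hasDerivAt_paramDen_left ε r q
  have h0 : paramDen ε r q ≠ 0 := mul_ne_zero hs (pow_ne_zero 3 hu)
  unfold param
  fin_cases i
  all_goals
    simp only [paramNum, Matrix.cons_val, Fin.reduceFinMk, Fin.mk_one, Fin.zero_eta]
    apply hasDerivAt_div_zero (hg := hden) (h0 := h0)
    case hf =>
      repeat first
        | exact hc
        | exact hc1
        | exact hasDerivAt_id' r
        | exact hasDerivAt_const r _
        | with_reducible apply HasDerivAt.fun_pow
        | with_reducible apply HasDerivAt.fun_add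
        | with_reducible apply HasDerivAt.fun_sub
        | with_reducible apply HasDerivAt.fun_mul
        | with_reducible apply HasDerivAt.div_const
        | with_reducible apply HasDerivAt.fun_neg
    simp only [paramDen]
    push_cast
  -- The combination (r² - q²)·`h1` - (1 + εrq)·`h2` eliminates `d2` and has 2(r² - q²)(1 + εrq)² as
  -- coefficient of `c2`. The multiplier is (1 + εrq)/2 times the coefficient of `c1` in the
  -- numerator; likewise in the other cases.
  · linear_combination (-(1 + ε * r * q) ^ 2 * (r * q ^ 2) / 2)
      * ((r ^ 2 - q ^ 2) * h1 - (1 + ε * r * q) * h2)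
  · linear_combination (-(1 + ε * r * q) ^ 2 * (q ^ 2 + r ^ 2 - 2 * r * q ^ 3 * ε) / 4)
      * ((r ^ 2 - q ^ 2) * h1 - (1 + ε * r * q) * h2)
  · linear_combination ((1 + ε * r * q) ^ 2 * (2 * r * q - q ^ 4 * ε - r ^ 2 * q ^ 2 * ε) / 4)
      * ((r ^ 2 - q ^ 2) * h1 - (1 + ε * r * q) * h2)
  · linear_combination ((1 + ε * r * q) ^ 2
      * (r - 2 * q ^ 3 * ε - 2 * r ^ 2 * q * ε + r * q ^ 4 * ε ^ 2) / 2)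
      * ((r ^ 2 - q ^ 2) * h1 - (1 + ε * r * q) * h2)

theorem hasDerivAt_param_right {ε r q c c1 c2 d2 : ℝ} {d d1 : ℝ → ℝ}
    (hu : 1 + ε * r * q ≠ 0) (hs : r ^ 2 - q ^ 2 ≠ 0)
    (hd : HasDerivAt d (d1 q) q) (hd1 : HasDerivAt d1 d2 q)
    (h1 : EinsteinTrace 0 ε r q c c1 c2 (d q) (d1 q) d2)
    (h2 : EinsteinTraceFree ε r q c c1 c2 (d q) (d1 q) d2) (i : Fin 4) :
    HasDerivAt (fun t => param ε r t c c1 (d t) (d1 t) i) 0 q := by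
  unfold EinsteinTrace at h1
  unfold EinsteinTraceFree at h2
  have hden := hasDerivAt_paramDen_right ε r q
  have h0 : paramDen ε r q ≠ 0 := mul_ne_zero hs (pow_ne_zero 3 hu)
  unfold param
  fin_cases i
  all_goals
    simp only [paramNum, Matrix.cons_val, Fin.reduceFinMk, Fin.mk_one, Fin.zero_eta]
    apply hasDerivAt_div_zero (hg := hden) (h0 := h0)
    case hf =>
      repeat first
        | exact hd
        | exact hd1
        | exact hasDerivAt_id' q
        | exact hasDerivAt_const q _
        | with_reducible apply HasDerivAt.fun_pow
        | with_reducible apply HasDerivAt.fun_add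
        | with_reducible apply HasDerivAt.fun_sub
        | with_reducible apply HasDerivAt.fun_mul
        | with_reducible apply HasDerivAt.div_const
        | with_reducible apply HasDerivAt.fun_neg
    simp only [paramDen]
    push_cast
  -- The opposite sign eliminates `c2` instead; the multiplier comes from the coefficient of `d1`.
  · linear_combination (-(1 + ε * r * q) ^ 2 * (r ^ 2 * q) / 2)
      * ((r ^ 2 - q ^ 2) * h1 + (1 + ε * r * q) * h2)
  · linear_combination (-(1 + ε * r * q) ^ 2 * (2 * r * q - r ^ 2 * q ^ 2 * ε - r ^ 4 * ε) / 4)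
      * ((r ^ 2 - q ^ 2) * h1 + (1 + ε * r * q) * h2)
  · linear_combination ((1 + ε * r * q) ^ 2 * (q ^ 2 + r ^ 2 - 2 * r ^ 3 * q * ε) / 4)
      * ((r ^ 2 - q ^ 2) * h1 + (1 + ε * r * q) * h2)
  · linear_combination ((1 + ε * r * q) ^ 2
      * (q - 2 * r * q ^ 2 * ε - 2 * r ^ 3 * ε + r ^ 4 * q * ε ^ 2) / 2)
      * ((r ^ 2 - q ^ 2) * h1 + (1 + ε * r * q) * h2)

theorem eq_quartic_param {ε r q c c1 d d1 : ℝ} (hu : 1 + ε * r * q ≠ 0)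
    (hs : r ^ 2 - q ^ 2 ≠ 0) :
    c = quarticC (param ε r q c c1 d d1 0) (param ε r q c c1 d d1 1) (param ε r q c c1 d d1 2)
        (param ε r q c c1 d d1 3) ε 0 r ∧
      d = quarticD (param ε r q c c1 d d1 0) (param ε r q c c1 d d1 1)
        (param ε r q c c1 d d1 2) (param ε r q c c1 d d1 3) ε 0 q := by
  have h0 : paramDen ε r q ≠ 0 := mul_ne_zero hs (pow_ne_zero 3 hu)
  simp only [quarticC, quarticD, param]
  constructor <;> field_simp <;> simp only [paramNum, paramDen, Matrix.cons_val] <;> ring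

/-- A function on a connected open subset of the plane whose partial derivatives vanish is
constant. -/
theorem exists_eq_const_of_partial_eq_zero {U : Set (ℝ × ℝ)} (hU : IsOpen U)
    (hc : IsPreconnected U) {F : ℝ → ℝ → ℝ}
    (hd : ∀ u ∈ U, DifferentiableAt ℝ (fun v : ℝ × ℝ => F v.1 v.2) u)
    (h1 : ∀ u ∈ U, HasDerivAt (fun t => F t u.2) 0 u.1)
    (h2 : ∀ u ∈ U, HasDerivAt (fun t => F u.1 t) 0 u.2) :
    ∃ a, ∀ u ∈ U, F u.1 u.2 = a := by
  refine hU.exists_is_const_of_fderiv_eq_zero (𝕜 := ℝ) (f := fun v : ℝ × ℝ => F v.1 v.2) hc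
    (fun u hu => (hd u hu).differentiableWithinAt) fun u hu => ?_
  have e1 : fderiv ℝ (fun v : ℝ × ℝ => F v.1 v.2) u (1, 0) = 0 :=
    HasDerivAt.unique (f := fun t => F t u.2)
      ((hd u hu).hasFDerivAt.comp_hasDerivAt (f := fun t => (t, u.2)) u.1
        ((hasDerivAt_id u.1).prodMk (hasDerivAt_const u.1 u.2))) (h1 u hu)
  have e2 : fderiv ℝ (fun v : ℝ × ℝ => F v.1 v.2) u (0, 1) = 0 :=
    HasDerivAt.unique (f := fun t => F u.1 t)
      ((hd u hu).hasFDerivAt.comp_hasDerivAt (f := fun t => (u.1, t)) u.2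
        ((hasDerivAt_const u.2 u.1).prodMk (hasDerivAt_id u.2))) (h2 u hu)
  ext
  · simpa using e1
  · simpa using e2

/-- C and D are prescribed only on the projections of U. These are open, so an identity there also
determines the derivatives. -/
theorem eventuallyEq_of_mem_image {U : Set (ℝ × ℝ)} (hU : IsOpen U) {f g : ℝ → ℝ}
    {π : ℝ × ℝ → ℝ} (hπ : IsOpenMap π) (h : ∀ u ∈ U, f (π u) = g (π u)) {u : ℝ × ℝ}
    (hu : u ∈ U) : f =ᶠ[nhds (π u)] g := by
  filter_upwards [(hπ U hU).mem_nhds ⟨u, hu, rfl⟩]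
  rintro _ ⟨v, hv, rfl⟩
  exact h v hv

theorem IsPDRegularOn.isEinsteinOn_iff {ε : ℝ} {C D : ℝ → ℝ} {U : Set (ℝ × ℝ)}
    (h : IsPDRegularOn ε C D U) (Λ : ℝ) :
    IsEinsteinOn (pdMetric ε C D) Λ (cylinder U) ↔
      ∀ u ∈ U, EinsteinTrace Λ ε u.1 u.2 (C u.1) (deriv C u.1) (deriv (deriv C) u.1)
          (D u.2) (deriv D u.2) (deriv (deriv D) u.2) ∧
        EinsteinTraceFree ε u.1 u.2 (C u.1) (deriv C u.1) (deriv (deriv C) u.1)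
          (D u.2) (deriv D u.2) (deriv (deriv D) u.2) := by
  constructor
  · intro hE u hu
    -- The equations do not involve τ and φ, so any point of the cylinder over u will do.
    have hp : ![0, 0, u.1, u.2] ∈ cylinder U := hu
    obtain ⟨h0, h1, -⟩ := h.ne_zero hp
    exact (einstein_components_iff h0 h1).1 ((h.einstein_iff hp Λ).1 (hE _ hp))
  · intro hE p hp
    obtain ⟨h0, h1, -⟩ := h.ne_zero hp
    exact (h.einstein_iff hp Λ).2 ((einstein_components_iff h0 h1).2 (hE _ hp))

theorem IsPDRegularOn.isEinsteinOn_of_quartic {ε : ℝ} {C D : ℝ → ℝ} {U : Set (ℝ × ℝ)}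
    (h : IsPDRegularOn ε C D U) {b m n k Λ : ℝ}
    (hq : ∀ u ∈ U, C u.1 = quarticC b m n k ε Λ u.1 ∧ D u.2 = quarticD b m n k ε Λ u.2) :
    IsEinsteinOn (pdMetric ε C D) Λ (cylinder U) := by
  refine (h.isEinsteinOn_iff Λ).2 fun u hu => ?_
  have hC := eventuallyEq_of_mem_image h.isOpen isOpenMap_fst (fun v hv => (hq v hv).1) hu
  have hD := eventuallyEq_of_mem_image h.isOpen isOpenMap_snd (fun v hv => (hq v hv).2) hu
  rw [hC.deriv.deriv_eq, hD.deriv.deriv_eq, hC.deriv_eq, hD.deriv_eq, hC.eq_of_nhds,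
    hD.eq_of_nhds]
  exact einstein_quartic b m n k ε Λ u.1 u.2

theorem differentiableAt_param {ε : ℝ} {u : ℝ × ℝ} {c c1 d d1 : ℝ × ℝ → ℝ}
    (hu : 1 + ε * u.1 * u.2 ≠ 0) (hs : u.1 ^ 2 - u.2 ^ 2 ≠ 0)
    (hc : DifferentiableAt ℝ c u) (hc1 : DifferentiableAt ℝ c1 u)
    (hd : DifferentiableAt ℝ d u) (hd1 : DifferentiableAt ℝ d1 u) (i : Fin 4) :
    DifferentiableAt ℝ (fun v => param ε v.1 v.2 (c v) (c1 v) (d v) (d1 v) i) u := by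
  have hnum : DifferentiableAt ℝ (fun v => paramNum ε v.1 v.2 (c v) (c1 v) (d v) (d1 v) i) u := by
    fin_cases i
    all_goals
      simp only [paramNum, Matrix.cons_val, Fin.reduceFinMk, Fin.mk_one, Fin.zero_eta]
      fun_prop
  have hden : DifferentiableAt ℝ (fun v : ℝ × ℝ => paramDen ε v.1 v.2) u := by
    unfold paramDen
    fun_prop
  have h0 : paramDen ε u.1 u.2 ≠ 0 := mul_ne_zero hs (pow_ne_zero 3 hu)
  simpa only [param, div_eq_mul_inv] using hnum.fun_mul (hden.fun_inv h0)

theorem IsPDRegularOn.exists_quartic {ε : ℝ} {C D : ℝ → ℝ} {U : Set (ℝ × ℝ)}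
    (h : IsPDRegularOn ε C D U) (hc : IsPreconnected U) {Λ : ℝ}
    (hE : IsEinsteinOn (pdMetric ε C D) Λ (cylinder U)) :
    ∃ b m n k : ℝ, ∀ u ∈ U,
      C u.1 = quarticC b m n k ε Λ u.1 ∧ D u.2 = quarticD b m n k ε Λ u.2 := by
  have hE' := (h.isEinsteinOn_iff Λ).1 hE
  -- The pair -Λr⁴/3, Λq⁴/3 is a particular solution, because (1 + εrq)² - 2(1 + εrq)εrq + (εrq)² =
  -- 1. Subtracting it leaves the equations with Λ = 0.
  set c : ℝ → ℝ := fun r => C r + Λ / 3 * r ^ 4 with hcdef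
  set d : ℝ → ℝ := fun q => D q - Λ / 3 * q ^ 4 with hddef
  set c1 : ℝ → ℝ := fun r => deriv C r + Λ / 3 * (4 * r ^ 3) with hc1def
  set d1 : ℝ → ℝ := fun q => deriv D q - Λ / 3 * (4 * q ^ 3) with hd1def
  have hoC := isOpenMap_fst U h.isOpen
  have hoD := isOpenMap_snd U h.isOpen
  have dC : ∀ u ∈ U, HasDerivAt C (deriv C u.1) u.1 := fun u hu =>
    ((h.smooth_left.differentiableOn (by simp)).differentiableAt
      (hoC.mem_nhds ⟨u, hu, rfl⟩)).hasDerivAt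
  have dD : ∀ u ∈ U, HasDerivAt D (deriv D u.2) u.2 := fun u hu =>
    ((h.smooth_right.differentiableOn (by simp)).differentiableAt
      (hoD.mem_nhds ⟨u, hu, rfl⟩)).hasDerivAt
  have dC1 : ∀ u ∈ U, HasDerivAt (deriv C) (deriv (deriv C) u.1) u.1 := fun u hu =>
    (((h.smooth_left.deriv_of_isOpen hoC (m := ∞) (by simp)).differentiableOn
      (by simp)).differentiableAt (hoC.mem_nhds ⟨u, hu, rfl⟩)).hasDerivAt
  have dD1 : ∀ u ∈ U, HasDerivAt (deriv D) (deriv (deriv D) u.2) u.2 := fun u hu =>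
    (((h.smooth_right.deriv_of_isOpen hoD (m := ∞) (by simp)).differentiableOn
      (by simp)).differentiableAt (hoD.mem_nhds ⟨u, hu, rfl⟩)).hasDerivAt
  have dc : ∀ u ∈ U, HasDerivAt c (c1 u.1) u.1 := fun u hu =>
    ((dC u hu).fun_add ((hasDerivAt_pow 4 u.1).const_mul (Λ / 3))).congr_deriv (by simp [c1])
  have dd : ∀ u ∈ U, HasDerivAt d (d1 u.2) u.2 := fun u hu =>
    ((dD u hu).fun_sub ((hasDerivAt_pow 4 u.2).const_mul (Λ / 3))).congr_deriv (by simp [d1])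
  have dc1 : ∀ u ∈ U, HasDerivAt c1 (deriv (deriv C) u.1 + 4 * Λ * u.1 ^ 2) u.1 := fun u hu =>
    ((dC1 u hu).fun_add (((hasDerivAt_pow 3 u.1).const_mul 4).const_mul (Λ / 3))).congr_deriv
      (by norm_num; ring)
  have dd1 : ∀ u ∈ U, HasDerivAt d1 (deriv (deriv D) u.2 - 4 * Λ * u.2 ^ 2) u.2 := fun u hu =>
    ((dD1 u hu).fun_sub (((hasDerivAt_pow 3 u.2).const_mul 4).const_mul (Λ / 3))).congr_deriv
      (by norm_num; ring)
  have e1 : ∀ u ∈ U, EinsteinTrace 0 ε u.1 u.2 (c u.1) (c1 u.1)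
      (deriv (deriv C) u.1 + 4 * Λ * u.1 ^ 2) (d u.2) (d1 u.2)
      (deriv (deriv D) u.2 - 4 * Λ * u.2 ^ 2) := fun u hu => by
    have := (hE' u hu).1
    unfold EinsteinTrace at this ⊢
    simp only [c, c1, d, d1]
    linear_combination this
  have e2 : ∀ u ∈ U, EinsteinTraceFree ε u.1 u.2 (c u.1) (c1 u.1)
      (deriv (deriv C) u.1 + 4 * Λ * u.1 ^ 2) (d u.2) (d1 u.2)
      (deriv (deriv D) u.2 - 4 * Λ * u.2 ^ 2) := fun u hu => by
    have := (hE' u hu).2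
    unfold EinsteinTraceFree at this ⊢
    simp only [c, c1, d, d1]
    linear_combination this
  have hne : ∀ u ∈ U, 1 + ε * u.1 * u.2 ≠ 0 ∧ u.1 ^ 2 - u.2 ^ 2 ≠ 0 := fun u hu =>
    ⟨(h.regular u hu).2.1, sub_ne_zero.2 (h.regular u hu).1⟩
  have key : ∀ i : Fin 4, ∃ a, ∀ u ∈ U,
      param ε u.1 u.2 (c u.1) (c1 u.1) (d u.2) (d1 u.2) i = a := fun i => by
    refine exists_eq_const_of_partial_eq_zero
      (F := fun r q => param ε r q (c r) (c1 r) (d q) (d1 q) i) h.isOpen hc (fun u hu => ?_)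
      (fun u hu => hasDerivAt_param_left (hne u hu).1 (hne u hu).2 (dc u hu) (dc1 u hu)
        (e1 u hu) (e2 u hu) i)
      (fun u hu => hasDerivAt_param_right (hne u hu).1 (hne u hu).2 (dd u hu) (dd1 u hu)
        (e1 u hu) (e2 u hu) i)
    have k1 : DifferentiableAt ℝ (fun v : ℝ × ℝ => c v.1) u :=
      (dc u hu).differentiableAt.comp u differentiableAt_fst
    have k2 : DifferentiableAt ℝ (fun v : ℝ × ℝ => c1 v.1) u :=
      (dc1 u hu).differentiableAt.comp u differentiableAt_fst
    have k3 : DifferentiableAt ℝ (fun v : ℝ × ℝ => d v.2) u :=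
      (dd u hu).differentiableAt.comp u differentiableAt_snd
    have k4 : DifferentiableAt ℝ (fun v : ℝ × ℝ => d1 v.2) u :=
      (dd1 u hu).differentiableAt.comp u differentiableAt_snd
    exact differentiableAt_param (hne u hu).1 (hne u hu).2 k1 k2 k3 k4 i
  choose a ha using key
  refine ⟨a 0, a 1, a 2, a 3, fun u hu => ?_⟩
  have := eq_quartic_param (c := c u.1) (c1 := c1 u.1) (d := d u.2) (d1 := d1 u.2)
    (hne u hu).1 (hne u hu).2
  simp only [ha _ u hu] at this
  simp only [c, d, quarticC, quarticD] at this ⊢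
  exact ⟨by linear_combination this.1, by linear_combination this.2⟩

/-! ### Coordinate changes -/

theorem pullback_of_diagonal {φ : Fin 4 → ℝ → ℝ} {Φ : Pt → Pt} (hΦ : ∀ p a, Φ p a = φ a (p a))
    (g : MetricField) (p : Pt) (a b : Fin 4) :
    pullback Φ g p a b = deriv (φ a) (p a) * deriv (φ b) (p b) * g (Φ p) a b := by
  simp only [pullback, hΦ, Matrix.of_apply, pderiv_of_apply]
  simp

noncomputable def squareChangeCoord : Fin 4 → ℝ → ℝ :=
  ![fun t => t / 2, fun t => t / 2, fun t => t ^ 2, fun t => t ^ 2]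

theorem squareChange_apply (p : Pt) (a : Fin 4) :
    squareChange p a = squareChangeCoord a (p a) := by
  fin_cases a <;> rfl

theorem deriv_squareChangeCoord (p : Pt) (a : Fin 4) :
    deriv (squareChangeCoord a) (p a) = ![1 / 2, 1 / 2, 2 * p 2, 2 * p 3] a := by
  fin_cases a <;> simp [squareChangeCoord]

theorem pullback_squareChange (ε : ℝ) (F G : ℝ → ℝ) {p : Pt} (h2 : 0 < p 2) (h3 : 0 < p 3) :
    pullback squareChange
        (ambitoricMetric (fun x y => 1 + ε * Real.sqrt (x * y)) (fun z => z) F G) p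
      = pdMetric ε (fun r => F (r ^ 2) / (4 * r)) (fun q => G (q ^ 2) / (4 * q)) p := by
  have e1 : Real.sqrt (p 2 ^ 2 * p 3 ^ 2) = p 2 * p 3 := by
    rw [← mul_pow, Real.sqrt_sq (by positivity)]
  have e2 : squareChange p 2 = p 2 ^ 2 := rfl
  have e3 : squareChange p 3 = p 3 ^ 2 := rfl
  ext a b
  rw [pullback_of_diagonal squareChange_apply, deriv_squareChangeCoord, deriv_squareChangeCoord]
  simp only [ambitoricMetric, pdMetric, e1, e2, e3, Real.sqrt_sq h2.le, Real.sqrt_sq h3.le,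
    ← mul_assoc]
  generalize F (p 2 ^ 2) = f
  generalize G (p 3 ^ 2) = g
  have h2' := h2.ne'
  have h3' := h3.ne'
  generalize p 2 = r at *
  generalize p 3 = q at *
  generalize (1 + ε * r * q) = u
  generalize r ^ 2 - q ^ 2 = s
  fin_cases a <;> fin_cases b <;>
    simp [symSq] <;> field_simp <;> ring_nf

theorem pullback_rescale (b m n k ε Λ : ℝ) (hk : 0 < k) (p : Pt) :
    pullback (rescale (Real.sqrt k)) (plebanskiDemianski b m n k ε Λ) p
      = plebanskiDemianski (b / k ^ 2) (m / Real.sqrt k ^ 3) (n / Real.sqrt k ^ 3) 1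
          (k * ε) Λ p := by
  obtain ⟨s, hs, rfl⟩ : ∃ s : ℝ, 0 < s ∧ k = s ^ 2 :=
    ⟨Real.sqrt k, Real.sqrt_pos.2 hk, (Real.sq_sqrt hk.le).symm⟩
  rw [Real.sqrt_sq hs.le]
  have hΦ : ∀ (p : Pt) (a : Fin 4), rescale s p a =
      (![fun t => t / s, fun t => t / s ^ 3, fun t => s * t, fun t => s * t] :
        Fin 4 → ℝ → ℝ) a (p a) := fun p a => by
    fin_cases a <;> rfl
  -- The quartics are homogeneous of degree 4 when r, q have weight 1, b weight 4, m and n weight 3,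
  -- k weight 2, ε weight -2 and Λ weight 0.
  have hC : quarticC b m n (s ^ 2) ε Λ (s * p 2)
      = s ^ 4 * quarticC (b / (s ^ 2) ^ 2) (m / s ^ 3) (n / s ^ 3) 1 (s ^ 2 * ε) Λ (p 2) := by
    simp only [quarticC]; field_simp
  have hD : quarticD b m n (s ^ 2) ε Λ (s * p 3)
      = s ^ 4 * quarticD (b / (s ^ 2) ^ 2) (m / s ^ 3) (n / s ^ 3) 1 (s ^ 2 * ε) Λ (p 3) := by
    simp only [quarticD]; field_simp
  have e2 : rescale s p 2 = s * p 2 := rfl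
  have e3 : rescale s p 3 = s * p 3 := rfl
  have e4 : 1 + ε * (s * p 2) * (s * p 3) = 1 + s ^ 2 * ε * p 2 * p 3 := by ring
  have e5 : (s * p 2) ^ 2 - (s * p 3) ^ 2 = s ^ 2 * (p 2 ^ 2 - p 3 ^ 2) := by ring
  ext a b
  rw [pullback_of_diagonal hΦ]
  simp only [plebanskiDemianski, pdMetric, e2, e3, e4, e5, hC, hD]
  generalize quarticC _ _ _ _ _ _ _ = C
  generalize quarticD _ _ _ _ _ _ _ = D
  generalize (1 + s ^ 2 * ε * p 2 * p 3) = u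
  generalize p 2 ^ 2 - p 3 ^ 2 = v
  fin_cases a <;> fin_cases b <;>
    simp [symSq] <;> field_simp

theorem pullback_boyerLindquist {M a : ℝ} (ha : a ≠ 0) {p : Pt} (hs : Real.sin (p 3) ≠ 0)
    (hρ : p 2 ^ 2 - a ^ 2 * Real.cos (p 3) ^ 2 ≠ 0) :
    pullback (boyerLindquist a) (plebanskiDemianski (a ^ 2) (-M) 0 1 0 0) p
      = kerrMetric M a p := by
  -- Since τ = t - aϕ mixes two coordinates, `pullback_of_diagonal` does not apply and the Jacobian
  -- is computed row by row. After the substitution C becomes Δ and D becomes a² sin² θ, which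
  -- cancels the factor in dq² = a² sin² θ dθ².
  have d0 : ∀ c, pderiv c (fun z => boyerLindquist a z 0) p = ![1, -a, 0, 0] c := fun c => by
    simp only [boyerLindquist, pderiv, Matrix.cons_val]
    fin_cases c <;> simp [Function.update_of_ne]
  have d1 : ∀ c, pderiv c (fun z => boyerLindquist a z 1) p = ![0, -1 / a, 0, 0] c := fun c => by
    simp only [boyerLindquist, Matrix.cons_val]
    rw [pderiv_of_apply (fun t => -t / a)]
    fin_cases c <;> simp
  have d2 : ∀ c, pderiv c (fun z => boyerLindquist a z 2) p = ![0, 0, 1, 0] c := fun c => by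
    simp only [boyerLindquist, Matrix.cons_val]
    rw [pderiv_of_apply (fun t => t)]
    fin_cases c <;> simp
  have d3 : ∀ c, pderiv c (fun z => boyerLindquist a z 3) p
      = ![0, 0, 0, -a * Real.sin (p 3)] c := fun c => by
    simp only [boyerLindquist, Matrix.cons_val]
    rw [pderiv_of_apply (fun t => a * Real.cos t)]
    fin_cases c <;> simp
  have e2 : boyerLindquist a p 2 = p 2 := rfl
  have e3 : boyerLindquist a p 3 = a * Real.cos (p 3) := rfl
  have hsc := Real.sin_sq_add_cos_sq (p 3)
  have hD : quarticD (a ^ 2) (-M) 0 1 0 0 (a * Real.cos (p 3)) = a ^ 2 * Real.sin (p 3) ^ 2 := by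
    simp only [quarticD]; linear_combination (-a ^ 2) * hsc
  have hC : quarticC (a ^ 2) (-M) 0 1 0 0 (p 2) = p 2 ^ 2 - 2 * M * p 2 - a ^ 2 := by
    simp only [quarticC]; ring
  have hc2 : Real.cos (p 3) ^ 2 = 1 - Real.sin (p 3) ^ 2 := by linear_combination hsc
  ext c d
  simp only [pullback, Matrix.of_apply, Fin.sum_univ_four, d0, d1, d2, d3, plebanskiDemianski,
    pdMetric, e2, e3, hC, hD, kerrMetric, mul_pow]
  rw [hc2] at hρ ⊢
  generalize Real.sin (p 3) = σ at *
  generalize p 2 = r at *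
  fin_cases c <;> fin_cases d <;>
    simp [symSq] <;> field_simp <;> ring

/-! ### Curvature of the quartic metrics and type D ⊗ D -/

theorem curv_quartic {ε r q b m n k Λ α β : ℝ} (hp : r + q ≠ 0) (hm : r - q ≠ 0)
    (hα : α = (n - m) * ((1 + ε * r * q) / (r + q)) ^ 3)
    (hβ : β = -(n + m) * ((1 + ε * r * q) / (r - q)) ^ 3) :
    curv01 ε (1 + ε * r * q) r q (quarticC b m n k ε Λ r) (deriv (quarticC b m n k ε Λ) r)
        (deriv (deriv (quarticC b m n k ε Λ)) r) (quarticD b m n k ε Λ q) = α + β + Λ / 3 ∧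
      curv23 ε (1 + ε * r * q) r q (quarticC b m n k ε Λ r) (quarticD b m n k ε Λ q)
        (deriv (quarticD b m n k ε Λ) q) (deriv (deriv (quarticD b m n k ε Λ)) q)
        = α + β + Λ / 3 ∧
      curvMixed (1 + ε * r * q) r q (quarticC b m n k ε Λ r) (deriv (quarticC b m n k ε Λ) r)
        (quarticD b m n k ε Λ q) (deriv (quarticD b m n k ε Λ) q) = β - α ∧
      curv02 ε (1 + ε * r * q) r q (quarticC b m n k ε Λ r) (deriv (quarticC b m n k ε Λ) r)
        (quarticD b m n k ε Λ q) (deriv (quarticD b m n k ε Λ) q)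
        = -(α + β) / 2 + Λ / 3 := by
  -- Factoring the denominator separates the poles: α has its pole along r + q = 0 and β along r - q
  -- = 0.
  have hs : r ^ 2 - q ^ 2 = (r + q) * (r - q) := by ring
  rw [deriv_deriv_quarticC, deriv_deriv_quarticD, deriv_quarticC, deriv_quarticD, hα, hβ]
  simp only [curv01, curv23, curvMixed, curv02, quarticC, quarticD, hs]
  refine ⟨?_, ?_, ?_, ?_⟩ <;> field_simp <;> ring

theorem isPDRegularOn_quartic (b m n k ε Λ : ℝ) :
    IsPDRegularOn ε (quarticC b m n k ε Λ) (quarticD b m n k ε Λ)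
      {u | PDRegularAt ε (quarticC b m n k ε Λ) (quarticD b m n k ε Λ) u.1 u.2} where
  isOpen := by
    -- Division is not continuous at s = 0. The product condition is polynomial and equivalent even
    -- there, since a / 0 = 0 and a * 0 = 0.
    have hpos : ∀ {a s : ℝ}, 0 < a / s ↔ 0 < a * s := fun {a s} => by
      rw [div_pos_iff, mul_pos_iff]
    simp only [PDRegularAt, hpos, Set.ofPred_and]
    have c1 : Continuous fun u : ℝ × ℝ => quarticC b m n k ε Λ u.1 := by
      unfold quarticC; fun_prop
    have c2 : Continuous fun u : ℝ × ℝ => quarticD b m n k ε Λ u.2 := by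
      unfold quarticD; fun_prop
    exact (isOpen_ne_fun (by fun_prop) (by fun_prop)).inter
      ((isOpen_ne_fun (by fun_prop) (by fun_prop)).inter
        ((isOpen_lt (by fun_prop) (by fun_prop)).inter
          (isOpen_lt (by fun_prop) (by fun_prop))))
  smooth_left := ContDiff.contDiffOn (by unfold quarticC; fun_prop)
  smooth_right := ContDiff.contDiffOn (by unfold quarticD; fun_prop)
  regular := fun _ hu => hu

theorem isTypeDDAt_plebanskiDemianski {b m n k ε Λ : ℝ} {p : Pt}
    (hp : PDRegularAt ε (quarticC b m n k ε Λ) (quarticD b m n k ε Λ) (p 2) (p 3)) :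
    IsTypeDDAt (plebanskiDemianski b m n k ε Λ) p
      (pdCoframe ε (quarticC b m n k ε Λ) (quarticD b m n k ε Λ) p)
      ((n - m) * ((1 + ε * p 2 * p 3) / (p 2 + p 3)) ^ 3)
      (-(n + m) * ((1 + ε * p 2 * p 3) / (p 2 - p 3)) ^ 3) := by
  have hU := isPDRegularOn_quartic b m n k ε Λ
  have hpU : p ∈ cylinder {u : ℝ × ℝ |
      PDRegularAt ε (quarticC b m n k ε Λ) (quarticD b m n k ε Λ) u.1 u.2} := hp
  have he := isOrthonormalCoframeAt_pdCoframe hp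
  have h0 := hU.isSmoothMetricOn.det_ne_zero p hpU
  have hE := hU.isEinsteinOn_of_quartic (b := b) (m := m) (n := n) (k := k) (Λ := Λ)
    (fun _ _ => ⟨rfl, rfl⟩) p hpU
  have hs : (p 2 + p 3) * (p 2 - p 3) ≠ 0 := by
    have := sub_ne_zero.2 hp.1
    rwa [sq_sub_sq] at this
  obtain ⟨k1, k2, k3, k4⟩ := curv_quartic (b := b) (k := k) (Λ := Λ) (left_ne_zero_of_mul hs)
    (right_ne_zero_of_mul hs) (α := (n - m) * ((1 + ε * p 2 * p 3) / (p 2 + p 3)) ^ 3)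
    (β := -(n + m) * ((1 + ε * p 2 * p 3) / (p 2 - p 3)) ^ 3) rfl rfl
  refine isTypeDDAt_of_frameCurvature he h0 fun a b c d => ?_
  rw [weyl_of_einstein he h0 hE, hU.riemannLow_eq hpU, k1, k2, k3, k4]
  unfold frameCurvature
  ring

/-! ### The ambitoric ansatz -/

/-- The region where the ambitoric metric with `H = 1 + ε √(xy)`, `R = z` is Riemannian. -/
structure IsAmbitoricRegularOn (ε : ℝ) (F G : ℝ → ℝ) (V : Set (ℝ × ℝ)) : Prop where
  isOpen : IsOpen V
  smooth_left : ContDiffOn ℝ ∞ F (Prod.fst '' V)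
  smooth_right : ContDiffOn ℝ ∞ G (Prod.snd '' V)
  regular : ∀ v ∈ V, 0 < v.1 ∧ 0 < v.2 ∧ v.1 ≠ v.2 ∧ 1 + ε * Real.sqrt (v.1 * v.2) ≠ 0 ∧
    0 < F v.1 / (v.1 - v.2) ∧ 0 < G v.2 / (v.1 - v.2)

/-- The preimage of `V` under `x = r²`, `y = q²` with `r, q > 0`. -/
def squareRoots (V : Set (ℝ × ℝ)) : Set (ℝ × ℝ) :=
  {u | 0 < u.1 ∧ 0 < u.2 ∧ (u.1 ^ 2, u.2 ^ 2) ∈ V}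

theorem symSq_comm (u : Fin 4 → ℝ) (a b : Fin 4) : symSq u a b = symSq u b a := by
  simp [symSq, Matrix.vecMulVec_apply, mul_comm]

theorem contDiff_symSq {f : Pt → Fin 4 → ℝ} (hf : ∀ a, ContDiff ℝ ∞ fun p => f p a)
    (a b : Fin 4) : ContDiff ℝ ∞ fun p => symSq (f p) a b := by
  simp only [symSq, Matrix.vecMulVec_apply]
  exact (hf a).mul (hf b)

namespace IsAmbitoricRegularOn

variable {ε : ℝ} {F G : ℝ → ℝ} {V : Set (ℝ × ℝ)}

theorem isPDRegularOn (h : IsAmbitoricRegularOn ε F G V) :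
    IsPDRegularOn ε (fun r => F (r ^ 2) / (4 * r)) (fun q => G (q ^ 2) / (4 * q))
      (squareRoots V) where
  isOpen := (isOpen_lt continuous_const continuous_fst).inter
    ((isOpen_lt continuous_const continuous_snd).inter (h.isOpen.preimage (by fun_prop)))
  smooth_left := by
    refine ContDiffOn.div (h.smooth_left.comp (contDiff_id.pow 2).contDiffOn ?_) (by fun_prop) ?_
    · rintro _ ⟨u, hu, rfl⟩
      exact ⟨_, hu.2.2, rfl⟩
    · rintro _ ⟨u, hu, rfl⟩
      exact mul_ne_zero four_ne_zero hu.1.ne'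
  smooth_right := by
    refine ContDiffOn.div (h.smooth_right.comp (contDiff_id.pow 2).contDiffOn ?_) (by fun_prop) ?_
    · rintro _ ⟨u, hu, rfl⟩
      exact ⟨_, hu.2.2, rfl⟩
    · rintro _ ⟨u, hu, rfl⟩
      exact mul_ne_zero four_ne_zero hu.2.1.ne'
  regular := by
    rintro ⟨r, q⟩ ⟨hr, hq, hV⟩
    obtain ⟨-, -, h3, h4, h5, h6⟩ := h.regular _ hV
    simp only at hr hq h3 h4 h5 h6
    rw [← mul_pow, Real.sqrt_sq (by positivity), ← mul_assoc] at h4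
    refine ⟨h3, h4, ?_, ?_⟩
    · rw [div_right_comm]; positivity
    · rw [div_right_comm]; positivity

theorem exists_squareChange_eq (h : IsAmbitoricRegularOn ε F G V) {p : Pt}
    (hp : p ∈ cylinder V) : ∃ z ∈ cylinder (squareRoots V), squareChange z = p := by
  obtain ⟨h1, h2, -⟩ := h.regular _ hp
  simp only at h1 h2
  -- The factors 2 undo the halving of τ and φ in `squareChange`.
  refine ⟨![2 * p 0, 2 * p 1, Real.sqrt (p 2), Real.sqrt (p 3)],
    ⟨Real.sqrt_pos.2 h1, Real.sqrt_pos.2 h2, ?_⟩, ?_⟩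
  · have hp' : (p 2, p 3) ∈ V := hp
    simpa [Real.sq_sqrt h1.le, Real.sq_sqrt h2.le] using hp'
  · ext a
    fin_cases a <;> simp [squareChange, Real.sq_sqrt h1.le, Real.sq_sqrt h2.le]

theorem isDiagonalChange :
    IsDiagonalChange squareChangeCoord squareChange (cylinder (squareRoots V)) (cylinder V) where
  apply := squareChange_apply
  smooth a := by
    fin_cases a <;>
      simp only [squareChangeCoord, Matrix.cons_val, Fin.reduceFinMk, Fin.mk_one,
        Fin.zero_eta] <;> fun_prop
  deriv_ne_zero p hp a := by
    have h2 : p 2 ≠ 0 := hp.1.ne'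
    have h3 : p 3 ≠ 0 := hp.2.1.ne'
    rw [deriv_squareChangeCoord]
    fin_cases a <;> simp [h2, h3]
  mapsTo p hp := hp.2.2

theorem pdMetric_apply (ε : ℝ) (F G : ℝ → ℝ) {p : Pt} (hp : p ∈ cylinder (squareRoots V))
    (a b : Fin 4) :
    pdMetric ε (fun r => F (r ^ 2) / (4 * r)) (fun q => G (q ^ 2) / (4 * q)) p a b
      = deriv (squareChangeCoord a) (p a) * deriv (squareChangeCoord b) (p b)
        * ambitoricMetric (fun x y => 1 + ε * Real.sqrt (x * y)) (fun z => z) F G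
          (squareChange p) a b := by
  rw [← pullback_squareChange ε F G hp.1 hp.2.1, pullback_of_diagonal squareChange_apply]

theorem isSmoothMetricOn (h : IsAmbitoricRegularOn ε F G V) :
    IsSmoothMetricOn
      (ambitoricMetric (fun x y => 1 + ε * Real.sqrt (x * y)) (fun z => z) F G)
      (cylinder V) where
  smooth a b := by
    have n2 : ∀ p ∈ cylinder V, p 2 ≠ 0 := fun p hp => (h.regular _ hp).1.ne'
    have n3 : ∀ p ∈ cylinder V, p 3 ≠ 0 := fun p hp => (h.regular _ hp).2.1.ne'
    have ns : ∀ p ∈ cylinder V, p 2 - p 3 ≠ 0 := fun p hp =>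
      sub_ne_zero.2 (h.regular _ hp).2.2.1
    have nA : ∀ p ∈ cylinder V, Real.sqrt (p 2) ≠ 0 := fun p hp =>
      (Real.sqrt_pos.2 (h.regular _ hp).1).ne'
    have nB : ∀ p ∈ cylinder V, Real.sqrt (p 3) ≠ 0 := fun p hp =>
      (Real.sqrt_pos.2 (h.regular _ hp).2.1).ne'
    have nF : ∀ p ∈ cylinder V, F (p 2) ≠ 0 := fun p hp h0 => by
      simpa [h0] using (h.regular _ hp).2.2.2.2.1
    have nG : ∀ p ∈ cylinder V, G (p 3) ≠ 0 := fun p hp h0 => by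
      simpa [h0] using (h.regular _ hp).2.2.2.2.2
    have s2 : ContDiff ℝ ∞ fun p : Pt => p 2 := by fun_prop
    have s3 : ContDiff ℝ ∞ fun p : Pt => p 3 := by fun_prop
    have ss : ContDiffOn ℝ ∞ (fun p : Pt => p 2 - p 3) (cylinder V) := (s2.sub s3).contDiffOn
    have sA : ContDiffOn ℝ ∞ (fun p : Pt => Real.sqrt (p 2)) (cylinder V) :=
      s2.contDiffOn.sqrt n2
    have sB : ContDiffOn ℝ ∞ (fun p : Pt => Real.sqrt (p 3)) (cylinder V) :=
      s3.contDiffOn.sqrt n3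
    have sF : ContDiffOn ℝ ∞ (fun p : Pt => F (p 2)) (cylinder V) :=
      h.smooth_left.comp s2.contDiffOn fun p hp => ⟨_, hp, rfl⟩
    have sG : ContDiffOn ℝ ∞ (fun p : Pt => G (p 3)) (cylinder V) :=
      h.smooth_right.comp s3.contDiffOn fun p hp => ⟨_, hp, rfl⟩
    have sH : ContDiffOn ℝ ∞ (fun p : Pt => 1 / (1 + ε * Real.sqrt (p 2 * p 3)) ^ 2)
        (cylinder V) :=
      contDiffOn_const.div ((contDiffOn_const.add (contDiffOn_const.mul
        ((s2.mul s3).contDiffOn.sqrt fun p hp => mul_ne_zero (n2 p hp) (n3 p hp)))).pow 2)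
        fun p hp => pow_ne_zero 2 (h.regular _ hp).2.2.2.1
    have v1 := contDiff_symSq (f := fun p => ![1, -p 3, 0, 0])
      (fun a => by fin_cases a <;> simp <;> fun_prop) a b
    have v2 := contDiff_symSq (f := fun _ => ![0, 0, 1, 0]) (fun a => contDiff_const) a b
    have v3 := contDiff_symSq (f := fun _ => ![0, 0, 0, 1]) (fun a => contDiff_const) a b
    have v4 := contDiff_symSq (f := fun p => ![1, -p 2, 0, 0])
      (fun a => by fin_cases a <;> simp <;> fun_prop) a b
    simp only [ambitoricMetric, Matrix.smul_apply, Matrix.add_apply, smul_eq_mul]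
    exact sH.mul (((((sF.div (sA.mul ss) fun p hp => mul_ne_zero (nA p hp) (ns p hp)).mul
      v1.contDiffOn).add ((ss.div (sF.mul sA) fun p hp =>
        mul_ne_zero (nF p hp) (nA p hp)).mul v2.contDiffOn)).add
      ((ss.div (sB.mul sG) fun p hp => mul_ne_zero (nB p hp) (nG p hp)).mul v3.contDiffOn)).add
      ((sG.div (sB.mul ss) fun p hp => mul_ne_zero (nB p hp) (ns p hp)).mul v4.contDiffOn))
  symm p _ a b := by
    simp only [ambitoricMetric, Matrix.smul_apply, Matrix.add_apply, symSq_comm _ a b]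
  -- Nondegeneracy is inherited from `pdMetric`, whose matrix is J g J with g the ambitoric matrix
  -- and J the diagonal Jacobian.
  det_ne_zero p hp h0 := by
    obtain ⟨z, hz, rfl⟩ := h.exists_squareChange_eq hp
    refine h.isPDRegularOn.isSmoothMetricOn.det_ne_zero z hz ?_
    have : pdMetric ε (fun r => F (r ^ 2) / (4 * r)) (fun q => G (q ^ 2) / (4 * q)) z
        = Matrix.diagonal (fun a => deriv (squareChangeCoord a) (z a))
          * ambitoricMetric (fun x y => 1 + ε * Real.sqrt (x * y)) (fun z => z) F G
            (squareChange z)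
          * Matrix.diagonal (fun a => deriv (squareChangeCoord a) (z a)) := by
      ext a b
      rw [Matrix.mul_diagonal, Matrix.diagonal_mul, pdMetric_apply ε F G hz]
      ring
    rw [this, Matrix.det_mul, Matrix.det_mul, h0]
    ring

/-- Ric and g acquire the same nonzero Jacobian factors, and every point of the cylinder over V is
the image of one with r, q > 0. -/
theorem isEinsteinOn_iff (h : IsAmbitoricRegularOn ε F G V) (Λ : ℝ) :
    IsEinsteinOn (ambitoricMetric (fun x y => 1 + ε * Real.sqrt (x * y)) (fun z => z) F G) Λ
        (cylinder V) ↔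
      IsEinsteinOn (pdMetric ε (fun r => F (r ^ 2) / (4 * r)) (fun q => G (q ^ 2) / (4 * q))) Λ
        (cylinder (squareRoots V)) := by
  have hr : ∀ {z : Pt} (_ : z ∈ cylinder (squareRoots V)) (a b : Fin 4), _ :=
    fun {z} hz => (isDiagonalChange (V := V)).ricci_eq h.isSmoothMetricOn
      (isOpen_cylinder h.isOpen) (isOpen_cylinder h.isPDRegularOn.isOpen)
      (fun z hz => pdMetric_apply ε F G hz) hz
  constructor
  · intro hE z hz a b
    rw [hr hz, pdMetric_apply ε F G hz, hE _ (isDiagonalChange.mapsTo z hz)]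
    ring
  · intro hE p hp a b
    obtain ⟨z, hz, rfl⟩ := h.exists_squareChange_eq hp
    have h1 := hE z hz a b
    rw [hr hz, pdMetric_apply ε F G hz] at h1
    refine mul_left_cancel₀ (mul_ne_zero (isDiagonalChange.deriv_ne_zero z hz a)
      (isDiagonalChange.deriv_ne_zero z hz b)) (h1.trans ?_)
    ring

/-- The classification in r, q needs a connected domain; this one is the image of V under the
continuous map taking both square roots. -/
theorem isPreconnected_squareRoots (h : IsAmbitoricRegularOn ε F G V) (hV : IsPreconnected V) :
    IsPreconnected (squareRoots V) := by
  have : squareRoots V = (fun v : ℝ × ℝ => (Real.sqrt v.1, Real.sqrt v.2)) '' V := by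
    ext ⟨r, q⟩
    constructor
    · rintro ⟨hr, hq, hV⟩
      exact ⟨_, hV, by simp only [Real.sqrt_sq hr.le, Real.sqrt_sq hq.le]⟩
    · rintro ⟨v, hv, hvu⟩
      obtain ⟨h1, h2, -⟩ := h.regular v hv
      obtain ⟨rfl, rfl⟩ := Prod.mk.inj hvu
      refine ⟨Real.sqrt_pos.2 h1, Real.sqrt_pos.2 h2, ?_⟩
      simpa only [Real.sq_sqrt h1.le, Real.sq_sqrt h2.le] using hv
  rw [this]
  exact hV.image _ (by fun_prop)

theorem isEinsteinOn_iff_exists_quartic (h : IsAmbitoricRegularOn ε F G V)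
    (hV : IsPreconnected V) (Λ : ℝ) :
    IsEinsteinOn (ambitoricMetric (fun x y => 1 + ε * Real.sqrt (x * y)) (fun z => z) F G) Λ
        (cylinder V) ↔
      ∃ b m n k : ℝ, ∀ v ∈ V,
        F v.1 = 4 * Real.sqrt v.1 * quarticC b m n k ε Λ (Real.sqrt v.1) ∧
        G v.2 = 4 * Real.sqrt v.2 * quarticD b m n k ε Λ (Real.sqrt v.2) := by
  rw [h.isEinsteinOn_iff]
  constructor
  · intro hE
    obtain ⟨b, m, n, k, hq⟩ := h.isPDRegularOn.exists_quartic (h.isPreconnected_squareRoots hV) hE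
    refine ⟨b, m, n, k, fun v hv => ?_⟩
    obtain ⟨h1, h2, -⟩ := h.regular v hv
    have h3 := Real.sqrt_pos.2 h1
    have h4 := Real.sqrt_pos.2 h2
    obtain ⟨e1, e2⟩ := hq (Real.sqrt v.1, Real.sqrt v.2) ⟨h3, h4, by
      simpa only [Real.sq_sqrt h1.le, Real.sq_sqrt h2.le] using hv⟩
    simp only [Real.sq_sqrt h1.le, Real.sq_sqrt h2.le] at e1 e2
    rw [← e1, ← e2]
    constructor <;> field_simp
  · rintro ⟨b, m, n, k, hq⟩
    refine h.isPDRegularOn.isEinsteinOn_of_quartic (b := b) (m := m) (n := n) (k := k) fun u hu => ?_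
    obtain ⟨e1, e2⟩ := hq _ hu.2.2
    have h1 := hu.1
    have h2 := hu.2.1
    simp only [Real.sqrt_sq h1.le, Real.sqrt_sq h2.le] at e1 e2
    simp only [e1, e2]
    constructor <;> field_simp

end IsAmbitoricRegularOn

end Ambitoric

/-! ### The main theorem -/

theorem mainTheorem8 (ε Λ : ℝ) :
    -- In the case `H = 1 + ε √(xy)`, `R = z`, the substitution `x = r²`, `y = q²` with `r, q > 0`
    -- turns the ambitoric ansatz into the metric in the coordinates `(τ, φ, r, q)`.
    (∀ F G : ℝ → ℝ, ∀ p : Pt, 0 < p 2 → 0 < p 3 →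
      pullback squareChange
          (ambitoricMetric (fun x y => 1 + ε * Real.sqrt (x * y)) (fun z => z) F G) p
        = pdMetric ε (fun r => F (r ^ 2) / (4 * r)) (fun q => G (q ^ 2) / (4 * q)) p) ∧
    -- The ansatz, in this case, is Einstein exactly for the quartics.
    (∀ (V : Set (ℝ × ℝ)) (F G : ℝ → ℝ), IsOpen V → IsPreconnected V →
      ContDiffOn ℝ ∞ F (Prod.fst '' V) → ContDiffOn ℝ ∞ G (Prod.snd '' V) →
      (∀ v ∈ V, 0 < v.1 ∧ 0 < v.2 ∧ v.1 ≠ v.2 ∧ 1 + ε * Real.sqrt (v.1 * v.2) ≠ 0 ∧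
        0 < F v.1 / (v.1 - v.2) ∧ 0 < G v.2 / (v.1 - v.2)) →
      (IsEinsteinOn
          (ambitoricMetric (fun x y => 1 + ε * Real.sqrt (x * y)) (fun z => z) F G)
          Λ (cylinder V) ↔
        ∃ b m n k : ℝ, ∀ v ∈ V,
          F v.1 = 4 * Real.sqrt v.1 * quarticC b m n k ε Λ (Real.sqrt v.1) ∧
          G v.2 = 4 * Real.sqrt v.2 * quarticD b m n k ε Λ (Real.sqrt v.2))) ∧
    -- The metric in the coordinates `(τ, φ, r, q)` is Einstein exactly for the quartics.
    (∀ (U : Set (ℝ × ℝ)) (C D : ℝ → ℝ), IsOpen U → IsPreconnected U →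
      ContDiffOn ℝ ∞ C (Prod.fst '' U) → ContDiffOn ℝ ∞ D (Prod.snd '' U) →
      (∀ u ∈ U, PDRegularAt ε C D u.1 u.2) →
      (IsEinsteinOn (pdMetric ε C D) Λ (cylinder U) ↔
        ∃ b m n k : ℝ, ∀ u ∈ U,
          C u.1 = quarticC b m n k ε Λ u.1 ∧ D u.2 = quarticD b m n k ε Λ u.2)) ∧
    -- If `k > 0`, rescaling `r` and `q` normalises `k` to `1`.
    (∀ b m n k : ℝ, 0 < k → ∀ p : Pt,
      pullback (rescale (Real.sqrt k)) (plebanskiDemianski b m n k ε Λ) p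
        = plebanskiDemianski (b / k ^ 2) (m / Real.sqrt k ^ 3) (n / Real.sqrt k ^ 3) 1
            (k * ε) Λ p) ∧
    -- These metrics are of type `D ⊗ D`.
    (∀ (b m n k : ℝ) (p : Pt),
      PDRegularAt ε (quarticC b m n k ε Λ) (quarticD b m n k ε Λ) (p 2) (p 3) →
      IsTypeDDAt (plebanskiDemianski b m n k ε Λ) p
        (pdCoframe ε (quarticC b m n k ε Λ) (quarticD b m n k ε Λ) p)
        ((n - m) * ((1 + ε * p 2 * p 3) / (p 2 + p 3)) ^ 3)
        (-(n + m) * ((1 + ε * p 2 * p 3) / (p 2 - p 3)) ^ 3)) ∧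
    -- Euclidean Kerr is the case `Λ = ε = n = 0`, with `b = a²` and `m = -M`.
    (∀ M a : ℝ, a ≠ 0 → ∀ p : Pt, Real.sin (p 3) ≠ 0 →
      p 2 ^ 2 - a ^ 2 * Real.cos (p 3) ^ 2 ≠ 0 → p 2 ^ 2 - 2 * M * p 2 - a ^ 2 ≠ 0 →
      pullback (boyerLindquist a) (plebanskiDemianski (a ^ 2) (-M) 0 1 0 0) p
        = kerrMetric M a p) := by
  refine ⟨fun F G p h2 h3 => pullback_squareChange ε F G h2 h3,
    fun V F G hV hc hF hG hr =>
      IsAmbitoricRegularOn.isEinsteinOn_iff_exists_quartic ⟨hV, hF, hG, hr⟩ hc Λ,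
    fun U C D hU hc hC hD hr => ?_,
    fun b m n k hk p => pullback_rescale b m n k ε Λ hk p,
    fun b m n k p hp => isTypeDDAt_plebanskiDemianski hp,
    fun M a ha p hs hρ _ => pullback_boyerLindquist ha hs hρ⟩
  have h : IsPDRegularOn ε C D U := ⟨hU, hC, hD, hr⟩
  exact ⟨h.exists_quartic hc, fun ⟨_, _, _, _, hq⟩ => h.isEinsteinOn_of_quartic hq⟩
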